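/- **Setting.** Let $G$ be a compact connected Lie group with Lie algebra $\mathfrak g$ and a fixed $\mathrm{Ad}$-invariant inner product, $T\subset G$ a maximal torus with Lie algebra $\mathfrak t$, and $\mathfrak t^\perp$ the orthogonal complement of $\mathfrak t$ in $\mathfrak g$. Let $(M,\omega,\Phi)$ be a quasi-Hamiltonian $G$-space: a $G$-manifold $M$ with a $G$-invariant 2-form $\omega$ and a smooth equivariant map $\Phi:M\to G$ such that $d_G\omega=-\Phi^*\eta_G$, where $\eta_G(X)=\tfrac1{12}\theta^L\cdot[\theta^L,\theta^L]-\tfrac12(\theta^L+\theta^R)\cdot X$ and $(d_G\alpha)(X)=d\alpha(X)-\iota(X_M)\alpha(X)$, and such that $\ker\omega_m\cap\ker d_m\Phi=0$ for all $m\in M$; here $X_M(m)=\frac{d}{ds}\big|_{s=0}\exp(-sX)\cdot m$. Let $\epsilon>0$ be such that $(t,Y)\mapsto t\exp Y$ is a diffeomorphism from $T\times B_\epsilon(\mathfrak t^\perp)$ onto an open subset $\mathcal T$ of $G$, let $\pi_T:\mathcal T\to T$ be the resulting projection, and put $\mathcal X=\Phi^{-1}(\mathcal T)$, $\Phi_a=\pi_T\circ\Phi:\mathcal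 X\to T$. Let $\hat{\mathcal X}=\mathcal X\times_T\mathfrak t$ be the fibre product of $\Phi_a$ and $\exp:\mathfrak t\to T$, a covering space of $\mathcal X$ with the lifted $T$-action, and let $\hat\Phi_a:\hat{\mathcal X}\to\mathfrak t$ be the projection. For a subset $K\subset\mathfrak t$, $\hat{\mathcal X}^{K}$ is the set of common zeros of the vector fields $X_{\hat{\mathcal X}}$, $X\in K$. Let $\mathfrak t_s$, $s\in\mathcal S$, be the subalgebras of $\mathfrak t$ that occur as infinitesimal stabilizers in $\mathfrak t$ of points of $\mathcal X$. Let $\mathcal W$ be the collection of all affine subspaces $\Delta\subset\mathfrak t$ that are translates of the orthogonal complement in $\mathfrak t$ of some $\mathfrak t_s$ and contain $\hat\Phi_a(C)$ for some connected component $C$ of $\hat{\mathcal X}^{\mathfrak t_s}$. For $\Delta\in\mathcal W$ let $\mathfrak t_\Delta\subset\mathfrak t$ be the subspace orthogonal to $\Delta$, $\mathfrak t_\Delta^\perp$ its orthogonal complement in $\mathfrak t$, and $\mathrm{pr}_\Delta$ the orthogonal projection of $\mathfrak t$ onto $\Delta$. Call $\gamma\in\mathfrak t$ *generic* if for all $\Delta,\Delta'\in\mathcal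 W$ and all open faces $\sigma$ of the Stiefel diagram (the arrangement of the hyperplanes $\{\xi\in\mathfrak t:\langle\alpha,\xi\rangle=n\}$, $\alpha$ a real root, $n\in\mathbb Z$), (1) $\Delta'\subsetneq\Delta$ implies $\mathrm{pr}_\Delta(\gamma)\neq\mathrm{pr}_{\Delta'}(\gamma)$, and (2) $\mathrm{pr}_\Delta(\gamma)\in\sigma$ implies that $\Delta$ is contained in the affine span of $\sigma$. For $\beta\in\mathfrak t$ put $\bar\beta=\beta-\gamma$ and $\mathcal Z_\beta=\hat{\mathcal X}^{\bar\beta}\cap\hat\Phi_a^{-1}(\beta)$. **Statement.** Let $\gamma\in\mathfrak t$ be generic. (a) For every $\beta\in\mathfrak t$, $$\mathcal Z_\beta=\bigsqcup_{\Delta\in\mathcal W,\ \mathrm{pr}_\Delta(\gamma)=\beta}\hat{\mathcal X}^{\mathfrak t_\Delta}\cap\hat\Phi_a^{-1}(\beta),$$ and this union is disjoint. Now let $\Delta\in\mathcal W$, $\beta=\mathrm{pr}_\Delta(\gamma)$ and $p\in\hat{\mathcal X}^{\mathfrak t_\Delta}\cap\hat\Phi_a^{-1}(\beta)$. (b) The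 stabilizer of $p$ in $\mathfrak t$ is exactly $\mathfrak t_\Delta$. Hence $\mathfrak t_\Delta^\perp$ acts locally freely on $\hat{\mathcal X}^{\mathfrak t_\Delta}\cap\hat\Phi_a^{-1}(\beta)$: if $X\in\mathfrak t_\Delta^\perp$ and $X_{\hat{\mathcal X}}(p)=0$, then $X=0$. (c) $\bar\beta\in\mathfrak t_\Delta$, and $\bar\beta$ acts with non-zero weights on the fibre $T_p\hat{\mathcal X}/T_p\hat{\mathcal X}^{\mathfrak t_\Delta}$ of the normal bundle $\nu(\hat{\mathcal X}^{\mathfrak t_\Delta},\hat{\mathcal X})$: every weight $\alpha\in\mathfrak t_\Delta^*$ of $\mathfrak t_\Delta$ on this space satisfies $\alpha(\bar\beta)\neq0$, and $\bar\beta$ annihilates no non-zero normal vector. -/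

import Mathlib

open scoped Manifold ContDiff

noncomputable section

namespace QHam

/-! ### Compact Lie groups: exponential map, adjoint action, maximal tori, roots -/

section LieGroups

variable (E : Type*) [NormedAddCommGroup E] [NormedSpace ℝ E]
variable (G : Type*) [TopologicalSpace G] [ChartedSpace E G] [Group G]

/-- The Lie algebra `𝔤 = T_1 G` of `G`. -/
abbrev LieAlg : Type _ := GroupLieAlgebra 𝓘(ℝ, E) G

variable {E G}

/-- `c` is the one-parameter subgroup of `G` with initial velocity `X`: the integral curve through
`1` of the left-invariant vector field determined by `X`. -/
def IsOneParam (X : LieAlg E G) (c : ℝ → G) : Prop :=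
  c 0 = 1 ∧ IsMIntegralCurve (I := 𝓘(ℝ, E)) c (mulInvariantVectorField X)

open Classical in
/-- The exponential map `𝔤 → G`, `exp X = c 1` where `c` is the one-parameter subgroup with velocity
`X` (which exists and is unique in a Lie group). -/
def exp (X : LieAlg E G) : G :=
  if h : ∃ c : ℝ → G, IsOneParam X c then h.choose 1 else 1

/-- The adjoint action: the derivative at `1` of the conjugation `h ↦ g h g⁻¹`. -/
def Ad (g : G) : LieAlg E G →L[ℝ] LieAlg E G :=
  mfderiv 𝓘(ℝ, E) 𝓘(ℝ, E) (fun h : G => g * h * g⁻¹) 1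

/-- The left Maurer-Cartan form `θ^L`. -/
def thetaL (g : G) : TangentSpace 𝓘(ℝ, E) g →L[ℝ] LieAlg E G :=
  mfderiv 𝓘(ℝ, E) 𝓘(ℝ, E) (fun h : G => g⁻¹ * h) g

/-- The right Maurer-Cartan form `θ^R`. -/
def thetaR (g : G) : TangentSpace 𝓘(ℝ, E) g →L[ℝ] LieAlg E G :=
  mfderiv 𝓘(ℝ, E) 𝓘(ℝ, E) (fun h : G => h * g⁻¹) g

variable (E G) in
/-- An `Ad`-invariant inner product on `𝔤`. -/
structure InvariantInnerProduct where
  form : LinearMap.BilinForm ℝ (LieAlg E G)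
  symm : ∀ X Y, form X Y = form Y X
  pos : ∀ X, X ≠ 0 → 0 < form X X
  invariant : ∀ (g : G) X Y, form (Ad g X) (Ad g Y) = form X Y

/-- The Cartan 3-form `η = (1/12) θ^L · [θ^L, θ^L]`.  As `[θ, θ](v, w) = 2 [θ v, θ w]` and the wedge
product sums over three cyclic permutations, `η(u, v, w) = (1/2) θ^L u · [θ^L v, θ^L w]`. -/
def cartanForm (B : InvariantInnerProduct E G) (g : G) (u v w : TangentSpace 𝓘(ℝ, E) g) : ℝ :=
  (1 / 2) * B.form (thetaL g u) ⁅thetaL g v, thetaL g w⁆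

variable (G) in
/-- A maximal torus: a subgroup that is maximal among the closed connected abelian ones. -/
structure MaximalTorus extends Subgroup G where
  closed : IsClosed (carrier : Set G)
  connected : IsConnected (carrier : Set G)
  comm : ∀ a ∈ carrier, ∀ b ∈ carrier, a * b = b * a
  maximal : ∀ S : Subgroup G, IsClosed (S : Set G) → IsConnected (S : Set G) →
    (∀ a ∈ S, ∀ b ∈ S, a * b = b * a) → toSubgroup ≤ S → S ≤ toSubgroup

/-- The Lie algebra `𝔱` of `T`: all `X` with `exp (s X) ∈ T` for every real `s`.  For the abelian
group `T` these `X` form a linear subspace, so that taking the span adds nothing. -/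
def MaximalTorus.lie (T : MaximalTorus G) : Submodule ℝ (LieAlg E G) :=
  Submodule.span ℝ {X | ∀ s : ℝ, exp (s • X) ∈ T.carrier}

/-- The (real) roots: the non-zero linear forms `α` on `𝔱` for which some non-zero vector `U + i V` of
`𝔤 ⊗ ℂ` satisfies `[X, U + i V] = 2 π i α(X) (U + i V)` for all `X ∈ 𝔱`. -/
def roots (T : MaximalTorus G) : Set (Module.Dual ℝ (T.lie (E := E))) :=
  {α | α ≠ 0 ∧ ∃ U V : LieAlg E G, (U ≠ 0 ∨ V ≠ 0) ∧ ∀ X : T.lie (E := E),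
    ⁅(X : LieAlg E G), U⁆ = -(2 * Real.pi * α X) • V ∧
    ⁅(X : LieAlg E G), V⁆ = (2 * Real.pi * α X) • U}

/-- The open faces of the Stiefel diagram, the arrangement of the hyperplanes `α = n` in `𝔱` for `α` a
root and `n` an integer: two points lie in the same open face iff they have the same position (below,
on, above) with respect to every hyperplane. -/
def stiefelFaces (T : MaximalTorus G) : Set (Set (T.lie (E := E))) :=
  {σ | ∃ ξ, σ = {ζ | ∀ α ∈ roots T, ∀ n : ℤ,
    SignType.sign (α ζ - (n : ℝ)) = SignType.sign (α ξ - (n : ℝ))}}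

variable (B : InvariantInnerProduct E G) (T : MaximalTorus G)

/-- The orthogonal complement inside `𝔱` of a subspace of `𝔱`. -/
def perp (K : Submodule ℝ (T.lie (E := E))) : Submodule ℝ (T.lie (E := E)) :=
  (B.form.restrict T.lie).orthogonal K

/-- For an affine subspace `Δ` of `𝔱`, the subspace `𝔱_Δ` orthogonal to `Δ`. -/
def orth (Δ : AffineSubspace ℝ (T.lie (E := E))) : Submodule ℝ (T.lie (E := E)) :=
  perp B T Δ.direction

/-- `pr_Δ(x) = y`: the point `y` of `Δ` is the orthogonal projection of `x` onto `Δ`. -/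
def IsProj (Δ : AffineSubspace ℝ (T.lie (E := E))) (x y : T.lie (E := E)) : Prop :=
  y ∈ Δ ∧ x - y ∈ orth B T Δ

/-- The map `r : G × 𝔤 → G`, `r(a, Y) = a exp Y`.  The second factor is written `E`, which is the
type underlying `𝔤 = T_1 G`, so that smoothness into it makes sense. -/
def r (p : G × E) : G := p.1 * exp (show LieAlg E G from p.2)

/-- `T × B_ε(𝔱^⊥)`, where `𝔱^⊥` is the orthogonal complement of `𝔱` in `𝔤`. -/
def tubeDomain (ε : ℝ) : Set (G × E) :=
  {p | p.1 ∈ T.carrier ∧ (show LieAlg E G from p.2) ∈ B.form.orthogonal T.lie ∧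
    B.form (show LieAlg E G from p.2) (show LieAlg E G from p.2) < ε ^ 2}

/-- A radius `ε` small enough that `r(t, Y) = t exp Y` restricts to a diffeomorphism from
`T × B_ε(𝔱^⊥)` onto an open subset `𝒯` of `G`. -/
structure Tube where
  ε : ℝ
  pos : 0 < ε
  injOn : Set.InjOn (r (E := E) (G := G)) (tubeDomain B T ε)
  isOpen : IsOpen (r '' tubeDomain B T ε)
  smooth_inv : ContMDiffOn 𝓘(ℝ, E) (𝓘(ℝ, E).prod 𝓘(ℝ, E)) ∞
    (Function.invFunOn r (tubeDomain B T ε)) (r '' tubeDomain B T ε)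

variable {B T}

/-- The tubular neighbourhood `𝒯` of `T` in `G`. -/
def Tube.nhd (N : Tube B T) : Set G := r '' tubeDomain B T N.ε

/-- The projection `π_T : 𝒯 ≅ T × B_ε(𝔱^⊥) → T` (used on `𝒯` only). -/
def Tube.proj (N : Tube B T) (g : G) : G := (Function.invFunOn r (tubeDomain B T N.ε) g).1

end LieGroups

/-! ### Quasi-Hamiltonian spaces -/

section Forms

variable {F : Type*} [NormedAddCommGroup F] [NormedSpace ℝ F]
variable {M : Type*} [TopologicalSpace M] [ChartedSpace F M]

/-- The expression of a 2-form `τ` on `M` in the preferred chart at `p`. -/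
def formInChart (τ : ∀ m : M, TangentSpace 𝓘(ℝ, F) m [⋀^Fin 2]→L[ℝ] ℝ) (p : M) (y : F) :
    F [⋀^Fin 2]→L[ℝ] ℝ :=
  (τ ((extChartAt 𝓘(ℝ, F) p).symm y)).compContinuousLinearMap
    (mfderiv 𝓘(ℝ, F) 𝓘(ℝ, F) (extChartAt 𝓘(ℝ, F) p).symm y)

/-- Smoothness of a 2-form. -/
def SmoothForm (τ : ∀ m : M, TangentSpace 𝓘(ℝ, F) m [⋀^Fin 2]→L[ℝ] ℝ) : Prop :=
  ∀ p : M, ContDiffOn ℝ ∞ (formInChart τ p) (extChartAt 𝓘(ℝ, F) p).target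

/-- The exterior derivative of a 2-form at `p`, computed in the preferred chart at `p` (which is the
chart that identifies `T_p M` with the model space). -/
def dForm (τ : ∀ m : M, TangentSpace 𝓘(ℝ, F) m [⋀^Fin 2]→L[ℝ] ℝ) (p : M) :
    TangentSpace 𝓘(ℝ, F) p [⋀^Fin 3]→L[ℝ] ℝ :=
  (show F [⋀^Fin 3]→L[ℝ] ℝ from extDeriv (formInChart τ p) (extChartAt 𝓘(ℝ, F) p p))

end Forms

section QHamiltonian

variable {E : Type*} [NormedAddCommGroup E] [NormedSpace ℝ E]
variable {G : Type*} [TopologicalSpace G] [ChartedSpace E G] [Group G]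
variable {F : Type*} [NormedAddCommGroup F] [NormedSpace ℝ F]
variable {M : Type*} [TopologicalSpace M] [ChartedSpace F M] [MulAction G M]

variable (F) in
/-- The derivative at `m` of the action of `a ∈ G`. -/
def dAct (a : G) (m : M) : TangentSpace 𝓘(ℝ, F) m →L[ℝ] TangentSpace 𝓘(ℝ, F) (a • m) :=
  mfderiv 𝓘(ℝ, F) 𝓘(ℝ, F) (fun y : M => a • y) m

variable (E G F) in
/-- The generating vector fields `X_M(m) = d/ds|_{s=0} exp (-s X) • m`, as a linear map of `X`. -/
def gen (m : M) : LieAlg E G →L[ℝ] TangentSpace 𝓘(ℝ, F) m :=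
  (show LieAlg E G →L[ℝ] TangentSpace 𝓘(ℝ, F) m from
    -(mfderiv 𝓘(ℝ, E) 𝓘(ℝ, F) (fun a : G => a • m) 1))

variable (E F) in
/-- The linear map `X ↦ X_M(m)` restricted to `𝔱`; its kernel is the infinitesimal stabilizer of `m`
in `𝔱`. -/
def genT (T : MaximalTorus G) (m : M) : T.lie (E := E) →ₗ[ℝ] TangentSpace 𝓘(ℝ, F) m :=
  (gen E G F m).toLinearMap ∘ₗ T.lie.subtype

variable (F M) in
/-- A quasi-Hamiltonian `G`-space structure on the `G`-manifold `M`: an invariant 2-form `ω` and an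
equivariant smooth map `Φ : M → G` with `d_G ω = -Φ^* η_G`, where `d_G α (X) = d (α(X)) - ι(X_M) α(X)` and
`η_G(X) = η - (1/2) (θ^L + θ^R) · X`, such that `ker ω_m ∩ ker d_m Φ = 0` for all `m`.  The equation
`d_G ω = -Φ^* η_G` is split into its parts of degree `0` and `1` in `X`. -/
structure QHamiltonianSpace (B : InvariantInnerProduct E G) where
  form : ∀ m : M, TangentSpace 𝓘(ℝ, F) m [⋀^Fin 2]→L[ℝ] ℝ
  Φ : M → G
  smooth_form : SmoothForm form
  smooth_Φ : ContMDiff 𝓘(ℝ, F) 𝓘(ℝ, E) ∞ Φ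
  invariant : ∀ (a : G) (m : M) (u v : TangentSpace 𝓘(ℝ, F) m),
    form (a • m) ![dAct F a m u, dAct F a m v] = form m ![u, v]
  equivariant : ∀ (a : G) (m : M), Φ (a • m) = a * Φ m * a⁻¹
  d_form : ∀ (m : M) (u v w : TangentSpace 𝓘(ℝ, F) m),
    dForm form m ![u, v, w] =
      -cartanForm B (Φ m) (mfderiv 𝓘(ℝ, F) 𝓘(ℝ, E) Φ m u) (mfderiv 𝓘(ℝ, F) 𝓘(ℝ, E) Φ m v)
        (mfderiv 𝓘(ℝ, F) 𝓘(ℝ, E) Φ m w)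
  moment : ∀ (m : M) (X : LieAlg E G) (v : TangentSpace 𝓘(ℝ, F) m),
    -form m ![gen E G F m X, v] =
      (1 / 2) * B.form (thetaL (Φ m) (mfderiv 𝓘(ℝ, F) 𝓘(ℝ, E) Φ m v) +
        thetaR (Φ m) (mfderiv 𝓘(ℝ, F) 𝓘(ℝ, E) Φ m v)) X
  minimal : ∀ (m : M) (v : TangentSpace 𝓘(ℝ, F) m),
    (∀ w, form m ![v, w] = 0) → mfderiv 𝓘(ℝ, F) 𝓘(ℝ, E) Φ m v = 0 → v = 0

/-! ### The covering of the abelianization -/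

variable {B : InvariantInnerProduct E G} {T : MaximalTorus G}
variable (N : Tube B T) (Q : QHamiltonianSpace F M B)

/-- The open subset `𝒳 = Φ⁻¹(𝒯)` of `M`. -/
def calX : Set M := Q.Φ ⁻¹' N.nhd

/-- The map `Φ_a = π_T ∘ Φ : 𝒳 → T` (used on `𝒳` only). -/
def PhiA (m : M) : G := N.proj (Q.Φ m)

/-- The fibre product `X̂ = 𝒳 ×_T 𝔱` of `Φ_a : 𝒳 → T` and `exp : 𝔱 → T`, with the topology induced
from `M × 𝔱`. -/
abbrev Xhat : Type _ :=
  {p : M × (T.lie (E := E)) // p.1 ∈ calX N Q ∧ PhiA N Q p.1 = exp (p.2 : LieAlg E G)}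

variable {N Q}

/-- The covering projection `X̂ → 𝒳 ⊆ M`.  It is a local diffeomorphism, and `T_p X̂` is identified
with `T_{p.pt} M` by means of it. -/
def Xhat.pt (p : Xhat N Q) : M := p.1.1

/-- The moment map `Φ̂_a : X̂ → 𝔱`. -/
def Xhat.moment (p : Xhat N Q) : T.lie (E := E) := p.1.2

/-- The generating vector field `X_{X̂}` of `X ∈ 𝔱` at `p`.  The action of `T` on `X̂` is
`a • (m, ξ) = (a • m, ξ)`, so this is the lift of `X_M`. -/
def Xhat.gen (p : Xhat N Q) : T.lie (E := E) →ₗ[ℝ] TangentSpace 𝓘(ℝ, F) p.pt :=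
  genT E F T p.pt

/-- The infinitesimal stabilizer in `𝔱` of `p ∈ X̂`. -/
def Xhat.stab (p : Xhat N Q) : Submodule ℝ (T.lie (E := E)) := LinearMap.ker p.gen

variable (N Q)

/-- The subspaces `𝔱_s` of `𝔱`, `s ∈ 𝒮`: the infinitesimal stabilizers of the points of `𝒳`. -/
def stabilizers : Set (Submodule ℝ (T.lie (E := E))) :=
  {K | ∃ m ∈ calX N Q, K = LinearMap.ker (genT E F T m)}

/-- The fixed point set `X̂^K` of a subset `K` of `𝔱`. -/
def fixedSet (K : Set (T.lie (E := E))) : Set (Xhat N Q) := {p | ∀ X ∈ K, p.gen X = 0}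

/-- The collection `𝒲` of affine subspaces `Δ` of `𝔱`: the translates `Δ` of `𝔱_s^⊥`, `s ∈ 𝒮`, into
which `Φ̂_a` maps some connected component of `X̂^{𝔱_s}`. -/
def calW : Set (AffineSubspace ℝ (T.lie (E := E))) :=
  {Δ | ∃ K ∈ stabilizers N Q, ∃ p ∈ fixedSet N Q K, Δ.direction = perp B T K ∧
    ∀ q ∈ connectedComponentIn (fixedSet N Q K) p, q.moment ∈ Δ}

/-- The two genericity conditions on `γ ∈ 𝔱`. -/
def IsGeneric (γ : T.lie (E := E)) : Prop :=
  (∀ Δ ∈ calW N Q, ∀ Δ' ∈ calW N Q, Δ' < Δ →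
    ∀ β β', IsProj B T Δ γ β → IsProj B T Δ' γ β' → β ≠ β') ∧
  (∀ Δ ∈ calW N Q, ∀ σ ∈ stiefelFaces (E := E) T, ∀ β, IsProj B T Δ γ β → β ∈ σ →
    Δ ≤ affineSpan ℝ σ)

/-- The `β`-component `𝒵_β = X̂^{β - γ} ∩ Φ̂_a⁻¹(β)` of the localizing set of `Φ̂_a - γ`. -/
def calZ (γ β : T.lie (E := E)) : Set (Xhat N Q) :=
  fixedSet N Q {β - γ} ∩ {p | p.moment = β}

/-- The piece `X̂^{𝔱_Δ} ∩ Φ̂_a⁻¹(β)`. -/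
def piece (Δ : AffineSubspace ℝ (T.lie (E := E))) (β : T.lie (E := E)) : Set (Xhat N Q) :=
  fixedSet N Q (orth B T Δ : Set (T.lie (E := E))) ∩ {p | p.moment = β}

variable {N Q}

/-- The tangent space at `p` of a submanifold `S` of `X̂`, spanned by the velocities at `p` of smooth
curves in `S`, as a subspace of `T_p X̂`. -/
def tangentTo (S : Set (Xhat N Q)) (p : Xhat N Q) :
    Submodule ℝ (TangentSpace 𝓘(ℝ, F) p.pt) :=
  Submodule.span ℝ {w | ∃ (δ : ℝ) (c : ℝ → Xhat N Q), 0 < δ ∧ c 0 = p ∧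
    (∀ s ∈ Set.Ioo (-δ) δ, c s ∈ S) ∧ ContinuousOn c (Set.Ioo (-δ) δ) ∧
    ContMDiffOn 𝓘(ℝ, ℝ) 𝓘(ℝ, F) ∞ (fun s => (c s).pt) (Set.Ioo (-δ) δ) ∧
    w = (show F from mfderiv 𝓘(ℝ, ℝ) 𝓘(ℝ, F) (fun s => (c s).pt) 0 (1 : ℝ))}

/-- The fibre at `p` of the normal bundle `ν(S, X̂)` of a submanifold `S` of `X̂`. -/
abbrev NormalSpace (S : Set (Xhat N Q)) (p : Xhat N Q) : Type _ :=
  TangentSpace 𝓘(ℝ, F) p.pt ⧸ tangentTo S p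

/-- For `X` in the infinitesimal stabilizer of `p`: the infinitesimal action of `X` on `T_p X̂`,
`w ↦ d/ds|_{s=0} d_p(exp (s X)) w`.  (The points `exp (s X) • p` all equal `p`, and so the derivatives
`d_p(exp (s X))` are endomorphisms of one vector space.) -/
def linAct (p : Xhat N Q) (X : T.lie (E := E)) :
    TangentSpace 𝓘(ℝ, F) p.pt →L[ℝ] TangentSpace 𝓘(ℝ, F) p.pt :=
  (show F →L[ℝ] F from deriv (fun s : ℝ =>
    (show F →L[ℝ] F from dAct F (exp (s • (X : LieAlg E G))) p.pt)) 0)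

/-- `α` is a weight of the action of the Lie algebra `K` on the normal space of `X̂^K` at `p`: some
non-zero vector `u + i v` of the complexified normal space satisfies
`X · (u + i v) = 2 π i α(X) (u + i v)` for all `X ∈ K`. -/
def IsNormalWeight (K : Submodule ℝ (T.lie (E := E))) (p : Xhat N Q) (α : Module.Dual ℝ K) :
    Prop :=
  ∃ u v : TangentSpace 𝓘(ℝ, F) p.pt,
    ((Submodule.Quotient.mk u : NormalSpace (fixedSet N Q K) p) ≠ 0 ∨
      (Submodule.Quotient.mk v : NormalSpace (fixedSet N Q K) p) ≠ 0) ∧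
    ∀ X : K,
      (Submodule.Quotient.mk (linAct p X u) : NormalSpace (fixedSet N Q K) p) =
        -(2 * Real.pi * α X) • Submodule.Quotient.mk v ∧
      (Submodule.Quotient.mk (linAct p X v) : NormalSpace (fixedSet N Q K) p) =
        (2 * Real.pi * α X) • Submodule.Quotient.mk u

end QHamiltonian

end QHam

end

/-! For `p ∈ X̂` with infinitesimal stabilizer `𝔨 ⊆ 𝔱` put `Δ_p = Φ̂_a(p) + 𝔨^⊥`. The whole theorem
rests on `Δ_p ∈ 𝒲`, and more generally on `Φ̂_a(p) + K^⊥ ∈ 𝒲` for every infinitesimal stabilizer `K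
⊆ 𝔨` (`mk'_mem_calW`). This says that `⟨Φ̂_a, X⟩` is locally constant on the zeros of `X`
(`eventually_bE_momE_eq`). At a zero `m` of `X` the moment condition makes `θ^L + θ^R`, pulled back
by `Φ`, orthogonal to `X`. As `Φ(m)` commutes with `exp (s X)`, the `θ^L` part alone is orthogonal
to `X`. Writing `Φ = exp ξ · exp Y` in the tube, the factor `exp Y` with `Y ∈ 𝔱^⊥` contributes
nothing in the direction `X`, and so `dξ ⊥ X` (`bE_deriv_lift_eq_zero`). In coordinates where the
compact isotropy group acts linearly (`exists_linearChart`) the zeros of `X` form a linear subspace,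
and integration along a segment finishes the argument.

Part (a): `p ∈ 𝒵_β` means `Φ̂_a(p) = β` and `γ - β ∈ 𝔨`, that is, `γ` projects to `β` on `Δ_p`. Part
(b): if `p` lies in the piece of `Δ`, then `𝔱_Δ ⊆ 𝔨`, so `Δ_p ⊆ Δ`, and both project `γ` to `β`;
genericity gives `Δ_p = Δ`, hence `𝔨 = 𝔱_Δ` (`stab_eq_orth`). Thus `p` determines `Δ`, which is
disjointness.

Part (c): let `A` be the action of `β - γ` on `T_p X̂`. If `A w` is tangent to the fixed point set,
then `A (A w) = 0`. The group generated by `A` is bounded, so `A w = 0`. The points of the line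
through `w` in a linear chart, other than `p` but near it, then share a stabilizer `K` containing `β
- γ`. By upper semicontinuity (`eventually_genE_eq_zero`) `K ⊆ 𝔨`, so `β + K^⊥ ∈ 𝒲` contains `Δ` and
also projects `γ` to `β`. Genericity gives `K = 𝔱_Δ`, so the line stays in the fixed point set and
`w` is tangent to it.

Since `exp` is defined pointwise through integral curves, its regularity has to be derived: on `𝔱`
from commutativity, on `𝔱^⊥` from the smooth inverse of the tube map. -/

set_option linter.unusedSectionVars false

noncomputable section

namespace QHam

open Filter Topology Set MeasureTheory

/-! ### Velocities of curves in manifolds -/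

section Curves

variable {F F' F'' : Type*} [NormedAddCommGroup F] [NormedSpace ℝ F] [NormedAddCommGroup F']
  [NormedSpace ℝ F'] [NormedAddCommGroup F''] [NormedSpace ℝ F'']
variable {M N P : Type*} [TopologicalSpace M] [ChartedSpace F M] [TopologicalSpace N]
  [ChartedSpace F' N] [TopologicalSpace P] [ChartedSpace F'' P]

variable (F F') in
/-- Differentiability of a map between boundaryless manifolds. -/
abbrev MD (f : M → N) (a : M) : Prop := MDifferentiableAt 𝓘(ℝ, F) 𝓘(ℝ, F') f a

variable (F F') in
/-- The derivative of a map of manifolds, as a map of the model spaces. -/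
def D (f : M → N) (a : M) : F →L[ℝ] F' := (mfderiv 𝓘(ℝ, F) 𝓘(ℝ, F') f a :)

/-- The curve `c` passes at time `s` through `a` with velocity `v`. -/
def HasVel (c : ℝ → M) (s : ℝ) (a : M) (v : F) : Prop :=
  c s = a ∧ MD ℝ F c s ∧ D ℝ F c s 1 = v

/-- The intermediate point is a variable tied by an equation, so that points equal only
propositionally, such as `g * 1` and `g`, match without casts between tangent spaces. -/
theorem D_comp {g : N → P} {f : M → N} {a : M} {b : N} (hb : f a = b) (hg : MD F' F'' g b)
    (hf : MD F F' f a) :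
    D F F'' (g ∘ f) a = (D F' F'' g b).comp (D F F' f a) := by
  subst hb
  exact mfderiv_comp a hg hf

theorem D_id (a : M) : D F F (id : M → M) a = ContinuousLinearMap.id ℝ F := mfderiv_id

theorem D_congr {f g : M → N} {a : M} (h : f =ᶠ[𝓝 a] g) : D F F' f a = D F F' g a := by
  have := h.mfderiv_eq (I := 𝓘(ℝ, F)) (I' := 𝓘(ℝ, F'))
  exact this

theorem D_eq_fderiv {f : F → F'} {a : F} : D F F' f a = fderiv ℝ f a := by
  unfold D
  rw [mfderiv_eq_fderiv]

theorem HasVel.comp {f : M → N} {c : ℝ → M} {s : ℝ} {a : M} {v : F} (hc : HasVel c s a v)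
    (hf : MD F F' f a) : HasVel (fun u => f (c u)) s (f a) (D F F' f a v) := by
  obtain ⟨rfl, h1, rfl⟩ := hc
  refine ⟨rfl, hf.comp s h1, ?_⟩
  have := D_comp (g := f) (f := c) rfl hf h1
  change D ℝ F' (f ∘ c) s 1 = _
  rw [this]; rfl

theorem HasVel.unique {c : ℝ → M} {s : ℝ} {a b : M} {v w : F} (h : HasVel c s a v)
    (h' : HasVel c s b w) : v = w := h.2.2.symm.trans h'.2.2

theorem HasVel.congr {c d : ℝ → M} {s : ℝ} {a : M} {v : F} (h : HasVel c s a v)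
    (hd : d =ᶠ[𝓝 s] c) : HasVel d s a v :=
  ⟨hd.eq_of_nhds.trans h.1, h.2.1.congr_of_eventuallyEq hd, by rw [D_congr hd]; exact h.2.2⟩

theorem HasVel.continuousAt {c : ℝ → M} {s : ℝ} {a : M} {v : F} (h : HasVel c s a v) :
    ContinuousAt c s := h.2.1.continuousAt

theorem hasVel_iff_hasDerivAt {c : ℝ → F} {s : ℝ} {v : F} :
    HasVel c s (c s) v ↔ HasDerivAt c v s := by
  constructor
  · rintro ⟨-, h1, rfl⟩
    rw [D_eq_fderiv]
    exact (mdifferentiableAt_iff_differentiableAt.1 h1).hasDerivAt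
  · intro h
    refine ⟨rfl, h.differentiableAt.mdifferentiableAt, ?_⟩
    rw [D_eq_fderiv]
    simpa using h.deriv

theorem HasVel.hasDerivAt {c : ℝ → F} {s : ℝ} {v a : F} (h : HasVel c s a v) :
    HasDerivAt c v s := by
  obtain ⟨rfl, h⟩ := h
  exact hasVel_iff_hasDerivAt.1 ⟨rfl, h⟩

theorem _root_.HasDerivAt.hasVel {c : ℝ → F} {s : ℝ} {v a : F} (h : HasDerivAt c v s)
    (ha : c s = a) : HasVel c s a v := by
  subst ha
  exact hasVel_iff_hasDerivAt.2 h

theorem hasVel_const (a : M) (s : ℝ) : HasVel (fun _ => a) s a (0 : F) := by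
  refine ⟨rfl, mdifferentiableAt_const, ?_⟩
  unfold D
  rw [mfderiv_const]; rfl

theorem HasVel.reparam {c : ℝ → M} {φ : ℝ → ℝ} {s t r : ℝ} {a : M} {v : F}
    (hc : HasVel c t a v) (hφ : HasDerivAt φ r s) (ht : φ s = t) :
    HasVel (fun u => c (φ u)) s a (r • v) := by
  subst ht
  have := (hφ.hasVel rfl).comp hc.2.1
  rw [hc.1] at this
  convert this
  rw [← hc.2.2, ← map_smul, smul_eq_mul, mul_one]

theorem hasMFDerivAt_iff_hasVel {c : ℝ → M} {s : ℝ} (v : F) :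
    HasMFDerivAt 𝓘(ℝ, ℝ) 𝓘(ℝ, F) c s (((1 : ℝ →L[ℝ] ℝ).smulRight v : ℝ →L[ℝ] F) :) ↔
      HasVel c s (c s) v := by
  constructor
  · intro h
    refine ⟨rfl, h.mdifferentiableAt, ?_⟩
    unfold D
    rw [h.mfderiv]
    exact one_smul ℝ v
  · rintro ⟨-, h1, h2⟩
    have : D ℝ F c s = (1 : ℝ →L[ℝ] ℝ).smulRight v := by
      ext; simpa using h2
    rw [← this]
    exact h1.hasMFDerivAt

theorem HasVel.prod {f : M × N → P} {c : ℝ → M} {d : ℝ → N} {s : ℝ} {a : M} {b : N} {v : F} {w : F'}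
    (hc : HasVel c s a v) (hd : HasVel d s b w)
    (hf : MDifferentiableAt (𝓘(ℝ, F).prod 𝓘(ℝ, F')) 𝓘(ℝ, F'') f (a, b)) :
    HasVel (fun u => f (c u, d u)) s (f (a, b))
      (D F F'' (fun x => f (x, b)) a v + D F' F'' (fun y => f (a, y)) b w) := by
  obtain ⟨rfl, hc1, rfl⟩ := hc
  obtain ⟨rfl, hd1, rfl⟩ := hd
  have h1 := hc1.hasMFDerivAt.prodMk hd1.hasMFDerivAt
  have h2 := hf.hasMFDerivAt.comp s h1
  refine ⟨rfl, h2.mdifferentiableAt, ?_⟩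
  unfold D
  rw [show (fun u => f (c u, d u)) = f ∘ fun u => (c u, d u) from rfl, h2.mfderiv]
  exact mfderiv_prod_eq_add_apply hf (v := (D ℝ F c s 1, D ℝ F' d s 1))

/-- A curve whose velocity vanishes everywhere is constant. -/
theorem eq_of_hasVel_zero [IsManifold 𝓘(ℝ, F) 1 M] {c : ℝ → M}
    (h : ∀ s, HasVel c s (c s) (0 : F)) (s : ℝ) : c s = c 0 := by
  have hl : IsLocallyConstant c := by
    rw [IsLocallyConstant.iff_eventually_eq]
    intro s
    have hcont : Continuous c := continuous_iff_continuousAt.2 fun s => (h s).continuousAt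
    have h1 : ∀ᶠ u in 𝓝 s, c u ∈ (chartAt F (c s)).source :=
      hcont.continuousAt.eventually ((chartAt F (c s)).open_source.mem_nhds (mem_chart_source F _))
    obtain ⟨δ, hδ, hb⟩ := Metric.eventually_nhds_iff_ball.1 h1
    have h2 : ∀ u ∈ Metric.ball s δ,
        HasDerivAt (fun u => extChartAt 𝓘(ℝ, F) (c s) (c u)) (0 : F) u := by
      intro u hu
      have := (h u).comp (F' := F) (mdifferentiableAt_extChartAt (I := 𝓘(ℝ, F)) (hb u hu))
      rw [map_zero] at this
      exact this.hasDerivAt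
    refine Metric.eventually_nhds_iff_ball.2 ⟨δ, hδ, fun u hu => ?_⟩
    have h3 := (convex_ball s δ).is_const_of_fderivWithin_eq_zero (𝕜 := ℝ)
      (f := fun u => extChartAt 𝓘(ℝ, F) (c s) (c u))
      (fun x hx => (h2 x hx).differentiableAt.differentiableWithinAt)
      (fun x hx => by
        rw [fderivWithin_of_isOpen Metric.isOpen_ball hx, (h2 x hx).hasFDerivAt.fderiv]
        simp) hu (Metric.mem_ball_self hδ)
    refine (extChartAt 𝓘(ℝ, F) (c s)).injOn ?_ ?_ h3
    · rw [extChartAt_source]; exact hb u hu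
    · exact mem_extChartAt_source _
  exact hl.apply_eq_of_isPreconnected isPreconnected_univ trivial trivial

end Curves

/-! ### One-parameter subgroups, the exponential map and the adjoint action -/

section Exponential

variable {E : Type*} [NormedAddCommGroup E] [NormedSpace ℝ E]
variable {G : Type*} [TopologicalSpace G] [ChartedSpace E G] [Group G] [LieGroup 𝓘(ℝ, E) ∞ G]

theorem contMDiffAt_mul_left (g h : G) : ContMDiffAt 𝓘(ℝ, E) 𝓘(ℝ, E) ∞ (fun x : G => g * x) h :=
  contMDiff_mul_left.contMDiffAt

theorem contMDiffAt_mul_right (g h : G) : ContMDiffAt 𝓘(ℝ, E) 𝓘(ℝ, E) ∞ (fun x : G => x * g) h :=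
  contMDiff_mul_right.contMDiffAt

theorem contMDiffAt_conj (g h : G) :
    ContMDiffAt 𝓘(ℝ, E) 𝓘(ℝ, E) ∞ (fun x : G => g * x * g⁻¹) h :=
  (contMDiffAt_mul_right g⁻¹ (g * h)).comp h (contMDiffAt_mul_left g h)

theorem md_mul_left (g h : G) : MD E E (fun x : G => g * x) h :=
  (contMDiffAt_mul_left g h).mdifferentiableAt (by simp)

theorem md_mul_right (g h : G) : MD E E (fun x : G => x * g) h :=
  (contMDiffAt_mul_right g h).mdifferentiableAt (by simp)

theorem md_conj (g h : G) : MD E E (fun x : G => g * x * g⁻¹) h :=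
  (contMDiffAt_conj g h).mdifferentiableAt (by simp)

variable (E) in
/-- The derivative at the identity of left multiplication by `g`. -/
def leftD (g : G) : E →L[ℝ] E := D E E (fun x : G => g * x) 1

variable (E) in
/-- The adjoint action on the model space. -/
def adE (g : G) : E →L[ℝ] E := D E E (fun x : G => g * x * g⁻¹) 1

variable (G) in
/-- The exponential map on the model space. -/
def expE (X : E) : G := exp (show LieAlg E G from X)

theorem D_mul_left_leftD (g h : G) (X : E) :
    D E E (fun x : G => g * x) h (leftD E h X) = leftD E (g * h) X := by
  unfold leftD
  have := D_comp (F := E) (F' := E) (F'' := E) (g := fun x : G => g * x) (f := fun x : G => h * x) (a := 1) (b := h) (mul_one h)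
    (md_mul_left g h) (md_mul_left h 1)
  rw [show (fun x : G => g * h * x) = (fun x : G => g * x) ∘ (fun x : G => h * x) by
    ext x; simp [mul_assoc], this]
  rfl

theorem leftD_one (X : E) : leftD E (1 : G) X = X := by
  unfold leftD
  have : (fun x : G => 1 * x) = id := by ext; simp
  rw [this, D_id]; rfl

theorem HasVel.mul_left {c : ℝ → G} {s : ℝ} {a : G} {X : E} (h : HasVel c s a (leftD E a X))
    (g : G) : HasVel (fun u => g * c u) s (g * a) (leftD E (g * a) X) := by
  rw [← D_mul_left_leftD]
  exact h.comp (f := fun x : G => g * x) (md_mul_left g a)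

theorem HasVel.mul_left_one {c : ℝ → G} {s : ℝ} {X : E} (h : HasVel c s 1 X)
    (g : G) : HasVel (fun u => g * c u) s g (leftD E g X) := by
  have := HasVel.mul_left (X := X) (by rwa [leftD_one]) g
  rwa [mul_one] at this

/-- The curve `c` has logarithmic (left) derivative `X` at time `s`. -/
def HasLog (c : ℝ → G) (s : ℝ) (X : E) : Prop := HasVel (fun u => (c s)⁻¹ * c u) s 1 X

theorem hasLog_iff {c : ℝ → G} {s : ℝ} {X : E} :
    HasLog c s X ↔ HasVel c s (c s) (leftD E (c s) X) := by
  constructor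
  · intro h
    have := h.mul_left_one (c s)
    simpa using this
  · intro h
    have := h.mul_left (c s)⁻¹
    rw [inv_mul_cancel, leftD_one] at this
    exact this

theorem HasVel.mul_curve {c d : ℝ → G} {s : ℝ} {X Y : E} (hc : HasVel c s 1 X) (hd : HasVel d s 1 Y) :
    HasVel (fun u => c u * d u) s 1 (X + Y) := by
  have h := hc.prod hd (f := fun p : G × G => p.1 * p.2)
    ((contMDiff_mul 𝓘(ℝ, E) ∞).contMDiffAt.mdifferentiableAt (by simp))
  have h1 : (fun x : G => x) = id := rfl
  have h2 : (fun x : G => 1 * x) = id := by ext; simp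
  simp only [_root_.mul_one, h2, h1, D_id] at h
  exact h

theorem HasVel.conj {c : ℝ → G} {s : ℝ} {X : E} (hc : HasVel c s 1 X) (g : G) :
    HasVel (fun u => g * c u * g⁻¹) s 1 (adE E g X) := by
  have h := hc.comp (f := fun x : G => g * x * g⁻¹) (md_conj g 1)
  rwa [mul_one, mul_inv_cancel] at h

/-- With `a = c s` and `b = d s`, the curve `(a b)⁻¹ c d` equals `b⁻¹ (a⁻¹ c) b · (b⁻¹ d)`, a
product of two curves through `1`, whose velocities add. -/
theorem HasLog.mul {c d : ℝ → G} {s : ℝ} {X Y : E} (hc : HasLog c s X) (hd : HasLog d s Y) :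
    HasLog (fun u => c u * d u) s (adE E (d s)⁻¹ X + Y) := by
  have h := (HasVel.conj hc (d s)⁻¹).mul_curve hd
  unfold HasLog
  convert h using 2
  group

theorem isOneParam_iff {X : E} {c : ℝ → G} :
    IsOneParam (show LieAlg E G from X) c ↔ c 0 = 1 ∧ ∀ s, HasLog c s X := by
  unfold IsOneParam IsMIntegralCurve
  refine and_congr_right fun _ => forall_congr' fun s => ?_
  rw [hasLog_iff, ← hasMFDerivAt_iff_hasVel]
  rfl

theorem lieGroup_three : LieGroup 𝓘(ℝ, E) (minSmoothness ℝ 3) G := by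
  rw [minSmoothness_of_isRCLikeNormedField]
  exact LieGroup.of_le (n := ∞) (ENat.LEInfty.out)

theorem contMDiff_invariantField (X : LieAlg E G) :
    ContMDiff 𝓘(ℝ, E) 𝓘(ℝ, E).tangent 1
      (fun g : G => (⟨g, mulInvariantVectorField X g⟩ : TangentBundle 𝓘(ℝ, E) G)) := by
  have := lieGroup_three (E := E) (G := G)
  refine (contMDiff_mulInvariantVectorField X).of_le ?_
  rw [minSmoothness_of_isRCLikeNormedField]
  norm_num

theorem IsOneParam.unique [T2Space G] {X : LieAlg E G} {c d : ℝ → G} (hc : IsOneParam X c)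
    (hd : IsOneParam X d) : c = d := by
  have : IsManifold 𝓘(ℝ, E) 1 G := .of_le (n := ∞) (by exact_mod_cast le_top)
  exact isMIntegralCurve_Ioo_eq_of_contMDiff_boundaryless (t₀ := 0)
    (contMDiff_invariantField X) hc.2 hd.2 (hc.1.trans hd.1.symm)

theorem IsOneParam.add [T2Space G] {X : E} {c : ℝ → G}
    (hc : IsOneParam (show LieAlg E G from X) c) (s t : ℝ) :
    c (s + t) = c s * c t := by
  have h : IsOneParam (show LieAlg E G from X) (fun t => (c s)⁻¹ * c (s + t)) := by
    rw [isOneParam_iff] at hc ⊢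
    refine ⟨by simp, fun t => ?_⟩
    have h1 := hasLog_iff.1 (hc.2 (s + t))
    have h2 := h1.reparam (φ := fun t => s + t) (s := t) ((hasDerivAt_id t).const_add s) rfl
    rw [one_smul] at h2
    rw [hasLog_iff]
    exact h2.mul_left (c s)⁻¹
  have := congrFun (h.unique hc) t
  rw [← this]; group

/-- Left translates of one local integral curve through `1` are integral curves through every point
with the same lifetime, which forces completeness of the field. -/
theorem exists_isOneParam [T2Space G] [CompleteSpace E] (X : LieAlg E G) :
    ∃ c : ℝ → G, IsOneParam X c := by
  have : IsManifold 𝓘(ℝ, E) 1 G := .of_le (n := ∞) (by exact_mod_cast le_top)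
  obtain ⟨c, hc0, hc⟩ := exists_isMIntegralCurveAt_of_contMDiffAt_boundaryless (t₀ := 0)
    (contMDiff_invariantField X).contMDiffAt (x₀ := (1 : G))
  obtain ⟨ε, hε, hb⟩ := Metric.eventually_nhds_iff_ball.1 hc
  rw [Real.ball_eq_Ioo, zero_sub, zero_add] at hb
  obtain ⟨d, hd0, hd⟩ := exists_isMIntegralCurve_of_isMIntegralCurveOn
    (contMDiff_invariantField X) hε (fun g => by
      refine ⟨fun u => g * c u, by simp [hc0], fun t ht => HasMFDerivAt.hasMFDerivWithinAt ?_⟩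
      have h1 := (hasMFDerivAt_iff_hasVel (leftD E (c t) X)).1 (hb t ht)
      exact (hasMFDerivAt_iff_hasVel (leftD E (g * c t) X)).2 (h1.mul_left g)) 1
  exact ⟨d, hd0, hd⟩

theorem IsOneParam.scale {X : E} {c : ℝ → G} (hc : IsOneParam (show LieAlg E G from X) c) (r : ℝ) :
    IsOneParam (show LieAlg E G from r • X) (fun s => c (r * s)) := by
  rw [isOneParam_iff] at hc ⊢
  refine ⟨by simpa using hc.1, fun s => ?_⟩
  have := (hc.2 (r * s)).reparam (φ := fun s => r * s) (s := s) (r := r)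
    (by simpa using (hasDerivAt_id s).const_mul r) rfl
  exact this

theorem IsOneParam.eq_expE [T2Space G] {X : E} {c : ℝ → G}
    (hc : IsOneParam (show LieAlg E G from X) c) (s : ℝ) : c s = expE G (s • X) := by
  have h : ∃ c : ℝ → G, IsOneParam (show LieAlg E G from (s • X)) c := ⟨_, hc.scale s⟩
  unfold expE exp
  rw [dif_pos h, ← (hc.scale s).unique h.choose_spec]
  simp

variable [T2Space G] [CompleteSpace E]

theorem isOneParam_expE (X : E) : IsOneParam (show LieAlg E G from X) (fun s => expE G (s • X)) := by
  obtain ⟨c, hc⟩ := exists_isOneParam (G := G) (show LieAlg E G from X)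
  have : c = fun s => expE G (s • X) := funext fun s => hc.eq_expE s
  rwa [← this]

theorem expE_zero : expE G (0 : E) = 1 := by
  simpa using (isOneParam_expE (G := G) (0 : E)).1

theorem expE_add_smul (X : E) (s t : ℝ) : expE G ((s + t) • X) = expE G (s • X) * expE G (t • X) :=
  (isOneParam_expE X).add s t

theorem expE_neg (X : E) : expE G (-X) = (expE G X)⁻¹ := by
  have := expE_add_smul (G := G) X (-1) 1
  simp only [neg_add_cancel, zero_smul, expE_zero, one_smul, neg_smul] at this
  exact eq_inv_of_mul_eq_one_left this.symm

theorem hasLog_expE (X : E) (s : ℝ) : HasLog (fun s => expE G (s • X)) s X :=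
  (isOneParam_iff.1 (isOneParam_expE X)).2 s

theorem hasVel_expE (X : E) : HasVel (fun s => expE G (s • X)) 0 1 X := by
  have := hasLog_iff.1 (hasLog_expE (G := G) X 0)
  rwa [zero_smul, expE_zero, leftD_one] at this

theorem continuous_expE_smul (X : E) : Continuous (fun s : ℝ => expE G (s • X)) :=
  continuous_iff_continuousAt.2 fun s => (hasLog_iff.1 (hasLog_expE X s)).continuousAt

/-- A homomorphism from `ℝ` that is differentiable at `0` is the exponential curve. -/
theorem eq_expE_of_hom {c : ℝ → G} {X : E} (hc : ∀ s t, c (s + t) = c s * c t)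
    (h0 : HasVel c 0 1 X) (s : ℝ) : c s = expE G (s • X) := by
  refine IsOneParam.eq_expE (isOneParam_iff.2 ⟨h0.1, fun s => ?_⟩) s
  have := h0.reparam (φ := fun u => u - s) (s := s) ((hasDerivAt_id s).sub_const s) (by simp)
  rw [one_smul] at this
  unfold HasLog
  convert this using 2 with u
  rw [inv_mul_eq_iff_eq_mul, ← hc]; simp

theorem expE_adE (g : G) (X : E) : expE G (adE E g X) = g * expE G X * g⁻¹ := by
  have := eq_expE_of_hom (c := fun s => g * expE G (s • X) * g⁻¹) (X := adE E g X)
    (fun s t => by rw [expE_add_smul]; group) ((hasVel_expE X).conj g) 1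
  simpa using this.symm

theorem expE_add_of_commute {X Y : E}
    (h : ∀ s t : ℝ, Commute (expE G (s • X)) (expE G (t • Y))) :
    expE G (X + Y) = expE G X * expE G Y := by
  have := eq_expE_of_hom (c := fun s => expE G (s • X) * expE G (s • Y)) (X := X + Y)
    (fun s t => by
      rw [expE_add_smul, expE_add_smul, mul_assoc, ← mul_assoc _ _ (expE G (t • Y)),
        (h t s).eq]
      group) ((hasVel_expE X).mul_curve (hasVel_expE Y)) 1
  simpa using this.symm

theorem adE_eq_of_commute {g : G} {X : E} (h : ∀ s : ℝ, Commute g (expE G (s • X))) :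
    adE E g X = X := by
  have h1 := (hasVel_expE (G := G) X).conj g
  have h2 : (fun u : ℝ => g * expE G (u • X) * g⁻¹) = fun u : ℝ => expE G (u • X) := by
    ext u; rw [(h u).eq]; group
  rw [h2] at h1
  exact h1.unique (hasVel_expE X)

theorem adE_mul (g h : G) (X : E) : adE E (g * h) X = adE E g (adE E h X) := by
  have h1 := ((hasVel_expE (G := G) X).conj h).conj g
  have h2 := (hasVel_expE (G := G) X).conj (g * h)
  refine h2.unique (h1.congr (Eventually.of_forall fun u => ?_))
  simp only; group

end Exponential

/-! ### Maps read in preferred charts -/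

section Rep

variable {F F' F'' : Type*} [NormedAddCommGroup F] [NormedSpace ℝ F] [NormedAddCommGroup F']
  [NormedSpace ℝ F'] [NormedAddCommGroup F''] [NormedSpace ℝ F'']
variable {M N : Type*} [TopologicalSpace M] [ChartedSpace F M] [TopologicalSpace N]
  [ChartedSpace F' N]

theorem contDiffAt_rep [IsManifold 𝓘(ℝ, F) ∞ M] {f : M → F''} {a a' : M} {n : WithTop ℕ∞}
    (hn : n ≤ ∞) (ha : a' ∈ (chartAt F a).source)
    (hf : ContMDiffAt 𝓘(ℝ, F) 𝓘(ℝ, F'') n f a') :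
    ContDiffAt ℝ n (fun x : F => f ((extChartAt 𝓘(ℝ, F) a).symm x)) (extChartAt 𝓘(ℝ, F) a a') := by
  rw [← contMDiffAt_iff_contDiffAt]
  have h1 : ContMDiffAt 𝓘(ℝ, F) 𝓘(ℝ, F) n (extChartAt 𝓘(ℝ, F) a).symm
      (extChartAt 𝓘(ℝ, F) a a') :=
    ((contMDiffOn_extChartAt_symm (n := ∞) a).contMDiffAt
      ((isOpen_extChartAt_target a).mem_nhds
        ((extChartAt 𝓘(ℝ, F) a).map_source (by rwa [extChartAt_source])))).of_le hn
  have h2 : (extChartAt 𝓘(ℝ, F) a).symm (extChartAt 𝓘(ℝ, F) a a') = a' :=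
    (extChartAt 𝓘(ℝ, F) a).left_inv (by rwa [extChartAt_source])
  exact ContMDiffAt.comp _ (by rw [h2]; exact hf) h1

theorem contDiffAt_rep_prod [IsManifold 𝓘(ℝ, F) ∞ M] [IsManifold 𝓘(ℝ, F') ∞ N] {f : M × N → F''}
    {a a' : M} {b b' : N} {n : WithTop ℕ∞} (hn : n ≤ ∞)
    (ha : a' ∈ (chartAt F a).source) (hb : b' ∈ (chartAt F' b).source)
    (hf : ContMDiffAt (𝓘(ℝ, F).prod 𝓘(ℝ, F')) 𝓘(ℝ, F'') n f (a', b')) :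
    ContDiffAt ℝ n
      (fun x : F × F' => f ((extChartAt 𝓘(ℝ, F) a).symm x.1, (extChartAt 𝓘(ℝ, F') b).symm x.2))
      (extChartAt 𝓘(ℝ, F) a a', extChartAt 𝓘(ℝ, F') b b') := by
  rw [← contMDiffAt_iff_contDiffAt]
  have h1 : ContMDiffAt 𝓘(ℝ, F) 𝓘(ℝ, F) n (extChartAt 𝓘(ℝ, F) a).symm
      (extChartAt 𝓘(ℝ, F) a a') :=
    ((contMDiffOn_extChartAt_symm (n := ∞) a).contMDiffAt
      ((isOpen_extChartAt_target a).mem_nhds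
        ((extChartAt 𝓘(ℝ, F) a).map_source (by rwa [extChartAt_source])))).of_le hn
  have h1' : ContMDiffAt 𝓘(ℝ, F') 𝓘(ℝ, F') n (extChartAt 𝓘(ℝ, F') b).symm
      (extChartAt 𝓘(ℝ, F') b b') :=
    ((contMDiffOn_extChartAt_symm (n := ∞) b).contMDiffAt
      ((isOpen_extChartAt_target b).mem_nhds
        ((extChartAt 𝓘(ℝ, F') b).map_source (by rwa [extChartAt_source])))).of_le hn
  have h2 : (extChartAt 𝓘(ℝ, F) a).symm (extChartAt 𝓘(ℝ, F) a a') = a' :=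
    (extChartAt 𝓘(ℝ, F) a).left_inv (by rwa [extChartAt_source])
  have h2' : (extChartAt 𝓘(ℝ, F') b).symm (extChartAt 𝓘(ℝ, F') b b') = b' :=
    (extChartAt 𝓘(ℝ, F') b).left_inv (by rwa [extChartAt_source])
  have h3 := ContMDiffAt.prodMap (x := extChartAt 𝓘(ℝ, F) a a') (y := extChartAt 𝓘(ℝ, F') b b') h1 h1'
  have hf' : ContMDiffAt (𝓘(ℝ, F).prod 𝓘(ℝ, F')) 𝓘(ℝ, F'') n f
      (Prod.map (extChartAt 𝓘(ℝ, F) a).symm (extChartAt 𝓘(ℝ, F') b).symm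
        (extChartAt 𝓘(ℝ, F) a a', extChartAt 𝓘(ℝ, F') b b')) := by
    simpa only [Prod.map, h2, h2'] using hf
  have h4 := hf'.comp _ h3
  rw [modelWithCornersSelf_prod, ← chartedSpaceSelf_prod]
  exact h4

end Rep

/-! ### Continuous differentiability of one-parameter subgroups -/

section Exponential

variable {E : Type*} [NormedAddCommGroup E] [NormedSpace ℝ E] [CompleteSpace E]
variable {G : Type*} [TopologicalSpace G] [ChartedSpace E G] [Group G] [LieGroup 𝓘(ℝ, E) ∞ G]
  [T2Space G]

/-- The preferred chart at the identity. -/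
abbrev chart1 (E G : Type*) [NormedAddCommGroup E] [NormedSpace ℝ E] [TopologicalSpace G]
    [ChartedSpace E G] [Group G] : PartialEquiv G E := extChartAt 𝓘(ℝ, E) (1 : G)

theorem contMDiffAt_of_chart1 {F : Type*} [NormedAddCommGroup F] [NormedSpace ℝ F] {f : F → G}
    {x : F} {n : WithTop ℕ∞} (hx : f x = 1) (hc : ContinuousAt f x)
    (h : ContDiffAt ℝ n (fun y => chart1 E G (f y)) x) :
    ContMDiffAt 𝓘(ℝ, F) 𝓘(ℝ, E) n f x := by
  rw [contMDiffAt_iff_target, hx]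
  exact ⟨hc, h.contMDiffAt⟩

/-- An integral curve is a priori only differentiable. From `c (s + t) = c s * c t` its derivative
at `s` is a partial derivative of the multiplication at `(c s, 1)`, which depends continuously on
`s`. -/
theorem contMDiff_expE_smul (X : E) :
    ContMDiff 𝓘(ℝ, ℝ) 𝓘(ℝ, E) 1 (fun s : ℝ => expE G (s • X)) := by
  set c : ℝ → G := fun s : ℝ => expE G (s • X) with hc
  have hcont : Continuous c := continuous_expE_smul X
  have hc0 : c 0 = 1 := by simp [hc, expE_zero]
  have hadd : ∀ s t, c (s + t) = c s * c t := expE_add_smul X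
  set χ := chart1 E G with hχ
  set f : E × E → E := fun p => χ (χ.symm p.1 * χ.symm p.2) with hf
  have h1s : (1 : G) ∈ (chartAt E (1 : G)).source := mem_chart_source E 1
  have hfs : ContDiffAt ℝ 1 f (χ 1, χ 1) := by
    refine contDiffAt_rep_prod (f := fun p : G × G => χ (p.1 * p.2)) (by simp) h1s h1s ?_
    refine ContMDiffAt.comp (I' := 𝓘(ℝ, E)) (g := χ) (1, 1) ?_
      (((contMDiff_mul 𝓘(ℝ, E) ∞).contMDiffAt).of_le (by simp))
    simp only [_root_.mul_one]
    exact contMDiffAt_extChartAt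
  obtain ⟨f', u, hu, hf'c, hf'⟩ : ∃ f' : E × E → E × E →L[ℝ] E, ∃ u ∈ 𝓝 (χ 1, χ 1),
      ContinuousOn f' u ∧ ∀ x ∈ u, HasFDerivAt f (f' x) x := by
    obtain ⟨f', u, hu, h1, h2⟩ := contDiffAt_one_iff.1 hfs
    exact ⟨f', u, hu, h1, h2⟩
  obtain ⟨u', hu', huo, hmem⟩ := mem_nhds_iff.1 hu
  have hχc : ∀ s, c s ∈ (chartAt E (1 : G)).source → ContinuousAt (fun s => χ (c s)) s :=
    fun s hs => ContinuousAt.comp (g := χ) (f := c) (continuousAt_extChartAt' (by rwa [extChartAt_source]))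
      hcont.continuousAt
  set W : Set ℝ := {s | c s ∈ (chartAt E (1 : G)).source} with hW
  have hWo : IsOpen W := (chartAt E (1 : G)).open_source.preimage hcont
  have hχW : ContinuousOn (fun s => χ (c s)) W := fun s hs => (hχc s hs).continuousWithinAt
  set V : Set ℝ := W ∩ (fun s => ((χ (c s) : E), χ 1)) ⁻¹' u' with hV
  have hVo : IsOpen V := (hχW.prodMk continuousOn_const).isOpen_inter_preimage hWo huo
  have hV0 : (0 : ℝ) ∈ V := by
    refine ⟨?_, ?_⟩
    · change c 0 ∈ (chartAt E (1 : G)).source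
      rw [hc0]; exact h1s
    · simpa [hc0] using hmem
  have hleft : ∀ g ∈ (chartAt E (1 : G)).source, χ.symm (χ g) = g := fun g hg =>
    (extChartAt 𝓘(ℝ, E) (1 : G)).left_inv (by rwa [extChartAt_source])
  have hx0 : HasDerivAt (fun s => χ (c s)) (D E E χ (1 : G) X) 0 :=
    (HasVel.comp (f := χ) (hasVel_expE (G := G) X)
      (mdifferentiableAt_extChartAt (I := 𝓘(ℝ, E)) h1s)).hasDerivAt
  have hder : ∀ s ∈ V, HasDerivAt (fun s => χ (c s)) (f' (χ (c s), χ 1) (0, D E E χ (1 : G) X)) s := by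
    intro s hs
    have e1 : HasDerivAt (fun t => f (χ (c s), χ (c t))) (f' (χ (c s), χ 1) (0, D E E χ (1 : G) X)) 0 := by
      have := hf' (χ (c s), χ 1) (hu' hs.2)
      rw [← hc0] at this
      rw [← hc0]
      exact HasFDerivAt.comp_hasDerivAt (f := fun t => ((χ (c s) : E), χ (c t))) (0 : ℝ) this
        ((hasDerivAt_const _ _).prodMk (by rw [hc0]; exact hx0))
    have e2 : HasDerivAt (fun t => χ (c (s + t))) (f' (χ (c s), χ 1) (0, D E E χ (1 : G) X)) 0 := by
      refine e1.congr_of_eventuallyEq ?_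
      filter_upwards [hWo.mem_nhds hV0.1] with t ht
      simp only [hf]
      rw [hleft _ hs.1, hleft _ ht, hadd]
    have e3 : HasDerivAt (fun t => χ (c (s + t))) (f' (χ (c s), χ 1) (0, D E E χ (1 : G) X)) (s - s) := by
      rwa [sub_self]
    have := e3.comp_sub_const s s
    simpa using this
  have hC1 : ContDiffAt ℝ 1 (fun s => χ (c s)) 0 := by
    rw [contDiffAt_one_iff]
    refine ⟨fun s => (1 : ℝ →L[ℝ] ℝ).smulRight (f' (χ (c s), χ 1) (0, D E E χ (1 : G) X)), V,
      hVo.mem_nhds hV0, ?_, fun s hs => (hder s hs).hasFDerivAt⟩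
    have : ContinuousOn (fun s => f' (χ (c s), χ 1)) V :=
      hf'c.comp ((hχW.prodMk continuousOn_const).mono inter_subset_left) (fun s hs => hu' hs.2)
    exact ((ContinuousLinearMap.smulRightL ℝ ℝ E 1).continuous.comp_continuousOn
      (this.clm_apply continuousOn_const))
  have h0 : ContMDiffAt 𝓘(ℝ, ℝ) 𝓘(ℝ, E) 1 c 0 := contMDiffAt_of_chart1 hc0 hcont.continuousAt hC1
  intro s
  -- Regularity at `0` is moved to `s` by left translation.
  have h2 : c = fun t => c s * c (t - s) := by
    ext t; rw [← hadd]; congr 1; ring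
  rw [h2]
  refine ContMDiffAt.comp s (I' := 𝓘(ℝ, E)) (g := fun x : G => c s * x)
    ((contMDiffAt_mul_left (E := E) (c s) _).of_le (by simp)) ?_
  refine ContMDiffAt.comp s (I' := 𝓘(ℝ, ℝ)) (g := c) (f := fun t : ℝ => t - s) (by simpa using h0) ?_
  exact (contDiff_id.sub contDiff_const).contMDiff.contMDiffAt

end Exponential

theorem nondegenerate_of_pos {V : Type*} [AddCommGroup V] [Module ℝ V]
    {β : LinearMap.BilinForm ℝ V} (hs : ∀ x y, β x y = β y x) (hp : ∀ x, x ≠ 0 → 0 < β x x) :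
    β.Nondegenerate := by
  have hr : β.IsRefl := fun X Y h => by rw [hs]; exact h
  refine (LinearMap.IsRefl.nondegenerate_iff_separatingLeft hr).2 fun x hx => ?_
  by_contra h
  exact (hp x h).ne' (hx x)

/-! ### The Lie algebra of the maximal torus and its exponential -/

section Torus

variable {E : Type*} [NormedAddCommGroup E] [NormedSpace ℝ E] [FiniteDimensional ℝ E]
variable {G : Type*} [TopologicalSpace G] [ChartedSpace E G] [Group G] [LieGroup 𝓘(ℝ, E) ∞ G]
  [T2Space G]
variable (B : InvariantInnerProduct E G) (T : MaximalTorus G)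

variable (E) in
/-- The Lie algebra of the torus as a subspace of the model space. -/
def tE : Submodule ℝ E := T.lie (E := E)

/-- The invariant inner product on the model space. -/
def bE : LinearMap.BilinForm ℝ E := B.form

/-- The orthogonal complement of the Lie algebra of the torus in the model space. -/
def nE : Submodule ℝ E := (bE B).orthogonal (tE E T)

theorem bE_symm (X Y : E) : bE B X Y = bE B Y X := B.symm X Y

theorem bE_pos {X : E} (h : X ≠ 0) : 0 < bE B X X := B.pos X h

theorem bE_adE (g : G) (X Y : E) : bE B (adE E g X) (adE E g Y) = bE B X Y := B.invariant g X Y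

theorem bE_isRefl : (bE B).IsRefl := fun X Y h => by rw [bE_symm]; exact h

theorem mem_nE {X : E} : X ∈ nE B T ↔ ∀ Y ∈ tE E T, bE B Y X = 0 := Iff.rfl

theorem isCompl_tE_nE : IsCompl (tE E T) (nE B T) := by
  refine LinearMap.BilinForm.isCompl_orthogonal_of_restrict_nondegenerate (bE_isRefl B) ?_
  refine nondegenerate_of_pos (fun x y => bE_symm B x y) fun x hx => bE_pos B ?_
  simpa using hx

/-- The orthogonal projection onto the Lie algebra of the torus. -/
def prT : E →L[ℝ] E :=
  LinearMap.toContinuousLinearMap ((tE E T).projection (nE B T) (isCompl_tE_nE B T))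

theorem prT_mem (X : E) : prT B T X ∈ tE E T := Submodule.projection_apply_mem _ X

theorem sub_prT_mem (X : E) : X - prT B T X ∈ nE B T := Submodule.sub_projection_mem _ X

theorem prT_of_mem {X : E} (h : X ∈ tE E T) : prT B T X = X :=
  Submodule.projection_apply_of_mem_left _ h

theorem prT_of_mem_nE {X : E} (h : X ∈ nE B T) : prT B T X = 0 :=
  (Submodule.projection_apply_eq_zero_iff _).2 h

variable {B T}

/-- The Lie algebra is a span, so the property must be carried through sums. It survives because
one-parameter subgroups inside the abelian group `T` commute. -/
theorem expE_mem {X : E} (h : X ∈ tE E T) : expE G X ∈ T.carrier := by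
  suffices ∀ s : ℝ, expE G (s • X) ∈ T.carrier by simpa using this 1
  refine Submodule.span_induction (p := fun (X : E) _ => ∀ s : ℝ, expE G (s • X) ∈ T.carrier)
    ?_ ?_ ?_ ?_ h
  · exact fun X hX s => hX s
  · intro s
    change expE G (s • (0 : E)) ∈ _
    rw [smul_zero, expE_zero]; exact T.one_mem
  · intro X Y _ _ hX hY s
    rw [smul_add, expE_add_of_commute]
    · exact T.mul_mem (hX s) (hY s)
    · intro u v
      rw [smul_smul, smul_smul]
      exact T.comm _ (hX _) _ (hY _)
  · intro a X _ hX s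
    change expE G (s • a • (X : E)) ∈ _
    rw [smul_smul]; exact hX _

theorem commute_of_mem {a b : G} (ha : a ∈ T.carrier) (hb : b ∈ T.carrier) : Commute a b :=
  T.comm a ha b hb

theorem expE_add {X Y : E} (hX : X ∈ tE E T) (hY : Y ∈ tE E T) :
    expE G (X + Y) = expE G X * expE G Y :=
  expE_add_of_commute fun s t => commute_of_mem (expE_mem (Submodule.smul_mem _ s hX))
    (expE_mem (Submodule.smul_mem _ t hY))

theorem adE_of_mem {h : G} (hh : h ∈ T.carrier) {X : E} (hX : X ∈ tE E T) : adE E h X = X :=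
  adE_eq_of_commute fun s => commute_of_mem hh (expE_mem (Submodule.smul_mem _ s hX))

theorem adE_mem_nE {h : G} (hh : h ∈ T.carrier) {Y : E} (hY : Y ∈ nE B T) :
    adE E h Y ∈ nE B T := by
  intro X hX
  have := bE_adE B h X Y
  rw [adE_of_mem hh hX] at this
  exact this.trans (hY X hX)

variable (B T)

/-- On `𝔱` the exponential is the product of one-parameter subgroups along a basis, each of them
`C¹`. Precomposing with the projection gives a map on the whole model space, where calculus applies.
-/
theorem contMDiff_expE_prT :
    ContMDiff 𝓘(ℝ, E) 𝓘(ℝ, E) 1 (fun Z : E => expE G (prT B T Z)) := by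
  let b := Module.finBasis ℝ (tE E T)
  have key : ∀ s : Finset (Fin (Module.finrank ℝ (tE E T))),
      ContMDiff 𝓘(ℝ, E) 𝓘(ℝ, E) 1 (fun Z : E =>
        expE G (∑ i ∈ s, b.repr ⟨prT B T Z, prT_mem B T Z⟩ i • (b i : E))) := by
    intro s
    induction s using Finset.induction_on with
    | empty => simpa [expE_zero] using contMDiff_const
    | insert i s hi ih =>
      have : ∀ Z : E, expE G (∑ i ∈ insert i s, b.repr ⟨prT B T Z, prT_mem B T Z⟩ i • (b i : E)) =
          expE G (b.repr ⟨prT B T Z, prT_mem B T Z⟩ i • (b i : E)) *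
          expE G (∑ i ∈ s, b.repr ⟨prT B T Z, prT_mem B T Z⟩ i • (b i : E)) := by
        intro Z
        rw [Finset.sum_insert hi, expE_add (T := T)]
        · exact Submodule.smul_mem _ _ (b i).2
        · exact Submodule.sum_mem _ fun j _ => Submodule.smul_mem _ _ (b j).2
      simp_rw [this]
      have : LieGroup 𝓘(ℝ, E) 1 G := LieGroup.of_le (n := ∞) (ENat.LEInfty.out)
      refine ContMDiff.mul ?_ ih
      refine (contMDiff_expE_smul (G := G) (b i : E)).comp
        (g := fun s : ℝ => expE G (s • (b i : E)))
        (f := fun Z => b.repr ⟨prT B T Z, prT_mem B T Z⟩ i) ?_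
      let ℓ : E →ₗ[ℝ] ℝ := (b.coord i) ∘ₗ ((prT B T).toLinearMap.codRestrict (tE E T) (prT_mem B T))
      exact (LinearMap.toContinuousLinearMap ℓ).contDiff.contMDiff
  have h := key Finset.univ
  have h2 : ∀ Z : E, ∑ i, b.repr ⟨prT B T Z, prT_mem B T Z⟩ i • (b i : E) = prT B T Z := by
    intro Z
    have := congrArg (tE E T).subtype (b.sum_repr ⟨prT B T Z, prT_mem B T Z⟩)
    rw [map_sum] at this
    exact this
  simpa only [h2] using h

theorem md_expE_prT (Z : E) : MD E E (fun Z : E => expE G (prT B T Z)) Z :=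
  (contMDiff_expE_prT B T).contMDiffAt.mdifferentiableAt (by simp)

/-- Along a differentiable curve in the Lie algebra of the torus, the logarithmic derivative of the
exponential is the derivative of the curve. -/
theorem hasLog_expE_comp (B : InvariantInnerProduct E G) (T : MaximalTorus G) {ξ : ℝ → E} {s : ℝ} {v : E} (hξ : ∀ u, ξ u ∈ tE E T)
    (h : HasDerivAt ξ v s) : HasLog (fun u => expE G (ξ u)) s v := by
  have hv : v ∈ tE E T := by
    have hcl : IsClosed (tE E T : Set E) := Submodule.closed_of_finiteDimensional _
    have h1 : prT B T v = v := by
      have h2 := (prT B T).hasFDerivAt.comp_hasDerivAt s h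
      refine h2.unique (h.congr_of_eventuallyEq (Eventually.of_forall fun u => ?_))
      exact prT_of_mem B T (hξ u)
    rw [← h1]; exact prT_mem B T v
  have h1 : ∀ u, (expE G (ξ s))⁻¹ * expE G (ξ u) = expE G (prT B T (ξ u - ξ s)) := by
    intro u
    rw [prT_of_mem B T (Submodule.sub_mem _ (hξ u) (hξ s)), ← expE_neg,
      ← expE_add (T := T) (Submodule.neg_mem _ (hξ s)) (hξ u)]
    congr 1; abel
  unfold HasLog
  simp_rw [h1]
  have h2 : HasVel (fun u => ξ u - ξ s) s (0 : E) v := (h.sub_const _).hasVel (by simp)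
  have h3 := h2.comp (f := fun Z => expE G (prT B T Z)) (md_expE_prT B T 0)
  have h4 : HasVel (fun u : ℝ => u • v) 0 (0 : E) v := by
    refine HasDerivAt.hasVel ?_ (by simp)
    simpa using (hasDerivAt_id (0 : ℝ)).smul_const v
  -- The derivative at `0` in the direction `v` is read off from the line `u • v`, whose image is a
  -- one-parameter subgroup.
  have h5 := h4.comp (f := fun Z => expE G (prT B T Z)) (md_expE_prT B T 0)
  have h6 : HasVel (fun u : ℝ => expE G (prT B T (u • v))) 0 1 v := by
    have := hasVel_expE (G := G) v
    refine this.congr (Eventually.of_forall fun u => ?_)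
    simp only
    rw [prT_of_mem B T (Submodule.smul_mem _ u hv)]
  rw [h5.unique h6, map_zero, expE_zero] at h3
  exact h3

end Torus

/-! ### Preferred charts have identity derivative at their center -/

section ChartDerivative

variable {F F' : Type*} [NormedAddCommGroup F] [NormedSpace ℝ F]
  [NormedAddCommGroup F'] [NormedSpace ℝ F']
variable {M : Type*} [TopologicalSpace M] [ChartedSpace F M] [IsManifold 𝓘(ℝ, F) ∞ M]

theorem D_eq_fderiv_written {N : Type*} [TopologicalSpace N] [ChartedSpace F' N] {f : M → N} {a : M}
    (h : MD F F' f a) :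
    D F F' f a = fderiv ℝ (writtenInExtChartAt 𝓘(ℝ, F) 𝓘(ℝ, F') a f) (extChartAt 𝓘(ℝ, F) a a) := by
  have h1 : D F F' f a = fderivWithin ℝ (writtenInExtChartAt 𝓘(ℝ, F) 𝓘(ℝ, F') a f)
    (range 𝓘(ℝ, F)) (extChartAt 𝓘(ℝ, F) a a) := h.mfderiv
  rw [h1, modelWithCornersSelf_coe, range_id, fderivWithin_univ]

theorem md_extChartAt (a : M) : MD F F (extChartAt 𝓘(ℝ, F) a) a :=
  have : IsManifold 𝓘(ℝ, F) 1 M := .of_le (n := ∞) ENat.LEInfty.out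
  mdifferentiableAt_extChartAt (mem_chart_source F a)

theorem D_extChartAt (a : M) : D F F (extChartAt 𝓘(ℝ, F) a) a = ContinuousLinearMap.id ℝ F := by
  rw [D_eq_fderiv_written (md_extChartAt a), ← fderiv_id (𝕜 := ℝ) (x := extChartAt 𝓘(ℝ, F) a a)]
  refine Filter.EventuallyEq.fderiv_eq ?_
  filter_upwards [extChartAt_target_mem_nhds (I := 𝓘(ℝ, F)) a] with x hx
  simp only [writtenInExtChartAt, extChartAt_model_space_eq_id, Function.comp_apply]
  exact (extChartAt 𝓘(ℝ, F) a).right_inv hx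

theorem contMDiffAt_extChartAt_symm' (a : M) :
    ContMDiffAt 𝓘(ℝ, F) 𝓘(ℝ, F) ∞ (extChartAt 𝓘(ℝ, F) a).symm (extChartAt 𝓘(ℝ, F) a a) :=
  (contMDiffOn_extChartAt_symm (n := ∞) a).contMDiffAt (extChartAt_target_mem_nhds (I := 𝓘(ℝ, F)) a)

theorem D_extChartAt_symm (a : M) :
    D F F (extChartAt 𝓘(ℝ, F) a).symm (extChartAt 𝓘(ℝ, F) a a) = ContinuousLinearMap.id ℝ F := by
  have h1 : MD F F (extChartAt 𝓘(ℝ, F) a).symm (extChartAt 𝓘(ℝ, F) a a) :=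
    (contMDiffAt_extChartAt_symm' a).mdifferentiableAt (by simp)
  have h2 := D_comp (F := F) (F' := F) (F'' := F) (g := extChartAt 𝓘(ℝ, F) a) (b := a)
    (extChartAt_to_inv a) (md_extChartAt a) h1
  rw [D_extChartAt, ContinuousLinearMap.id_comp] at h2
  rw [← h2, D_eq_fderiv, ← fderiv_id (𝕜 := ℝ) (x := extChartAt 𝓘(ℝ, F) a a)]
  refine Filter.EventuallyEq.fderiv_eq ?_
  filter_upwards [extChartAt_target_mem_nhds (I := 𝓘(ℝ, F)) a] with x hx
  exact (extChartAt 𝓘(ℝ, F) a).right_inv hx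

end ChartDerivative

/-! ### The tube around the torus, and the exponential near `0` in `𝔱^⊥` -/

section Tube

variable {E : Type*} [NormedAddCommGroup E] [NormedSpace ℝ E] [FiniteDimensional ℝ E]
variable {G : Type*} [TopologicalSpace G] [ChartedSpace E G] [Group G] [LieGroup 𝓘(ℝ, E) ∞ G]
  [T2Space G]
variable {B : InvariantInnerProduct E G} {T : MaximalTorus G} (N : Tube B T)

/-- The component in the orthogonal complement of the torus of the inverse of the tube map. -/
def Tube.normal (g : G) : E := (Function.invFunOn r (tubeDomain B T N.ε) g).2

theorem mem_tubeDomain {ε : ℝ} {p : G × E} :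
    p ∈ tubeDomain B T ε ↔ p.1 ∈ T.carrier ∧ p.2 ∈ nE B T ∧ bE B p.2 p.2 < ε ^ 2 := Iff.rfl

theorem Tube.spec {g : G} (hg : g ∈ N.nhd) :
    N.proj g ∈ T.carrier ∧ N.normal g ∈ nE B T ∧ bE B (N.normal g) (N.normal g) < N.ε ^ 2 ∧
      N.proj g * expE G (N.normal g) = g := by
  obtain ⟨h1, h2, h3⟩ := mem_tubeDomain.1 (Function.invFunOn_mem hg)
  exact ⟨h1, h2, h3, Function.invFunOn_eq hg⟩

theorem Tube.mul_mem {t : G} {Y : E} (ht : t ∈ T.carrier) (hY : Y ∈ nE B T)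
    (hε : bE B Y Y < N.ε ^ 2) : t * expE G Y ∈ N.nhd := ⟨(t, Y), ⟨ht, hY, hε⟩, rfl⟩

theorem Tube.eq_of_mul {t : G} {Y : E} (ht : t ∈ T.carrier) (hY : Y ∈ nE B T)
    (hε : bE B Y Y < N.ε ^ 2) :
    N.proj (t * expE G Y) = t ∧ N.normal (t * expE G Y) = Y := by
  have hmem := N.mul_mem ht hY hε
  have := N.injOn (Function.invFunOn_mem hmem) (show (t, Y) ∈ tubeDomain B T N.ε from ⟨ht, hY, hε⟩)
    (Function.invFunOn_eq hmem)
  exact ⟨congrArg Prod.fst this, congrArg Prod.snd this⟩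

theorem Tube.eps_sq_pos : 0 < N.ε ^ 2 := pow_pos N.pos 2

theorem Tube.torus_mem {t : G} (ht : t ∈ T.carrier) : t ∈ N.nhd := by
  have := N.mul_mem ht (Submodule.zero_mem _) (by simpa using N.eps_sq_pos)
  simpa [expE_zero] using this

theorem Tube.torus_eq {t : G} (ht : t ∈ T.carrier) : N.proj t = t ∧ N.normal t = 0 := by
  have := N.eq_of_mul ht (Submodule.zero_mem _) (by simpa using N.eps_sq_pos)
  simpa [expE_zero] using this

theorem Tube.one_eq : N.proj 1 = 1 ∧ N.normal 1 = 0 := N.torus_eq T.one_mem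

theorem Tube.isOpen_nhd : IsOpen N.nhd := N.isOpen

theorem Tube.contMDiffAt_inv {g : G} (hg : g ∈ N.nhd) :
    ContMDiffAt 𝓘(ℝ, E) (𝓘(ℝ, E).prod 𝓘(ℝ, E)) ∞ (Function.invFunOn r (tubeDomain B T N.ε)) g :=
  N.smooth_inv.contMDiffAt (N.isOpen_nhd.mem_nhds hg)

theorem Tube.contMDiffAt_proj {g : G} (hg : g ∈ N.nhd) :
    ContMDiffAt 𝓘(ℝ, E) 𝓘(ℝ, E) ∞ N.proj g := (N.contMDiffAt_inv hg).fst

theorem Tube.contMDiffAt_normal {g : G} (hg : g ∈ N.nhd) :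
    ContMDiffAt 𝓘(ℝ, E) 𝓘(ℝ, E) ∞ N.normal g := (N.contMDiffAt_inv hg).snd

/-- For `h, t ∈ T` one has `h (t exp Y) h⁻¹ = t exp (Ad_h Y)`. Since `Ad_h` preserves `𝔱^⊥` and
lengths, this is again a tube decomposition, which is unique. -/
theorem Tube.conj {g h : G} (hg : g ∈ N.nhd) (hh : h ∈ T.carrier) :
    N.proj (h * g * h⁻¹) = N.proj g ∧ N.normal (h * g * h⁻¹) = adE E h (N.normal g) := by
  obtain ⟨h1, h2, h3, h4⟩ := N.spec hg
  have := N.eq_of_mul h1 (adE_mem_nE hh h2) (by rwa [bE_adE])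
  rw [expE_adE, ← mul_assoc, ← mul_assoc, ← (commute_of_mem hh h1).eq, mul_assoc h, h4] at this
  exact this

theorem continuous_bE_self : Continuous fun Y : E => bE B Y Y := by
  let β : E →L[ℝ] E →L[ℝ] ℝ :=
    LinearMap.toContinuousLinearMap (LinearMap.toContinuousLinearMap.toLinearMap ∘ₗ bE B)
  exact (β.continuous.clm_apply continuous_id)

theorem continuous_bE_left (X : E) : Continuous fun Y : E => bE B Y X := by
  simp_rw [bE_symm B _ X]
  exact LinearMap.continuous_of_finiteDimensional (bE B X)

theorem Tube.eventually_lt : ∀ᶠ Y in 𝓝 (0 : E), bE B Y Y < N.ε ^ 2 :=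
  (continuous_bE_self (B := B)).continuousAt.eventually_lt continuousAt_const
    (by simpa using N.eps_sq_pos)

theorem Tube.D_normal (Z : E) : D E E N.normal 1 Z = Z - prT B T Z := by
  have hmd : MD E E N.normal 1 :=
    (N.contMDiffAt_normal (N.torus_mem T.one_mem)).mdifferentiableAt (by simp)
  have h1 : D E E N.normal 1 (prT B T Z) = 0 := by
    have := (hasVel_expE (G := G) (prT B T Z)).comp hmd
    refine this.unique ((hasVel_const (0 : E) 0).congr (Eventually.of_forall fun u => ?_))
    exact (N.torus_eq (expE_mem (Submodule.smul_mem _ u (prT_mem B T Z)))).2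
  have h2 : D E E N.normal 1 (Z - prT B T Z) = Z - prT B T Z := by
    have := (hasVel_expE (G := G) (Z - prT B T Z)).comp hmd
    have h3 : HasDerivAt (fun u : ℝ => u • (Z - prT B T Z)) (Z - prT B T Z) 0 := by
      simpa using (hasDerivAt_id (0 : ℝ)).smul_const (Z - prT B T Z)
    refine this.unique ((h3.hasVel (a := 0) (by simp)).congr ?_)
    have h4 : ∀ᶠ u : ℝ in 𝓝 0, bE B (u • (Z - prT B T Z)) (u • (Z - prT B T Z)) < N.ε ^ 2 := by
      have : Tendsto (fun u : ℝ => u • (Z - prT B T Z)) (𝓝 0) (𝓝 0) := by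
        simpa using h3.continuousAt.tendsto
      exact this.eventually N.eventually_lt
    filter_upwards [h4] with u hu
    simpa using (N.eq_of_mul T.one_mem (Submodule.smul_mem _ u (sub_prT_mem B T Z)) hu).2
  rw [map_sub, h1, sub_zero] at h2
  exact h2

/-- Only the inverse of the tube map is known to be smooth. If `g` depends smoothly on `Z ∈ 𝔱^⊥` and
has normal component `Z`, then `exp Z = (proj g)⁻¹ g` is smooth; such a `g` comes from the inverse
function theorem. -/
theorem contMDiffAt_expE_prN_zero (N : Tube B T) :
    ContMDiffAt 𝓘(ℝ, E) 𝓘(ℝ, E) 1 (fun Z : E => expE G (Z - prT B T Z)) 0 := by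
  set χ := chart1 E G with hχ
  set σ : E → G := fun Z => χ.symm (χ 1 + Z) with hσ
  have h1n : (1 : G) ∈ N.nhd := N.torus_mem T.one_mem
  have hσ0 : σ 0 = 1 := by
    simp only [hσ, add_zero]; exact extChartAt_to_inv (I := 𝓘(ℝ, E)) (1 : G)
  have hadd : ContMDiffAt 𝓘(ℝ, E) 𝓘(ℝ, E) ∞ (fun Z : E => χ 1 + Z) 0 :=
    (contDiff_const.add contDiff_id).contMDiff.contMDiffAt
  have hσs : ContMDiffAt 𝓘(ℝ, E) 𝓘(ℝ, E) ∞ σ 0 := by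
    refine ContMDiffAt.comp (0 : E) (g := χ.symm) (f := fun Z : E => χ 1 + Z) ?_ hadd
    rw [add_zero]
    exact contMDiffAt_extChartAt_symm' (1 : G)
  have hσm : MD E E σ 0 := hσs.mdifferentiableAt (by simp)
  have hDσ : D E E σ 0 = ContinuousLinearMap.id ℝ E := by
    have := D_comp (F := E) (F' := E) (F'' := E) (g := χ.symm) (f := fun Z : E => χ 1 + Z)
      (a := 0) (b := χ 1) (add_zero _)
      ((contMDiffAt_extChartAt_symm' (1 : G)).mdifferentiableAt (by simp))
      (hadd.mdifferentiableAt (by simp))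
    rw [D_extChartAt_symm, D_eq_fderiv, fderiv_const_add, fderiv_fun_id] at this
    exact this
  have hyσ : ContDiffAt ℝ ∞ (fun Z => N.normal (σ Z)) 0 := by
    rw [← contMDiffAt_iff_contDiffAt]
    refine ContMDiffAt.comp (0 : E) (g := N.normal) ?_ hσs
    rw [hσ0]; exact N.contMDiffAt_normal h1n
  -- The projection onto `𝔱` completes the normal component to a map whose derivative at `0` is the
  -- identity.
  set W : E → E := fun Z => prT B T Z + N.normal (σ Z) with hW
  have hWs : ContDiffAt ℝ ∞ W 0 := (prT B T).contDiff.contDiffAt.add hyσ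
  have hWd : HasFDerivAt W ((ContinuousLinearEquiv.refl ℝ E : E ≃L[ℝ] E) : E →L[ℝ] E) 0 := by
    have h1 : fderiv ℝ (fun Z => N.normal (σ Z)) 0 =
        (D E E N.normal 1).comp (ContinuousLinearMap.id ℝ E) := by
      rw [← hDσ, ← D_comp (F := E) (F' := E) (F'' := E) hσ0
        ((N.contMDiffAt_normal h1n).mdifferentiableAt (by simp)) hσm, D_eq_fderiv]
      rfl
    have h2 : HasFDerivAt W _ 0 := ((prT B T).hasFDerivAt (x := 0)).add (hyσ.differentiableAt (by simp)).hasFDerivAt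
    convert h2 using 1
    rw [h1]
    ext Z
    simp [N.D_normal]
  have hW0 : W 0 = 0 := by simp [hW, hσ0, N.one_eq.2]
  have hj := hWs.to_localInverse hWd (by simp)
  set j : E → E := hWs.localInverse hWd (by simp) with hjdef
  rw [hW0] at hj
  have hj0 : j 0 = 0 := by
    have := hWs.localInverse_apply_image hWd (by simp)
    rwa [hW0] at this
  have hright : ∀ᶠ Z in 𝓝 (0 : E), W (j Z) = Z := by
    have := (hWs.hasStrictFDerivAt' hWd (by simp)).eventually_right_inverse
    rwa [hW0] at this
  set pN : E →L[ℝ] E := ContinuousLinearMap.id ℝ E - prT B T with hpN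
  have hpNt : Tendsto pN (𝓝 0) (𝓝 0) := by simpa using pN.continuous.tendsto 0
  have hjc : Tendsto j (𝓝 0) (𝓝 0) := by simpa [hj0] using hj.continuousAt.tendsto
  have hσc : Tendsto σ (𝓝 0) (𝓝 1) := by simpa [hσ0] using hσs.continuousAt.tendsto
  have hev : ∀ᶠ Z in 𝓝 (0 : E), σ (j (pN Z)) ∈ N.nhd :=
    (hσc.comp (hjc.comp hpNt)).eventually (N.isOpen_nhd.mem_nhds h1n)
  have heq : (fun Z : E => expE G (Z - prT B T Z)) =ᶠ[𝓝 0]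
      fun Z => (N.proj (σ (j (pN Z))))⁻¹ * σ (j (pN Z)) := by
    filter_upwards [hev, hpNt.eventually hright] with Z h1 h2
    obtain ⟨h3, h4, h5, h6⟩ := N.spec h1
    -- Comparing the `𝔱` components in `W (j (pN Z)) = pN Z` leaves the normal component alone on
    -- the left.
    have h7 : prT B T (j (pN Z)) = 0 := by
      have := congrArg (prT B T) h2
      simp only [hW, map_add, prT_of_mem_nE B T h4, prT_of_mem B T (prT_mem B T _)] at this
      rw [add_zero] at this
      rw [this]
      exact prT_of_mem_nE B T (sub_prT_mem B T Z)
    have h8 : N.normal (σ (j (pN Z))) = Z - prT B T Z := by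
      have := h2
      simp only [hW, h7, zero_add] at this
      exact this
    rw [h8] at h6
    rw [eq_inv_mul_iff_mul_eq]
    exact h6
  refine ContMDiffAt.congr_of_eventuallyEq ?_ heq
  have h1 : ContMDiffAt 𝓘(ℝ, E) 𝓘(ℝ, E) ∞ (fun Z => σ (j (pN Z))) 0 := by
    refine ContMDiffAt.comp (0 : E) (g := σ) (f := fun Z => j (pN Z)) (by simpa [hj0] using hσs) ?_
    rw [contMDiffAt_iff_contDiffAt]
    exact ContDiffAt.comp (0 : E) (g := j) (f := pN) (by simpa using hj) pN.contDiff.contDiffAt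
  have h2 : ContMDiffAt 𝓘(ℝ, E) 𝓘(ℝ, E) ∞ (fun Z => N.proj (σ (j (pN Z)))) 0 := by
    refine ContMDiffAt.comp (0 : E) (g := N.proj) (f := fun Z => σ (j (pN Z))) ?_ h1
    simp only [map_zero, hj0, hσ0]
    exact N.contMDiffAt_proj h1n
  exact (h2.inv.mul h1).of_le (by simp)

end Tube

/-! ### Logarithmic derivatives on `𝔱^⊥` and a local logarithm on the torus -/

section Tube

variable {E : Type*} [NormedAddCommGroup E] [NormedSpace ℝ E] [FiniteDimensional ℝ E]
variable {G : Type*} [TopologicalSpace G] [ChartedSpace E G] [Group G] [LieGroup 𝓘(ℝ, E) ∞ G]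
  [T2Space G]
variable {B : InvariantInnerProduct E G} {T : MaximalTorus G} (N : Tube B T)

theorem expE_nat_smul (n : ℕ) (X : E) : expE G ((n : ℝ) • X) = expE G X ^ n := by
  induction n with
  | zero => simp [expE_zero]
  | succ n ih =>
    rw [Nat.cast_succ, expE_add_smul, ih, one_smul, pow_succ]

theorem lieGroup_one : LieGroup 𝓘(ℝ, E) 1 G := LieGroup.of_le (n := ∞) ENat.LEInfty.out

/-- The identity `exp Z = exp (Z / (n + 1)) ^ (n + 1)` spreads regularity from a neighbourhood of
`0` to all of `𝔱^⊥`. -/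
theorem contMDiff_expE_prN (N : Tube B T) :
    ContMDiff 𝓘(ℝ, E) 𝓘(ℝ, E) 1 (fun Z : E => expE G (Z - prT B T Z)) := by
  have := lieGroup_one (E := E) (G := G)
  have : IsManifold 𝓘(ℝ, E) 1 G := .of_le (n := ∞) ENat.LEInfty.out
  have h0 := (contMDiffAt_iff_contMDiffAt_nhds (I := 𝓘(ℝ, E)) (I' := 𝓘(ℝ, E)) (n := 1)
    (by simp)).1 (contMDiffAt_expE_prN_zero N)
  intro Z
  have h1 : Tendsto (fun n : ℕ => ((n : ℝ) + 1)⁻¹ • Z) atTop (𝓝 0) := by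
    have := (tendsto_one_div_add_atTop_nhds_zero_nat (𝕜 := ℝ)).smul_const Z
    simpa using this
  obtain ⟨n, hn⟩ := (h1.eventually h0).exists
  have hn0 : ((n : ℝ) + 1) ≠ 0 := by positivity
  have h2 : (fun Z : E => expE G (Z - prT B T Z)) =
      fun Z => expE G (((n : ℝ) + 1)⁻¹ • Z - prT B T (((n : ℝ) + 1)⁻¹ • Z)) ^ (n + 1) := by
    ext W
    rw [← expE_nat_smul, map_smul, ← smul_sub, smul_smul]
    push_cast
    rw [mul_inv_cancel₀ hn0, one_smul]
  rw [h2]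
  refine (contMDiff_pow (I := 𝓘(ℝ, E)) (n := 1) (n + 1)).contMDiffAt.comp Z ?_
  exact ContMDiffAt.comp Z (g := fun Z : E => expE G (Z - prT B T Z))
    (f := fun Z : E => ((n : ℝ) + 1)⁻¹ • Z) hn
    (contDiff_const_smul _).contMDiff.contMDiffAt

theorem adE_one (X : E) : adE E (1 : G) X = X := by
  refine adE_eq_of_commute fun s => Commute.one_left _

theorem bE_adE_left (B : InvariantInnerProduct E G) {g : G} {X Z : E} (h : adE E g Z = Z) :
    bE B (adE E g⁻¹ X) Z = bE B X Z := by
  rw [← bE_adE B g, ← adE_mul, mul_inv_cancel, adE_one, h]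

/-- The logarithmic derivative of a power is a sum of `Ad`-conjugates of `L`. Paired with a vector
fixed by `Ad (c s)`, each term counts as `L` itself. -/
theorem HasLog.pow {c : ℝ → G} {s : ℝ} {L Z : E} (h : HasLog c s L)
    (B : InvariantInnerProduct E G) (hZ : adE E (c s) Z = Z) (n : ℕ) :
    ∃ L', HasLog (fun u => c u ^ n) s L' ∧ bE B L' Z = n * bE B L Z := by
  induction n with
  | zero =>
    refine ⟨0, ?_, by simp⟩
    unfold HasLog
    simpa using hasVel_const (F := E) (1 : G) s
  | succ n ih =>
    obtain ⟨L', h1, h2⟩ := ih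
    refine ⟨_, by simpa only [pow_succ] using h1.mul h, ?_⟩
    rw [map_add, LinearMap.add_apply, bE_adE_left B hZ, h2]
    push_cast; ring

/-- This replaces the formula for the derivative of `exp`. As `exp Y = exp (Y / (n + 1)) ^ (n + 1)`,
the pairing with `X` equals `(n + 1)` times that for the rescaled curve, for every `n`. As `n` grows
the rescaled curve shrinks to `0`, where the derivative of `exp` is the identity, and the limit is
the pairing of `V` with `X`. -/
theorem hasLog_expE_normal (N : Tube B T) {Y : ℝ → E} {s : ℝ} {V X : E} (hY : ∀ u, Y u ∈ nE B T)
    (hd : HasDerivAt Y V s) (hX : ∀ a : ℝ, adE E (expE G (a • Y s)) X = X) :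
    ∃ L, HasLog (fun u => expE G (Y u)) s L ∧ bE B L X = bE B V X := by
  have := lieGroup_one (E := E) (G := G)
  have hpY : ∀ u, prT B T (Y u) = 0 := fun u => prT_of_mem_nE B T (hY u)
  have hV : prT B T V = 0 := by
    have h1 := (prT B T).hasFDerivAt.comp_hasDerivAt s hd
    refine h1.unique ((hasDerivAt_const s (0 : E)).congr_of_eventuallyEq
      (Eventually.of_forall hpY))
  have hC := contMDiff_expE_prN N
  -- the map `(Z, W) ↦ exp (Z)⁻¹ exp (Z + W)` in the chart at the identity
  set χ := chart1 E G with hχ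
  set f : E × E → G := fun p => (expE G (p.1 - prT B T p.1))⁻¹ *
    expE G (p.1 + p.2 - prT B T (p.1 + p.2)) with hf
  have hfC : ContMDiff 𝓘(ℝ, E × E) 𝓘(ℝ, E) 1 f := by
    refine ContMDiff.mul (ContMDiff.inv ?_) ?_
    · exact hC.comp (g := fun Z : E => expE G (Z - prT B T Z)) (f := fun p : E × E => p.1)
        contDiff_fst.contMDiff
    · exact hC.comp (g := fun Z : E => expE G (Z - prT B T Z)) (f := fun p : E × E => p.1 + p.2)
        (contDiff_fst.add contDiff_snd).contMDiff
  have hf1 : ∀ Z, f (Z, 0) = 1 := fun Z => by simp [hf]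
  have hk : ∀ Z, ContDiffAt ℝ 1 (fun p => χ (f p)) (Z, 0) := by
    intro Z
    rw [← contMDiffAt_iff_contDiffAt]
    refine ContMDiffAt.comp (I' := 𝓘(ℝ, E)) (g := χ) (Z, (0 : E)) ?_ hfC.contMDiffAt
    rw [hf1]; exact contMDiffAt_extChartAt
  -- logarithmic derivatives of the rescaled curves
  have hL : ∀ n : ℕ, ∃ L, HasLog (fun u => expE G (((n : ℝ) + 1)⁻¹ • Y u)) s L ∧
      ((n : ℝ) + 1) • L = fderiv ℝ (fun p => χ (f p)) (((n : ℝ) + 1)⁻¹ • Y s, 0) (0, V) := by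
    intro n
    set a : ℝ := ((n : ℝ) + 1)⁻¹ with ha
    have ha0 : (n : ℝ) + 1 ≠ 0 := by positivity
    have hcurve : HasDerivAt (fun u => (a • Y s, a • Y u - a • Y s)) ((0 : E), a • V) s :=
      (hasDerivAt_const s _).prodMk ((hd.const_smul a).sub_const _)
    have hvel := (hcurve.hasVel (a := (a • Y s, 0)) (by simp)).comp (f := f)
      (hfC.contMDiffAt.mdifferentiableAt (by simp))
    rw [hf1] at hvel
    have heq : ∀ u, f (a • Y s, a • Y u - a • Y s) =
        (expE G (a • Y s))⁻¹ * expE G (a • Y u) := by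
      intro u; simp [hf, hpY]
    simp_rw [heq] at hvel
    refine ⟨_, hvel, ?_⟩
    have h1 := hvel.comp (f := χ) (md_extChartAt (1 : G))
    rw [D_extChartAt] at h1
    have h2 := HasFDerivAt.comp_hasDerivAt s (f := fun u => (a • Y s, a • Y u - a • Y s))
      (by simpa using ((hk (a • Y s)).differentiableAt (by simp)).hasFDerivAt) hcurve
    have h3 := h1.hasDerivAt.unique (by simpa only [Function.comp_def, heq] using h2)
    rw [ContinuousLinearMap.id_apply] at h3
    rw [h3, ← map_smul]
    simp [ha, smul_smul, mul_inv_cancel₀ ha0]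
  choose L hL1 hL2 using hL
  have hbase := hL1 0
  simp only [Nat.cast_zero, zero_add, inv_one, one_smul] at hbase
  refine ⟨L 0, hbase, ?_⟩
  -- The index is shifted by one: `L n` belongs to `Y / (n + 1)`, and `L 0` to `Y` itself.
  have hconst : ∀ n : ℕ, bE B (((n : ℝ) + 1) • L n) X = bE B (L 0) X := by
    intro n
    have ha0 : (n : ℝ) + 1 ≠ 0 := by positivity
    obtain ⟨L', h1, h2⟩ := (hL1 n).pow B (Z := X) (hX _) (n + 1)
    have h3 : (fun u => expE G (((n : ℝ) + 1)⁻¹ • Y u) ^ (n + 1)) = fun u => expE G (Y u) := by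
      ext u
      rw [← expE_nat_smul, smul_smul]
      push_cast
      rw [mul_inv_cancel₀ ha0, one_smul]
    rw [h3] at h1
    have h4 : L' = L 0 := HasVel.unique h1 hbase
    rw [map_smul, LinearMap.smul_apply, ← h4, h2]
    push_cast; rfl
  have hlim : Tendsto (fun n : ℕ => bE B (((n : ℝ) + 1) • L n) X) atTop (𝓝 (bE B V X)) := by
    refine ((continuous_bE_left (B := B) X).tendsto V).comp ?_
    simp_rw [hL2]
    have h1 : Tendsto (fun n : ℕ => (((n : ℝ) + 1)⁻¹ • Y s, (0 : E))) atTop (𝓝 (0, 0)) := by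
      have := (tendsto_one_div_add_atTop_nhds_zero_nat (𝕜 := ℝ)).smul_const (Y s)
      refine Tendsto.prodMk_nhds ?_ tendsto_const_nhds
      simpa using this
    have h2 : ContinuousAt (fderiv ℝ (fun p => χ (f p))) ((0 : E), (0 : E)) :=
      ((hk 0).fderiv_right (m := 0) (by simp)).continuousAt
    have h3 : fderiv ℝ (fun p => χ (f p)) ((0 : E), (0 : E)) (0, V) = V := by
      have e1 : HasDerivAt (fun u : ℝ => ((0 : E), u • V)) ((0 : E), V) 0 := by
        refine (hasDerivAt_const _ _).prodMk ?_
        simpa using (hasDerivAt_id (0 : ℝ)).smul_const V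
      have e2 := HasFDerivAt.comp_hasDerivAt (0 : ℝ) (f := fun u : ℝ => ((0 : E), u • V))
        (by simpa using ((hk 0).differentiableAt (by simp)).hasFDerivAt) e1
      have e3 := (hasVel_expE (G := G) V).comp (f := χ) (md_extChartAt (1 : G))
      rw [D_extChartAt] at e3
      refine e2.unique (e3.hasDerivAt.congr_of_eventuallyEq (Eventually.of_forall fun u => ?_))
      simp [hf, hV, expE_zero]
    have h4 := ((ContinuousLinearMap.apply ℝ E ((0 : E), V)).continuous.tendsto _).comp
      (h2.tendsto.comp h1)
    rw [ContinuousLinearMap.apply_apply, h3] at h4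
    exact h4
  exact tendsto_nhds_unique (tendsto_const_nhds.congr fun n => (hconst n).symm) hlim

/-- The exponential map of a maximal torus has a local inverse that extends differentiably to a
neighbourhood of the identity in `G`. -/
theorem exists_log (N : Tube B T) : ∃ lam : G → E, ∃ V ∈ 𝓝 (1 : G), ∃ U ∈ 𝓝 (0 : E),
    (∀ g, lam g ∈ tE E T) ∧ ContMDiffAt 𝓘(ℝ, E) 𝓘(ℝ, E) 1 lam 1 ∧ lam 1 = 0 ∧
    (∀ X ∈ tE E T, X ∈ U → lam (expE G X) = X) ∧
    ∀ t ∈ T.carrier, t ∈ V → expE G (lam t) = t := by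
  have := lieGroup_one (E := E) (G := G)
  set χ := chart1 E G with hχ
  -- The product of the two exponentials is a local `C¹` diffeomorphism at `0`; the `𝔱` component of
  -- its inverse is the logarithm.
  set κ : E → G := fun Z => expE G (prT B T Z) * expE G (Z - prT B T Z) with hκ
  have hκC : ContMDiff 𝓘(ℝ, E) 𝓘(ℝ, E) 1 κ := (contMDiff_expE_prT B T).mul (contMDiff_expE_prN N)
  have hκ0 : κ 0 = 1 := by simp [hκ, expE_zero]
  have hk : ContDiffAt ℝ 1 (fun Z => χ (κ Z)) 0 := by
    rw [← contMDiffAt_iff_contDiffAt]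
    refine ContMDiffAt.comp (I' := 𝓘(ℝ, E)) (g := χ) (0 : E) ?_ hκC.contMDiffAt
    rw [hκ0]; exact contMDiffAt_extChartAt
  have hkd : HasFDerivAt (fun Z => χ (κ Z))
      ((ContinuousLinearEquiv.refl ℝ E : E ≃L[ℝ] E) : E →L[ℝ] E) 0 := by
    convert (hk.differentiableAt (by simp)).hasFDerivAt using 1
    ext V
    have e1 : HasDerivAt (fun u : ℝ => u • V) V 0 := by
      simpa using (hasDerivAt_id (0 : ℝ)).smul_const V
    have e2 := HasFDerivAt.comp_hasDerivAt (0 : ℝ) (f := fun u : ℝ => u • V)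
      (by simpa using (hk.differentiableAt (by simp)).hasFDerivAt) e1
    have e3 := ((hasVel_expE (G := G) (prT B T V)).mul_curve
      (hasVel_expE (G := G) (V - prT B T V))).comp (f := χ) (md_extChartAt (1 : G))
    rw [D_extChartAt] at e3
    have e4 := e2.unique (e3.hasDerivAt.congr_of_eventuallyEq (Eventually.of_forall fun u => by
      simp [hκ, smul_sub]))
    simpa using e4.symm
  set ι : E → E := hk.localInverse hkd (by simp) with hι
  have hιs : ContDiffAt ℝ 1 ι (χ 1) := by
    have := hk.to_localInverse hkd (by simp)
    rwa [hκ0] at this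
  have hι1 : ι (χ 1) = 0 := by
    have := hk.localInverse_apply_image hkd (by simp)
    rwa [hκ0] at this
  have hleft : ∀ᶠ Z in 𝓝 (0 : E), ι (χ (κ Z)) = Z :=
    (hk.hasStrictFDerivAt' hkd (by simp)).eventually_left_inverse
  have hright : ∀ᶠ x in 𝓝 (χ 1), χ (κ (ι x)) = x := by
    have := (hk.hasStrictFDerivAt' hkd (by simp)).eventually_right_inverse
    rwa [hκ0] at this
  have hχc : ContinuousAt χ (1 : G) := continuousAt_extChartAt (1 : G)
  have hιc : Tendsto (fun g : G => ι (χ g)) (𝓝 1) (𝓝 0) := by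
    have := hιs.continuousAt.tendsto.comp hχc.tendsto
    rwa [hι1] at this
  have hsrc : (chartAt E (1 : G)).source ∈ 𝓝 (1 : G) :=
    (chartAt E (1 : G)).open_source.mem_nhds (mem_chart_source E 1)
  refine ⟨fun g => prT B T (ι (χ g)), _,
    (hχc.eventually hright).and ((hιc.eventually (hκC.continuous.continuousAt.eventually
      (by rw [hκ0]; exact hsrc))).and (Filter.Eventually.and hsrc
      (hιc.eventually ((show Tendsto (fun Z : E => Z - prT B T Z) (𝓝 0) (𝓝 0) by
        simpa [Pi.sub_def] using
          ((continuous_id.sub (prT B T).continuous).tendsto (0 : E))).eventually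
          N.eventually_lt)))), _, hleft, fun g => prT_mem B T _, ?_, by simp [hι1], ?_, ?_⟩
  · refine (prT B T).contDiff.contMDiff.contMDiffAt.comp (1 : G) ?_
    exact ContMDiffAt.comp (1 : G) (g := ι) (f := χ) hιs.contMDiffAt contMDiffAt_extChartAt
  · intro X hX hU
    have h1 : κ X = expE G X := by simp [hκ, prT_of_mem B T hX, expE_zero]
    rw [← h1]
    exact (congrArg (prT B T) hU).trans (prT_of_mem B T hX)
  · rintro t ht ⟨h1, h2, h3, h4⟩
    have h5 : κ (ι (χ t)) = t := by
      refine (extChartAt 𝓘(ℝ, E) (1 : G)).injOn ?_ ?_ h1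
      · rwa [extChartAt_source]
      · rwa [extChartAt_source]
    -- For `t ∈ T` both `t = t · exp 0` and `t = exp (Z_𝔱) exp (Z_⊥)` are tube decompositions, so
    -- `exp (Z_𝔱) = t`.
    have h6 := (N.eq_of_mul (expE_mem (prT_mem B T (ι (χ t)))) (sub_prT_mem B T (ι (χ t))) h4).1
    rw [show expE G (prT B T (ι (χ t))) * expE G (ι (χ t) - prT B T (ι (χ t))) = t from h5,
      (N.torus_eq ht).1] at h6
    exact h6.symm

end Tube

/-! ### Generating vector fields and their zeros -/

section Action

variable {E : Type*} [NormedAddCommGroup E] [NormedSpace ℝ E] [FiniteDimensional ℝ E]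
variable {G : Type*} [TopologicalSpace G] [ChartedSpace E G] [Group G] [LieGroup 𝓘(ℝ, E) ∞ G]
  [T2Space G]
variable {F : Type*} [NormedAddCommGroup F] [NormedSpace ℝ F]
variable {M : Type*} [TopologicalSpace M] [ChartedSpace F M] [IsManifold 𝓘(ℝ, F) ∞ M]
  [MulAction G M] [ContMDiffSMul 𝓘(ℝ, E) 𝓘(ℝ, F) ∞ G M]

theorem contMDiffAt_smul (p : G × M) :
    ContMDiffAt (𝓘(ℝ, E).prod 𝓘(ℝ, F)) 𝓘(ℝ, F) ∞ (fun q : G × M => q.1 • q.2) p :=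
  (contMDiff_smul (I := 𝓘(ℝ, E)) (I' := 𝓘(ℝ, F)) (n := ∞) (G := G) (M := M)).contMDiffAt

theorem contMDiffAt_const_smul (E : Type*) [NormedAddCommGroup E] [NormedSpace ℝ E]
    {G : Type*} [TopologicalSpace G] [ChartedSpace E G] [Group G] {F : Type*} [NormedAddCommGroup F]
    [NormedSpace ℝ F] {M : Type*} [TopologicalSpace M] [ChartedSpace F M] [MulAction G M]
    [ContMDiffSMul 𝓘(ℝ, E) 𝓘(ℝ, F) ∞ G M] (g : G) (m : M) :
    ContMDiffAt 𝓘(ℝ, F) 𝓘(ℝ, F) ∞ (fun x : M => g • x) m :=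
  (ContMDiffSMul.contMDiff_const_smul (I := 𝓘(ℝ, E)) (I' := 𝓘(ℝ, F)) (n := ∞) g).contMDiffAt

theorem md_const_smul (E : Type*) [NormedAddCommGroup E] [NormedSpace ℝ E]
    {G : Type*} [TopologicalSpace G] [ChartedSpace E G] [Group G] {F : Type*} [NormedAddCommGroup F]
    [NormedSpace ℝ F] {M : Type*} [TopologicalSpace M] [ChartedSpace F M] [MulAction G M]
    [ContMDiffSMul 𝓘(ℝ, E) 𝓘(ℝ, F) ∞ G M] (g : G) (m : M) : MD F F (fun x : M => g • x) m :=
  (contMDiffAt_const_smul E g m).mdifferentiableAt (by simp)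

theorem contMDiffAt_smul_const (g : G) (m : M) :
    ContMDiffAt 𝓘(ℝ, E) 𝓘(ℝ, F) ∞ (fun a : G => a • m) g :=
  (contMDiffAt_smul (E := E) (F := F) (g, m)).comp g (f := fun a : G => (a, m))
    (contMDiffAt_id.prodMk contMDiffAt_const)

theorem md_smul_const (g : G) (m : M) : MD E F (fun a : G => a • m) g :=
  (contMDiffAt_smul_const g m).mdifferentiableAt (by simp)

variable (E F G) in
/-- The generating vector fields, on the model spaces. -/
def genE (m : M) : E →L[ℝ] F := -D E F (fun a : G => a • m) 1

theorem hasVel_expE_smul (X : E) (m : M) :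
    HasVel (fun s : ℝ => expE G (s • X) • m) 0 m (-genE E G F m X) := by
  have := (hasVel_expE (G := G) X).comp (F' := F) (f := fun a : G => a • m) (md_smul_const 1 m)
  rw [one_smul] at this
  simpa [genE] using this

/-- The generating vector field of `X` vanishes at `m` iff `m` is fixed by `exp (s X)`. -/
theorem genE_eq_zero_iff {X : E} {m : M} :
    genE E G F m X = 0 ↔ ∀ s : ℝ, expE G (s • X) • m = m := by
  constructor
  · intro h s
    have : IsManifold 𝓘(ℝ, F) 1 M := .of_le (n := ∞) ENat.LEInfty.out
    have h0 := hasVel_expE_smul (F := F) (G := G) X m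
    rw [h, neg_zero] at h0
    have := eq_of_hasVel_zero (F := F) (c := fun s : ℝ => expE G (s • X) • m) (fun s => by
      have h1 := h0.reparam (φ := fun u => u - s) (s := s) ((hasDerivAt_id s).sub_const s) (by simp)
      rw [smul_zero] at h1
      have h2 := h1.comp (F' := F) (f := fun x : M => expE G (s • X) • x) (md_const_smul E _ _)
      rw [map_zero] at h2
      refine h2.congr (Eventually.of_forall fun u => ?_)
      simp only
      rw [smul_smul, ← expE_add_smul]
      congr 3; ring) s
    simpa [expE_zero] using this
  · intro h
    have h1 := hasVel_expE_smul (F := F) (G := G) X m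
    simp_rw [h] at h1
    simpa using h1.unique (hasVel_const m 0)

end Action

/-! ### Differential of the abelianized moment map, and its local lifts -/

section Moment

variable {E : Type*} [NormedAddCommGroup E] [NormedSpace ℝ E] [FiniteDimensional ℝ E]
variable {G : Type*} [TopologicalSpace G] [ChartedSpace E G] [Group G] [LieGroup 𝓘(ℝ, E) ∞ G]
  [T2Space G]
variable {F : Type*} [NormedAddCommGroup F] [NormedSpace ℝ F]
variable {M : Type*} [TopologicalSpace M] [ChartedSpace F M] [IsManifold 𝓘(ℝ, F) ∞ M]
  [MulAction G M] [ContMDiffSMul 𝓘(ℝ, E) 𝓘(ℝ, F) ∞ G M]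
variable {B : InvariantInnerProduct E G} {T : MaximalTorus G} {N : Tube B T}
  {Q : QHamiltonianSpace F M B}

theorem md_Φ (Q : QHamiltonianSpace F M B) (m : M) : MD F E Q.Φ m :=
  Q.smooth_Φ.contMDiffAt.mdifferentiableAt (by simp)

theorem commute_Φ {X : E} {m : M} (h : genE E G F m X = 0) (s : ℝ) :
    Commute (expE G (s • X)) (Q.Φ m) := by
  have h1 := Q.equivariant (expE G (s • X)) m
  rw [genE_eq_zero_iff.1 h s] at h1
  have h2 : Q.Φ m * expE G (s • X) = expE G (s • X) * Q.Φ m := by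
    conv_lhs => rw [h1]
    group
  exact h2.symm

/-- The logarithmic derivative of the moment map is orthogonal to the infinitesimal stabilizer. -/
theorem bE_hasLog_Φ {x : ℝ → M} {s : ℝ} {m : M} {v : F} (hx : HasVel x s m v) {X : E}
    (hX : genE E G F m X = 0) : ∃ L, HasLog (fun u => Q.Φ (x u)) s L ∧ bE B L X = 0 := by
  have hv := hx.comp (md_Φ Q m)
  set g := Q.Φ m with hg
  set w := D F E Q.Φ m v with hw
  have hgs : Q.Φ (x s) = g := hv.1
  have h1 : HasVel (fun u => g⁻¹ * Q.Φ (x u)) s 1 (D E E (fun h : G => g⁻¹ * h) g w) := by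
    have := hv.comp (f := fun h : G => g⁻¹ * h) (md_mul_left g⁻¹ g)
    rwa [inv_mul_cancel] at this
  have h2 : HasVel (fun u => Q.Φ (x u) * g⁻¹) s 1 (D E E (fun h : G => h * g⁻¹) g w) := by
    have := hv.comp (f := fun h : G => h * g⁻¹) (md_mul_right g⁻¹ g)
    rwa [mul_inv_cancel] at this
  set L := D E E (fun h : G => g⁻¹ * h) g w with hL
  -- The right logarithmic derivative is `Ad_g` of the left one; as `Ad_g` fixes `X`, both pair
  -- equally with `X`.
  have h3 : D E E (fun h : G => h * g⁻¹) g w = adE E g L := by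
    refine h2.unique ((h1.conj g).congr (Eventually.of_forall fun u => ?_))
    simp only; group
  refine ⟨L, by unfold HasLog; simpa only [hgs] using h1, ?_⟩
  have h4 := Q.moment m X v
  have h5 : Q.form m ![gen E G F m X, v] = 0 :=
    (Q.form m).map_coord_zero 0 hX
  rw [h5, neg_zero] at h4
  have h6 : (0 : ℝ) = (1 / 2) * bE B (L + D E E (fun h : G => h * g⁻¹) g w) X := h4
  have h7 : adE E g X = X := adE_eq_of_commute fun u => (commute_Φ hX u).symm
  have h8 : bE B (adE E g L) X = bE B L X := by
    rw [← bE_adE B g L X, h7]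
  rw [h3, map_add, LinearMap.add_apply, h8] at h6
  linarith

/-- The derivative of a local lift of the abelianized moment map is orthogonal to the infinitesimal
stabilizer. -/
theorem bE_deriv_lift_eq_zero {x : ℝ → M} {s : ℝ} {m : M} {v : F} (hx : HasVel x s m v)
    (hm : m ∈ calX N Q) {X : E} (hXT : X ∈ tE E T) (hX : genE E G F m X = 0) {ξ : ℝ → E} {w : E}
    (hξT : ∀ u, ξ u ∈ tE E T) (hξ : HasDerivAt ξ w s)
    (heq : ∀ᶠ u in 𝓝 s, expE G (ξ u) = N.proj (Q.Φ (x u))) : bE B w X = 0 := by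
  have hm' : Q.Φ m ∈ N.nhd := hm
  have hv := hx.comp (md_Φ Q m)
  have hxs : Q.Φ (x s) = Q.Φ m := hv.1
  set Z : ℝ → E := fun u => N.normal (Q.Φ (x u)) with hZ
  have hZd : HasDerivAt Z (D E E N.normal (Q.Φ m) (D F E Q.Φ m v)) s :=
    (hv.comp (f := N.normal)
      ((N.contMDiffAt_normal hm').mdifferentiableAt (by simp))).hasDerivAt
  set V₀ := D E E N.normal (Q.Φ m) (D F E Q.Φ m v)
  -- Outside the tube `N.normal` carries no information. Subtracting the projection puts the curve
  -- in `𝔱^⊥` at all times and changes nothing near `s`.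
  have hYd : HasDerivAt (fun u => Z u - prT B T (Z u)) (V₀ - prT B T V₀) s :=
    hZd.sub ((prT B T).hasFDerivAt.comp_hasDerivAt s hZd)
  have hnhd : ∀ᶠ u in 𝓝 s, Q.Φ (x u) ∈ N.nhd :=
    hv.continuousAt.eventually (by simp only [hxs]; exact N.isOpen_nhd.mem_nhds hm')
  have hYZ : ∀ᶠ u in 𝓝 s, Z u - prT B T (Z u) = Z u := by
    filter_upwards [hnhd] with u hu
    rw [prT_of_mem_nE B T (N.spec hu).2.1, sub_zero]
  have hYs : Z s - prT B T (Z s) = N.normal (Q.Φ m) := by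
    rw [hYZ.self_of_nhds, hZ]; simp only [hxs]
  have hfix : ∀ u : ℝ, adE E (expE G (u • X)) (N.normal (Q.Φ m)) = N.normal (Q.Φ m) := by
    intro u
    have h1 := (N.conj hm' (expE_mem (Submodule.smul_mem _ u hXT))).2
    have h2 : expE G (u • X) * Q.Φ m * (expE G (u • X))⁻¹ = Q.Φ m := by
      rw [(commute_Φ (Q := Q) hX u).eq, mul_inv_cancel_right]
    rw [h2] at h1
    exact h1.symm
  -- Conjugation by `exp (u X)` fixes `Φ(m)`, hence its normal component `Y`. So `exp (u X)`
  -- commutes with `exp (a Y)`, and `Ad (exp (a Y))` fixes `X`.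
  have hcomm : ∀ a : ℝ, adE E (expE G (a • N.normal (Q.Φ m))) X = X := by
    intro a
    refine adE_eq_of_commute fun u => ?_
    have h1 := expE_adE (G := G) (expE G (u • X)) (a • N.normal (Q.Φ m))
    rw [map_smul, hfix] at h1
    exact (eq_mul_inv_iff_mul_eq.1 h1)
  obtain ⟨L, hL1, hL2⟩ := hasLog_expE_normal N (Y := fun u => Z u - prT B T (Z u)) (X := X)
    (fun u => sub_prT_mem B T _) hYd (by simp only [hYs]; exact hcomm)
  obtain ⟨L', hL'1, hL'2⟩ := bE_hasLog_Φ (Q := Q) hx hX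
  have hprod := (hasLog_expE_comp B T hξT hξ).mul hL1
  have hΦ : (fun u => Q.Φ (x u)) =ᶠ[𝓝 s] fun u => expE G (ξ u) * expE G (Z u - prT B T (Z u)) := by
    filter_upwards [hnhd, hYZ, heq] with u h1 h2 h3
    rw [h3, h2]
    exact (N.spec h1).2.2.2.symm
  have h1 : L' = adE E (expE G (Z s - prT B T (Z s)))⁻¹ w + L := by
    refine HasVel.unique hL'1 (HasVel.congr hprod ?_)
    filter_upwards [hΦ] with u hu
    have hs := hΦ.self_of_nhds
    simp only at hs
    rw [hu, hs]
  have h2 : bE B (adE E (expE G (Z s - prT B T (Z s)))⁻¹ w) X = bE B w X := by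
    refine bE_adE_left B ?_
    have := hcomm 1
    rwa [one_smul, ← hYs] at this
  have h3 : bE B (V₀ - prT B T V₀) X = 0 := by
    rw [bE_symm]
    exact (mem_nE B T).1 (sub_prT_mem B T V₀) X hXT
  rw [h1, map_add, LinearMap.add_apply, h2, hL2, h3, add_zero] at hL'2
  exact hL'2

/-- The moment map of `p ∈ X̂`, with values in the model space. -/
def Xhat.momE (p : Xhat N Q) : E := (p.moment : LieAlg E G)

theorem Xhat.momE_mem (p : Xhat N Q) : p.momE ∈ tE E T := p.moment.2

theorem Xhat.proj_eq (p : Xhat N Q) : N.proj (Q.Φ p.pt) = expE G p.momE := p.2.2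

theorem Xhat.continuous_pt : Continuous (Xhat.pt : Xhat N Q → M) :=
  continuous_fst.comp continuous_subtype_val

theorem Xhat.continuous_momE : Continuous (Xhat.momE : Xhat N Q → E) :=
  (continuous_subtype_val (p := fun X : LieAlg E G => X ∈ T.lie (E := E))).comp
    ((continuous_snd (X := M) (Y := T.lie (E := E))).comp continuous_subtype_val)

/-- Near every point, the covering `X̂ → 𝒳` has a section through which the moment map factors. -/
theorem exists_lift (p : Xhat N Q) : ∃ ξ : M → E, ∃ O : Set M, IsOpen O ∧ p.pt ∈ O ∧
    O ⊆ calX N Q ∧ (∀ m, ξ m ∈ tE E T) ∧ ξ p.pt = p.momE ∧ (∀ m ∈ O, MD F E ξ m) ∧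
    (∀ m ∈ O, N.proj (Q.Φ m) = expE G (ξ m)) ∧ ∀ᶠ q in 𝓝 p, q.momE = ξ q.pt := by
  obtain ⟨lam, V, hV, U, hU, hlT, hls, hl1, hlX, hlt⟩ := exists_log N
  have hp : Q.Φ p.pt ∈ N.nhd := p.2.1
  set c : M → G := fun m => expE G (-p.momE) * N.proj (Q.Φ m) with hc
  have hcp : c p.pt = 1 := by
    simp only [hc]
    rw [p.proj_eq, expE_neg, inv_mul_cancel]
  have : IsManifold 𝓘(ℝ, E) 1 G := .of_le (n := ∞) ENat.LEInfty.out
  have hlam : ∀ᶠ g in 𝓝 (1 : G), MD E E lam g := by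
    filter_upwards [(contMDiffAt_iff_contMDiffAt_nhds (by simp)).1 hls] with g hg
    exact hg.mdifferentiableAt (by simp)
  have hcm : ∀ m ∈ calX N Q, MD F E c m := by
    intro m hm
    refine MDifferentiableAt.comp (I' := 𝓘(ℝ, E)) (g := fun g : G => expE G (-p.momE) * g) m
      (md_mul_left _ _) ?_
    exact MDifferentiableAt.comp (I' := 𝓘(ℝ, E)) (g := N.proj) m
      ((N.contMDiffAt_proj hm).mdifferentiableAt (by simp)) (md_Φ Q m)
  have hopen : IsOpen (calX N Q) := N.isOpen_nhd.preimage Q.smooth_Φ.continuous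
  have hev : ∀ᶠ m in 𝓝 p.pt, m ∈ calX N Q ∧ MD E E lam (c m) ∧ c m ∈ V := by
    have hcc := (hcm _ hp).continuousAt
    refine Filter.Eventually.and (hopen.mem_nhds hp) (Filter.Eventually.and ?_ ?_)
    · exact hcc.eventually (by rw [hcp]; exact hlam)
    · exact hcc.eventually (by rw [hcp]; exact hV)
  obtain ⟨O, hO, hOo, hpO⟩ := eventually_nhds_iff.1 hev
  -- Translating by `exp (-Φ̂_a(p))` brings the values near `1`, where the local logarithm applies.
  refine ⟨fun m => p.momE + lam (c m), O, hOo, hpO, fun m hm => (hO m hm).1,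
    fun m => Submodule.add_mem _ p.momE_mem (hlT _), by simp [hcp, hl1], ?_, ?_, ?_⟩
  · intro m hm
    have h1 : MD F E (fun m => lam (c m)) m :=
      MDifferentiableAt.comp (I' := 𝓘(ℝ, E)) (g := lam) m (hO m hm).2.1 (hcm m (hO m hm).1)
    exact mdifferentiableAt_const.add h1
  · intro m hm
    obtain ⟨h1, h2, h3⟩ := hO m hm
    have h4 : c m ∈ T.carrier :=
      T.mul_mem (expE_mem (Submodule.neg_mem _ p.momE_mem)) (N.spec h1).1
    rw [expE_add (T := T) p.momE_mem (hlT _), hlt _ h4 h3]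
    simp only [hc]
    rw [expE_neg, mul_inv_cancel_left]
  · have h1 : Tendsto (fun q : Xhat N Q => q.momE - p.momE) (𝓝 p) (𝓝 0) := by
      have := (Xhat.continuous_momE.tendsto p).sub_const p.momE
      simpa using this
    filter_upwards [h1.eventually hU] with q hq
    have h2 : c q.pt = expE G (q.momE - p.momE) := by
      simp only [hc]
      rw [q.proj_eq, ← expE_add (T := T) (Submodule.neg_mem _ p.momE_mem) q.momE_mem]
      congr 1; abel
    rw [h2, hlX _ (Submodule.sub_mem _ q.momE_mem p.momE_mem) hq]
    abel

end Moment

/-! ### Smoothness of integrals over a compact parameter space -/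

section ParametricIntegral

variable {V V' W : Type*} [NormedAddCommGroup V] [NormedSpace ℝ V] [NormedAddCommGroup V']
  [NormedSpace ℝ V'] [NormedAddCommGroup W] [NormedSpace ℝ W]

theorem contDiffAt_iteratedFDeriv_param {f : V' × V → W} {p₀ : V' × V} (hf : ContDiffAt ℝ ∞ f p₀)
    (k : ℕ) :
    ContDiffAt ℝ ∞ (fun p : V' × V => iteratedFDeriv ℝ k (fun x => f (p.1, x)) p.2) p₀ := by
  induction k with
  | zero =>
    simp_rw [iteratedFDeriv_zero_eq_comp]
    exact (continuousMultilinearCurryFin0 ℝ V W).symm.contDiff.contDiffAt.comp p₀ hf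
  | succ k ih =>
    simp_rw [iteratedFDeriv_succ_eq_comp_left]
    let L : (V →L[ℝ] V [×k]→L[ℝ] W) →L[ℝ] V [×(k + 1)]→L[ℝ] W :=
      ((continuousMultilinearCurryLeftEquiv ℝ (fun _ : Fin (k + 1) => V) W).symm :
        (V →L[ℝ] V [×k]→L[ℝ] W) →L[ℝ] V [×(k + 1)]→L[ℝ] W)
    refine (ContinuousLinearMap.contDiff (𝕜 := ℝ) (E := V →L[ℝ] V [×k]→L[ℝ] W)
      (F := V [×(k + 1)]→L[ℝ] W) L).contDiffAt.comp p₀ ?_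
    refine ContDiffAt.fderiv (n := ∞) (f := fun (p : V' × V) (x : V) =>
      iteratedFDeriv ℝ k (fun x => f (p.1, x)) x) (g := fun p : V' × V => p.2) ?_
      contDiffAt_snd (by simp)
    exact ContDiffAt.comp (p₀, p₀.2) (g := fun p : V' × V =>
      iteratedFDeriv ℝ k (fun x => f (p.1, x)) p.2)
      (f := fun q : (V' × V) × V => (q.1.1, q.2)) ih
      ((contDiff_fst.comp contDiff_fst).prodMk contDiff_snd).contDiffAt

variable {H : Type*} [TopologicalSpace H] [CompactSpace H] [MeasurableSpace H] [BorelSpace H]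
  (μ : Measure H) [IsFiniteMeasure μ]

theorem integrable_of_continuous {f : H → W} (hf : Continuous f) : Integrable f μ :=
  hf.integrable_of_hasCompactSupport (HasCompactSupport.of_compactSpace f)

theorem hasFDerivAt_integral_of_continuousOn {f : H → V → W} {f' : H → V → V →L[ℝ] W} {U : Set V}
    (hU : IsOpen U) (hf : ContinuousOn (fun p : H × V => f p.1 p.2) (univ ×ˢ U))
    (hf' : ContinuousOn (fun p : H × V => f' p.1 p.2) (univ ×ˢ U))
    (hd : ∀ h, ∀ x ∈ U, HasFDerivAt (f h) (f' h x) x) {x : V} (hx : x ∈ U) :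
    HasFDerivAt (fun x => ∫ h, f h x ∂μ) (∫ h, f' h x ∂μ) x := by
  have hfc : ∀ x ∈ U, Continuous fun h => f h x := fun x hx =>
    continuousOn_univ.1 (hf.comp (f := fun h => (h, x)) (by fun_prop) fun h _ => ⟨trivial, hx⟩)
  have hfc' : ∀ x ∈ U, Continuous fun h => f' h x := fun x hx =>
    continuousOn_univ.1 (hf'.comp (f := fun h => (h, x)) (by fun_prop) fun h _ => ⟨trivial, hx⟩)
  obtain ⟨C, hC⟩ := isCompact_univ.exists_bound_of_continuousOn (hfc' x hx).continuousOn
  -- Compactness of `H` gives one neighbourhood of `x` on which the derivatives are bounded for all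
  -- parameters; the constant `C + 1` is the dominating function.
  have hb : ∀ᶠ y in 𝓝 x, ∀ h ∈ (univ : Set H), y ∈ U ∧ ‖f' h y‖ < C + 1 := by
    refine isCompact_univ.eventually_forall_of_forall_eventually fun h _ => ?_
    have h1 : ContinuousAt (fun p : H × V => f' p.1 p.2) (h, x) :=
      hf'.continuousAt ((isOpen_univ.prod hU).mem_nhds ⟨trivial, hx⟩)
    have h2 : ContinuousAt (fun p : V × H => f' p.2 p.1) (x, h) :=
      ContinuousAt.comp (f := Prod.swap) (x := (x, h)) h1 continuous_swap.continuousAt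
    refine Filter.Eventually.and ?_ ?_
    · exact continuousAt_fst.eventually (hU.mem_nhds hx)
    · exact h2.norm.eventually_lt continuousAt_const (by linarith [hC h trivial])
  refine hasFDerivAt_integral_of_dominated_of_fderiv_le (bound := fun _ => C + 1) (𝕜 := ℝ)
    (F := fun x h => f h x) (F' := fun x h => f' h x)
    (s := {y | ∀ h ∈ (univ : Set H), y ∈ U ∧ ‖f' h y‖ < C + 1}) hb ?_ ?_ ?_ ?_ ?_ ?_
  · filter_upwards [hU.mem_nhds hx] with y hy
    exact (integrable_of_continuous μ (hfc y hy)).aestronglyMeasurable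
  · exact integrable_of_continuous μ (hfc x hx)
  · exact (integrable_of_continuous μ (hfc' x hx)).aestronglyMeasurable
  · exact Eventually.of_forall fun h y hy => (hy h trivial).2.le
  · exact integrable_const _
  · exact Eventually.of_forall fun h y hy => hd h y (hy h trivial).1

/-- The parameter space need not be a manifold: joint continuity of each iterated derivative
suffices to integrate the Taylor series term by term. -/
theorem contDiffOn_integral [CompleteSpace W] {f : H → V → W} {U : Set V} (hU : IsOpen U)
    (hf : ∀ h, ContDiffOn ℝ ∞ (f h) U)
    (hc : ∀ k : ℕ, ContinuousOn (fun p : H × V => iteratedFDeriv ℝ k (f p.1) p.2) (univ ×ˢ U)) :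
    ContDiffOn ℝ ∞ (fun x => ∫ h, f h x ∂μ) U := by
  have hcx : ∀ k : ℕ, ∀ x ∈ U, Continuous fun h => iteratedFDeriv ℝ k (f h) x := fun k x hx =>
    continuousOn_univ.1 ((hc k).comp (f := fun h => (h, x)) (by fun_prop) fun h _ => ⟨trivial, hx⟩)
  have key : HasFTaylorSeriesUpToOn ∞ (fun x => ∫ h, f h x ∂μ)
      (fun x k => ∫ h, iteratedFDeriv ℝ k (f h) x ∂μ) U := by
    have hder : ∀ (m : ℕ), ∀ x ∈ U, HasFDerivAt (fun x => ∫ h, iteratedFDeriv ℝ m (f h) x ∂μ)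
        (∫ h, iteratedFDeriv ℝ (m + 1) (f h) x ∂μ).curryLeft x := by
      intro m x hx
      let L := continuousMultilinearCurryLeftEquiv ℝ (fun _ : Fin (m + 1) => V) W
      have h1 : (∫ h, iteratedFDeriv ℝ (m + 1) (f h) x ∂μ).curryLeft =
          ∫ h, (iteratedFDeriv ℝ (m + 1) (f h) x).curryLeft ∂μ := by
        let L' : (V [×(m + 1)]→L[ℝ] W) →L[ℝ] V →L[ℝ] V [×m]→L[ℝ] W :=
          (L : (V [×(m + 1)]→L[ℝ] W) →L[ℝ] V →L[ℝ] V [×m]→L[ℝ] W)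
        exact (ContinuousLinearMap.integral_comp_comm (𝕜 := ℝ) (E := V [×(m + 1)]→L[ℝ] W)
          (Fₗ := V →L[ℝ] V [×m]→L[ℝ] W) L' (integrable_of_continuous μ (hcx (m + 1) x hx))).symm
      rw [h1]
      refine hasFDerivAt_integral_of_continuousOn μ hU (hc m)
        (f' := fun h x => (iteratedFDeriv ℝ (m + 1) (f h) x).curryLeft)
        (L.continuous.comp_continuousOn (hc (m + 1))) ?_ hx
      intro h y hy
      have h2 : DifferentiableAt ℝ (iteratedFDeriv ℝ m (f h)) y :=
        (((hf h).contDiffAt (hU.mem_nhds hy)).iteratedFDeriv_right (m := 1) (i := m)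
          (by norm_cast; exact le_top)).differentiableAt (by simp)
      have h3 : (iteratedFDeriv ℝ (m + 1) (f h) y).curryLeft =
          fderiv ℝ (iteratedFDeriv ℝ m (f h)) y := by
        rw [iteratedFDeriv_succ_eq_comp_left]
        exact L.apply_symm_apply _
      rw [h3]
      exact h2.hasFDerivAt
    refine ⟨fun x hx => ?_, fun m _ x hx => (hder m x hx).hasFDerivWithinAt,
      fun m _ x hx => (hder m x hx).continuousAt.continuousWithinAt⟩
    let L' : (V [×0]→L[ℝ] W) →L[ℝ] W :=
      (continuousMultilinearCurryFin0 ℝ V W : (V [×0]→L[ℝ] W) →L[ℝ] W)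
    have h1 : (∫ h, iteratedFDeriv ℝ 0 (f h) x ∂μ).curry0 =
        ∫ h, (iteratedFDeriv ℝ 0 (f h) x).curry0 ∂μ :=
      (L'.integral_comp_comm
        (integrable_of_continuous μ (hcx 0 x hx))).symm
    rw [h1]
    rfl
  exact key.contDiffOn

end ParametricIntegral

/-! ### Derivatives of the action and their dependence on the group element -/

section Average

theorem exists_leftInvariant_probability (K : Type*) [Group K] [TopologicalSpace K]
    [IsTopologicalGroup K] [CompactSpace K] [MeasurableSpace K] [BorelSpace K] :
    ∃ μ : Measure K, IsProbabilityMeasure μ ∧ μ.IsMulLeftInvariant :=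
  ⟨Measure.haarMeasure (⊤ : TopologicalSpace.PositiveCompacts K),
    ⟨Measure.haarMeasure_self (K₀ := (⊤ : TopologicalSpace.PositiveCompacts K))⟩, inferInstance⟩

theorem isOpen_setOf_forall_smul_mem {G M : Type*} [TopologicalSpace G] [TopologicalSpace M]
    [SMul G M] [ContinuousSMul G M] {H : Set G} (hH : IsCompact H) {W : Set M} (hW : IsOpen W) :
    IsOpen {m : M | ∀ h ∈ H, h • m ∈ W} := by
  rw [isOpen_iff_mem_nhds]
  intro m hm
  refine hH.eventually_forall_of_forall_eventually fun h hh => ?_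
  have : Continuous fun p : M × G => p.2 • p.1 := continuous_snd.smul continuous_fst
  exact this.continuousAt.eventually (hW.mem_nhds (hm h hh))

variable {E : Type*} [NormedAddCommGroup E] [NormedSpace ℝ E] [FiniteDimensional ℝ E]
variable {G : Type*} [TopologicalSpace G] [ChartedSpace E G] [Group G] [LieGroup 𝓘(ℝ, E) ∞ G]
  [T2Space G]
variable {F : Type*} [NormedAddCommGroup F] [NormedSpace ℝ F] [FiniteDimensional ℝ F]
variable {M : Type*} [TopologicalSpace M] [ChartedSpace F M] [IsManifold 𝓘(ℝ, F) ∞ M]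
  [MulAction G M] [ContMDiffSMul 𝓘(ℝ, E) 𝓘(ℝ, F) ∞ G M]

variable (F) in
/-- The derivative at `m` of the action of `g`, as an endomorphism of the model space. -/
def actD (g : G) (m : M) : F →L[ℝ] F := D F F (fun x : M => g • x) m

variable (F) in
/-- The action of `g` in the preferred chart at `m₀`, centered at `0` in the target. -/
def actRep (m₀ : M) (g : G) (y : F) : F :=
  extChartAt 𝓘(ℝ, F) m₀ (g • (extChartAt 𝓘(ℝ, F) m₀).symm y) - extChartAt 𝓘(ℝ, F) m₀ m₀

theorem actD_one (m : M) : actD F (1 : G) m = ContinuousLinearMap.id ℝ F := by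
  rw [← D_id (F := F) m]
  exact D_congr (Eventually.of_forall fun x => one_smul G x)

variable (E) in
include E in
theorem actD_mul {g k : G} {m : M} (hk : k • m = m) :
    actD F (g * k) m = (actD F g m).comp (actD F k m) := by
  have := D_comp (F := F) (F' := F) (F'' := F) (g := fun x : M => g • x) (f := fun x : M => k • x)
    hk (md_const_smul E g m) (md_const_smul E k m)
  rw [actD, actD, actD, ← this]
  exact D_congr (Eventually.of_forall fun x => mul_smul g k x)

variable (E) in
include E in
theorem actD_inv_comp {g : G} {m : M} (hg : g • m = m) :
    (actD F g m).comp (actD F g⁻¹ m) = ContinuousLinearMap.id ℝ F := by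
  rw [← actD_mul E (inv_smul_eq_iff.2 hg.symm), mul_inv_cancel, actD_one]

variable (E) in
include E in
theorem actRep_self_param_contDiffAt {m₀ : M} {g : G} {m : M}
    (hm : m ∈ (chartAt F m₀).source) (hgm : g • m ∈ (chartAt F m₀).source) :
    ContDiffAt ℝ ∞ (fun p : E × F => actRep F m₀ ((extChartAt 𝓘(ℝ, E) g).symm p.1) p.2)
      (extChartAt 𝓘(ℝ, E) g g, extChartAt 𝓘(ℝ, F) m₀ m) := by
  have hG : IsManifold 𝓘(ℝ, E) ∞ G := inferInstance
  refine ContDiffAt.sub ?_ contDiffAt_const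
  refine contDiffAt_rep_prod (f := fun q : G × M => extChartAt 𝓘(ℝ, F) m₀ (q.1 • q.2)) le_rfl
    (mem_chart_source E g) hm ?_
  exact ContMDiffAt.comp (I' := 𝓘(ℝ, F)) (g := extChartAt 𝓘(ℝ, F) m₀) (g, m)
    (contMDiffAt_extChartAt' hgm) (contMDiffAt_smul (g, m))

-- Reading `G` in the chart at `g` turns the action into a smooth map on a product of vector spaces,
-- so partial derivatives along `F` are jointly continuous.
variable (E) in
include E in
theorem continuousAt_iteratedFDeriv_actRep {m₀ : M} {g : G} {m : M}
    (hm : m ∈ (chartAt F m₀).source) (hgm : g • m ∈ (chartAt F m₀).source) (k : ℕ) :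
    ContinuousAt (fun p : G × F => iteratedFDeriv ℝ k (actRep F m₀ p.1) p.2)
      (g, extChartAt 𝓘(ℝ, F) m₀ m) := by
  have h1 := (contDiffAt_iteratedFDeriv_param (actRep_self_param_contDiffAt E hm hgm) k).continuousAt
  have h2 : ContinuousAt (fun p : G × F => (extChartAt 𝓘(ℝ, E) g p.1, p.2))
      (g, extChartAt 𝓘(ℝ, F) m₀ m) :=
    ((continuousAt_extChartAt (I := 𝓘(ℝ, E)) g).comp (f := Prod.fst)
      (x := (g, extChartAt 𝓘(ℝ, F) m₀ m)) continuousAt_fst).prodMk continuousAt_snd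
  have h3 := ContinuousAt.comp (x := (g, extChartAt 𝓘(ℝ, F) m₀ m))
    (f := fun p : G × F => (extChartAt 𝓘(ℝ, E) g p.1, p.2)) h1 h2
  refine h3.congr ?_
  have h4 : ∀ᶠ p : G × F in 𝓝 (g, extChartAt 𝓘(ℝ, F) m₀ m), p.1 ∈ (extChartAt 𝓘(ℝ, E) g).source :=
    continuousAt_fst.eventually (extChartAt_source_mem_nhds (I := 𝓘(ℝ, E)) g)
  filter_upwards [h4] with p hp
  simp only [Function.comp_apply, (extChartAt 𝓘(ℝ, E) g).left_inv hp]

variable (E) in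
include E in
theorem actRep_contDiffAt {m₀ : M} {g : G} {m : M}
    (hm : m ∈ (chartAt F m₀).source) (hgm : g • m ∈ (chartAt F m₀).source) :
    ContDiffAt ℝ ∞ (actRep F m₀ g) (extChartAt 𝓘(ℝ, F) m₀ m) := by
  refine ContDiffAt.sub ?_ contDiffAt_const
  refine contDiffAt_rep (f := fun q : M => extChartAt 𝓘(ℝ, F) m₀ (g • q)) le_rfl hm ?_
  exact ContMDiffAt.comp (I' := 𝓘(ℝ, F)) (g := extChartAt 𝓘(ℝ, F) m₀) m
    (contMDiffAt_extChartAt' hgm) (contMDiffAt_const_smul E g m)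

variable (E) in
include E in
theorem actD_eq_fderiv_actRep {m₀ : M} {g : G} (hg : g • m₀ = m₀) :
    actD F g m₀ = fderiv ℝ (actRep F m₀ g) (extChartAt 𝓘(ℝ, F) m₀ m₀) := by
  rw [actD, D_eq_fderiv_written (md_const_smul E g m₀)]
  unfold actRep
  rw [fderiv_sub_const]
  congr 1
  ext y
  simp only [writtenInExtChartAt, Function.comp_apply, hg]

variable (E) in
include E in
theorem continuousOn_actD (H : Set G) {m₀ : M} (hH : ∀ g ∈ H, g • m₀ = m₀) :
    ContinuousOn (fun g : G => actD F g m₀) H := by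
  rw [continuousOn_clm_apply]
  intro v g hg
  have h1 : ContinuousAt (fun g : G => iteratedFDeriv ℝ 1 (actRep F m₀ g)
      (extChartAt 𝓘(ℝ, F) m₀ m₀)) g :=
    ContinuousAt.comp (f := fun g : G => (g, extChartAt 𝓘(ℝ, F) m₀ m₀)) (x := g)
      (continuousAt_iteratedFDeriv_actRep E (mem_chart_source F m₀)
        (by rw [hH g hg]; exact mem_chart_source F m₀) 1)
      (by fun_prop)
  have h2 : ContinuousAt (fun g : G => iteratedFDeriv ℝ 1 (actRep F m₀ g)
      (extChartAt 𝓘(ℝ, F) m₀ m₀) (fun _ => v)) g :=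
    (ContinuousMultilinearMap.apply ℝ (fun _ : Fin 1 => F) F (fun _ => v)).continuous.continuousAt.comp
      h1
  refine h2.continuousWithinAt.congr (fun g' hg' => ?_) ?_
  · rw [actD_eq_fderiv_actRep E (hH g' hg'), iteratedFDeriv_one_apply]
  · rw [actD_eq_fderiv_actRep E (hH g hg), iteratedFDeriv_one_apply]

end Average

/-! ### Averaging a chart over a compact isotropy group -/

section Average

variable {E : Type*} [NormedAddCommGroup E] [NormedSpace ℝ E] [FiniteDimensional ℝ E]
variable {G : Type*} [TopologicalSpace G] [ChartedSpace E G] [Group G] [LieGroup 𝓘(ℝ, E) ∞ G]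
  [T2Space G]
variable {F : Type*} [NormedAddCommGroup F] [NormedSpace ℝ F] [FiniteDimensional ℝ F]
variable {M : Type*} [TopologicalSpace M] [ChartedSpace F M] [IsManifold 𝓘(ℝ, F) ∞ M]
  [MulAction G M] [ContMDiffSMul 𝓘(ℝ, E) 𝓘(ℝ, F) ∞ G M]
variable {H : Subgroup G} [MeasurableSpace H] [BorelSpace H] [CompactSpace H] (μ : Measure H)
  [IsProbabilityMeasure μ] {m₀ : M}

variable (F m₀) in
/-- The average over `H` of the conjugates of the chart at `m₀`, centered at `0`. -/
def avgChart (m : M) : F :=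
  ∫ h : H, actD F (h : G) m₀
    (extChartAt 𝓘(ℝ, F) m₀ ((h : G)⁻¹ • m) - extChartAt 𝓘(ℝ, F) m₀ m₀) ∂μ

variable (F H m₀) in
/-- The points all of whose translates under `H` lie in the domain of the preferred chart at `m₀`. -/
def avgDomain : Set M := {m | ∀ h ∈ H, h • m ∈ (chartAt F m₀).source}

variable (E F) in
include E F in
theorem continuousSMul_of_contMDiffSMul : ContinuousSMul G M :=
  ⟨(contMDiff_smul (I := 𝓘(ℝ, E)) (I' := 𝓘(ℝ, F)) (n := ∞) (G := G) (M := M)).continuous⟩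

variable (E F H m₀) in
include E in
theorem isOpen_avgDomain : IsOpen (avgDomain F H m₀) := by
  have : ContinuousSMul G M := continuousSMul_of_contMDiffSMul E F
  exact isOpen_setOf_forall_smul_mem (H := (H : Set G)) (isCompact_iff_compactSpace.2 ‹_›)
    (chartAt F m₀).open_source

theorem avgDomain_subset : avgDomain F H m₀ ⊆ (chartAt F m₀).source := fun m hm => by
  simpa using hm 1 H.one_mem

theorem self_mem_avgDomain (hm₀ : ∀ h ∈ H, h • m₀ = m₀) : m₀ ∈ avgDomain F H m₀ := fun h hh => by
  rw [hm₀ h hh]; exact mem_chart_source F m₀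

theorem avgChart_self (hm₀ : ∀ h ∈ H, h • m₀ = m₀) : avgChart F μ m₀ m₀ = 0 := by
  have : ∀ h : H, actD F (h : G) m₀
      (extChartAt 𝓘(ℝ, F) m₀ ((h : G)⁻¹ • m₀) - extChartAt 𝓘(ℝ, F) m₀ m₀) = 0 := fun h => by
    rw [hm₀ _ (H.inv_mem h.2), sub_self, map_zero]
  simp only [avgChart, this, integral_zero]

variable (E) in
include E in
theorem continuous_actD_coe (hm₀ : ∀ h ∈ H, h • m₀ = m₀) :
    Continuous fun h : H => actD F (h : G) m₀ :=
  continuousOn_iff_continuous_domRestrict.1 (continuousOn_actD E (H : Set G) hm₀)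

variable (E) in
include E in
theorem continuousOn_iteratedFDeriv_actRep_inv (k : ℕ) :
    ContinuousOn (fun p : H × F => iteratedFDeriv ℝ k (actRep F m₀ ((p.1 : G)⁻¹)) p.2)
      (univ ×ˢ ((extChartAt 𝓘(ℝ, F) m₀).target ∩ (extChartAt 𝓘(ℝ, F) m₀).symm ⁻¹'
        avgDomain F H m₀)) := by
  have : IsTopologicalGroup G := topologicalGroup_of_lieGroup 𝓘(ℝ, E) ∞
  rintro ⟨h, x⟩ ⟨-, hx, hx'⟩
  have h1 := continuousAt_iteratedFDeriv_actRep E (g := (h : G)⁻¹)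
    (avgDomain_subset hx') (hx' _ (H.inv_mem h.2)) k
  rw [(extChartAt 𝓘(ℝ, F) m₀).right_inv hx] at h1
  refine ContinuousAt.continuousWithinAt ?_
  exact ContinuousAt.comp (f := fun p : H × F => ((p.1 : G)⁻¹, p.2)) (x := (h, x)) h1
    (by fun_prop)

variable (E) in
include E in
theorem contDiffAt_actRep_inv (h : H) {x : F} (hx : x ∈ (extChartAt 𝓘(ℝ, F) m₀).target ∩
      (extChartAt 𝓘(ℝ, F) m₀).symm ⁻¹' avgDomain F H m₀) :
    ContDiffAt ℝ ∞ (actRep F m₀ ((h : G)⁻¹)) x := by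
  have h1 := actRep_contDiffAt E (g := (h : G)⁻¹)
    (avgDomain_subset hx.2) (hx.2 _ (H.inv_mem h.2))
  rwa [(extChartAt 𝓘(ℝ, F) m₀).right_inv hx.1] at h1

variable (E m₀) in
include E in
theorem isOpen_avgDomain_rep : IsOpen ((extChartAt 𝓘(ℝ, F) m₀).target ∩
      (extChartAt 𝓘(ℝ, F) m₀).symm ⁻¹' avgDomain F H m₀) :=
  (continuousOn_extChartAt_symm m₀).isOpen_inter_preimage (isOpen_extChartAt_target m₀)
    (isOpen_avgDomain E F H m₀)

variable (E) in
include E in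
theorem contDiffOn_avgChart_rep (hm₀ : ∀ h ∈ H, h • m₀ = m₀) :
    ContDiffOn ℝ ∞ (fun x => avgChart F μ m₀ ((extChartAt 𝓘(ℝ, F) m₀).symm x))
      ((extChartAt 𝓘(ℝ, F) m₀).target ∩ (extChartAt 𝓘(ℝ, F) m₀).symm ⁻¹' avgDomain F H m₀) := by
  have : CompleteSpace F := FiniteDimensional.complete ℝ F
  refine contDiffOn_integral μ (isOpen_avgDomain_rep E m₀)
    (f := fun h x => actD F (h : G) m₀ (actRep F m₀ ((h : G)⁻¹) x)) (fun h x hx => ?_) fun k => ?_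
  · exact ((actD F (h : G) m₀).contDiff.contDiffAt.comp x
      (contDiffAt_actRep_inv E h hx)).contDiffWithinAt
  · have h1 : ContinuousOn (fun p : H × F => (actD F (p.1 : G) m₀).compContinuousMultilinearMap
        (iteratedFDeriv ℝ k (actRep F m₀ ((p.1 : G)⁻¹)) p.2))
        (univ ×ˢ ((extChartAt 𝓘(ℝ, F) m₀).target ∩ (extChartAt 𝓘(ℝ, F) m₀).symm ⁻¹'
          avgDomain F H m₀)) :=
      (ContinuousLinearMap.compContinuousMultilinearMapL ℝ (fun _ : Fin k => F) F
        F).isBoundedBilinearMap.continuous.comp_continuousOn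
        ((((continuous_actD_coe E hm₀).comp continuous_fst).continuousOn).prodMk
          (continuousOn_iteratedFDeriv_actRep_inv E k))
    refine h1.congr ?_
    rintro ⟨h, x⟩ ⟨-, hx⟩
    exact (actD F (h : G) m₀).iteratedFDeriv_comp_left (contDiffAt_actRep_inv E h hx)
      (by exact_mod_cast le_top)

-- Each conjugate `dh ∘ χ ∘ h⁻¹` has derivative `dh ∘ dh⁻¹ = id` at the fixed point, and an average
-- of identities over a probability measure is the identity.
variable (E) in
include E in
theorem hasFDerivAt_avgChart_rep (hm₀ : ∀ h ∈ H, h • m₀ = m₀) :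
    HasFDerivAt (fun x => avgChart F μ m₀ ((extChartAt 𝓘(ℝ, F) m₀).symm x))
      (ContinuousLinearMap.id ℝ F) (extChartAt 𝓘(ℝ, F) m₀ m₀) := by
  have : CompleteSpace F := FiniteDimensional.complete ℝ F
  set U := (extChartAt 𝓘(ℝ, F) m₀).target ∩ (extChartAt 𝓘(ℝ, F) m₀).symm ⁻¹' avgDomain F H m₀
    with hU
  have hmem : extChartAt 𝓘(ℝ, F) m₀ m₀ ∈ U :=
    ⟨mem_extChartAt_target m₀, by
      rw [mem_preimage, extChartAt_to_inv]; exact self_mem_avgDomain hm₀⟩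
  have hf : ∀ k : ℕ, ContinuousOn (fun p : H × F =>
      iteratedFDeriv ℝ k (actRep F m₀ ((p.1 : G)⁻¹)) p.2) (univ ×ˢ U) :=
    continuousOn_iteratedFDeriv_actRep_inv E
  have hP : Continuous fun p : H × F => actD F (p.1 : G) m₀ :=
    (continuous_actD_coe E hm₀).comp continuous_fst
  have key := hasFDerivAt_integral_of_continuousOn μ (isOpen_avgDomain_rep E m₀)
    (f := fun (h : H) x => actD F (h : G) m₀ (actRep F m₀ ((h : G)⁻¹) x))
    (f' := fun h x => (actD F (h : G) m₀).comp (fderiv ℝ (actRep F m₀ ((h : G)⁻¹)) x))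
    ?_ ?_ ?_ hmem
  · have h1 : ∀ h : H, (actD F (h : G) m₀).comp
        (fderiv ℝ (actRep F m₀ ((h : G)⁻¹)) (extChartAt 𝓘(ℝ, F) m₀ m₀)) =
        ContinuousLinearMap.id ℝ F := fun h => by
      rw [← actD_eq_fderiv_actRep E (hm₀ _ (H.inv_mem h.2)), actD_inv_comp E (hm₀ _ h.2)]
    simp only [h1, integral_const, probReal_univ, one_smul] at key
    exact key
  · have h0 := (ContinuousMultilinearMap.apply ℝ (fun _ : Fin 0 => F) F
      (fun _ => 0)).continuous.comp_continuousOn (hf 0)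
    have h0' : ContinuousOn (fun p : H × F => actRep F m₀ ((p.1 : G)⁻¹) p.2) (univ ×ˢ U) :=
      h0.congr fun p _ => rfl
    exact hP.continuousOn.clm_apply h0'
  · refine hP.continuousOn.clm_comp ?_
    rw [continuousOn_clm_apply]
    intro v
    refine ((ContinuousMultilinearMap.apply ℝ (fun _ : Fin 1 => F) F
      (fun _ => v)).continuous.comp_continuousOn (hf 1)).congr fun p _ => ?_
    rw [Function.comp_apply, ContinuousMultilinearMap.apply_apply, iteratedFDeriv_one_apply]
  · intro h x hx
    exact (actD F (h : G) m₀).hasFDerivAt.comp x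
      ((contDiffAt_actRep_inv E h hx).differentiableAt (by simp)).hasFDerivAt

-- The substitution `h ↦ k h` in the integral pulls `dk` out on the left and cancels `k` against the
-- argument.
variable (E) in
include E in
theorem avgChart_smul [μ.IsMulLeftInvariant] (hm₀ : ∀ h ∈ H, h • m₀ = m₀) {k : G} (hk : k ∈ H)
    {m : M} (hm : m ∈ avgDomain F H m₀) :
    avgChart F μ m₀ (k • m) = actD F k m₀ (avgChart F μ m₀ m) := by
  have : CompleteSpace F := FiniteDimensional.complete ℝ F
  have : IsTopologicalGroup G := topologicalGroup_of_lieGroup 𝓘(ℝ, E) ∞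
  have : ContinuousSMul G M := continuousSMul_of_contMDiffSMul E F
  have hc : Continuous fun h : H => actD F (h : G) m₀
      (extChartAt 𝓘(ℝ, F) m₀ ((h : G)⁻¹ • m) - extChartAt 𝓘(ℝ, F) m₀ m₀) := by
    refine (continuous_actD_coe E hm₀).clm_apply (Continuous.sub ?_ continuous_const)
    rw [← continuousOn_univ]
    refine (continuousOn_extChartAt m₀).comp (f := fun h : H => (h : G)⁻¹ • m)
      (Continuous.continuousOn (by fun_prop)) fun h _ => ?_
    rw [extChartAt_source]
    exact hm _ (H.inv_mem h.2)
  have h1 := integral_mul_left_eq_self (μ := μ) (fun h : H => actD F (h : G) m₀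
      (extChartAt 𝓘(ℝ, F) m₀ ((h : G)⁻¹ • k • m) - extChartAt 𝓘(ℝ, F) m₀ m₀)) ⟨k, hk⟩
  rw [avgChart, ← h1, avgChart,
    ← (actD F k m₀).integral_comp_comm (integrable_of_continuous μ hc)]
  refine integral_congr_ae (Eventually.of_forall fun h => ?_)
  simp only [Subgroup.coe_mul, mul_inv_rev, mul_smul, inv_smul_smul,
    actD_mul E (g := k) (hm₀ _ h.2), ContinuousLinearMap.comp_apply]

end Average

/-! ### Linear coordinates around a fixed point -/

section Linearization

variable (F : Type*) [NormedAddCommGroup F] [NormedSpace ℝ F]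
variable {G : Type*} [Group G]
variable {M : Type*} [TopologicalSpace M] [ChartedSpace F M] [MulAction G M]

/-- Coordinates at `m₀` in which the group `H` acts linearly, with parametrization `param`. -/
structure LinearChart (H : Subgroup G) (m₀ : M) where
  /-- the coordinate map -/
  coord : M → F
  /-- its inverse -/
  param : F → M
  /-- the invariant domain of the coordinate map -/
  dom : Set M
  /-- the domain of the parametrization -/
  ball : Set F
  isOpen_dom : IsOpen dom
  isOpen_ball : IsOpen ball
  mem_dom : m₀ ∈ dom
  zero_mem : (0 : F) ∈ ball
  smul_mem : ∀ h ∈ H, ∀ m ∈ dom, h • m ∈ dom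
  injOn : InjOn coord dom
  param_mem : ∀ v ∈ ball, param v ∈ dom
  coord_param : ∀ v ∈ ball, coord (param v) = v
  coord_smul : ∀ h ∈ H, ∀ m ∈ dom, coord (h • m) = actD F h m₀ (coord m)
  coord_self : coord m₀ = 0
  smooth_coord : ∀ m ∈ dom, ContMDiffAt 𝓘(ℝ, F) 𝓘(ℝ, F) ∞ coord m
  smooth_param : ∀ v ∈ ball, ContMDiffAt 𝓘(ℝ, F) 𝓘(ℝ, F) ∞ param v
  D_coord : D F F coord m₀ = ContinuousLinearMap.id ℝ F

end Linearization

section Existence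

variable {E : Type*} [NormedAddCommGroup E] [NormedSpace ℝ E] [FiniteDimensional ℝ E]
variable {G : Type*} [TopologicalSpace G] [ChartedSpace E G] [Group G] [LieGroup 𝓘(ℝ, E) ∞ G]
  [T2Space G]
variable {F : Type*} [NormedAddCommGroup F] [NormedSpace ℝ F] [FiniteDimensional ℝ F]
variable {M : Type*} [TopologicalSpace M] [ChartedSpace F M] [IsManifold 𝓘(ℝ, F) ∞ M]
  [MulAction G M] [ContMDiffSMul 𝓘(ℝ, E) 𝓘(ℝ, F) ∞ G M]

variable (E F) in
include E in
/-- A compact group of diffeomorphisms fixing `m₀` acts linearly in suitable coordinates. -/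
theorem exists_linearChart {H : Subgroup G} (hH : IsCompact (H : Set G)) {m₀ : M}
    (hm₀ : ∀ h ∈ H, h • m₀ = m₀) : Nonempty (LinearChart F H m₀) := by
  have : CompleteSpace F := FiniteDimensional.complete ℝ F
  have : IsTopologicalGroup G := topologicalGroup_of_lieGroup 𝓘(ℝ, E) ∞
  have : ContinuousSMul G M := continuousSMul_of_contMDiffSMul E F
  have : CompactSpace H := isCompact_iff_compactSpace.1 hH
  let _ : MeasurableSpace H := borel H
  have : BorelSpace H := ⟨rfl⟩
  obtain ⟨μ, hμ, hμ'⟩ := exists_leftInvariant_probability H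
  set χ := extChartAt 𝓘(ℝ, F) m₀ with hχ
  have hsrc : χ.source = (chartAt F m₀).source := extChartAt_source _ _
  set φ : M → F := avgChart F μ m₀ with hφ
  set Θ : F → F := fun x => φ (χ.symm x) with hΘ
  set U : Set F := χ.target ∩ χ.symm ⁻¹' avgDomain F H m₀ with hU
  have hUo : IsOpen U := isOpen_avgDomain_rep E m₀
  have hΘU : ContDiffOn ℝ ∞ Θ U := contDiffOn_avgChart_rep E μ hm₀
  have hx₀ : χ m₀ ∈ U :=
    ⟨mem_extChartAt_target m₀, by
      rw [mem_preimage, hχ, extChartAt_to_inv]; exact self_mem_avgDomain hm₀⟩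
  have hΘx : ContDiffAt ℝ ∞ Θ (χ m₀) := hΘU.contDiffAt (hUo.mem_nhds hx₀)
  have hΘd : HasFDerivAt Θ ((ContinuousLinearEquiv.refl ℝ F : F ≃L[ℝ] F) : F →L[ℝ] F) (χ m₀) :=
    hasFDerivAt_avgChart_rep E μ hm₀
  set e := hΘx.toOpenPartialHomeomorph Θ hΘd (by simp) with he
  have hex : χ m₀ ∈ e.source := hΘx.mem_toOpenPartialHomeomorph_source hΘd (by simp)
  -- Invertibility of the derivative throughout `O`, not only at the center, makes the inverse
  -- smooth at every point of its domain.
  set O : Set F := e.source ∩ (U ∩ fderiv ℝ Θ ⁻¹' range ((↑) : (F ≃L[ℝ] F) → F →L[ℝ] F)) with hO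
  have hOo : IsOpen O := e.open_source.inter
    ((hΘU.continuousOn_fderiv_of_isOpen hUo (by simp)).isOpen_inter_preimage hUo
      ContinuousLinearEquiv.isOpen)
  have hxO : χ m₀ ∈ O := ⟨hex, hx₀, ⟨_, hΘd.fderiv.symm⟩⟩
  set W₁ : Set M := χ.source ∩ χ ⁻¹' O with hW₁
  have hW₁o : IsOpen W₁ :=
    (continuousOn_extChartAt m₀).isOpen_inter_preimage (isOpen_extChartAt_source m₀) hOo
  -- The largest `H`-invariant subset of `W₁`; it is open because `H` is compact.
  set W : Set M := {m | ∀ h ∈ (H : Set G), h • m ∈ W₁} with hW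
  have hWo : IsOpen W := isOpen_setOf_forall_smul_mem hH hW₁o
  have hWW₁ : W ⊆ W₁ := fun m hm => by simpa using hm 1 H.one_mem
  have hWA : W ⊆ avgDomain F H m₀ := fun m hm h hh => hsrc ▸ (hm h hh).1
  have hm₀W : m₀ ∈ W := fun h hh => by
    rw [hm₀ h hh]; exact ⟨mem_extChartAt_source m₀, hxO⟩
  have hφΘ : ∀ m ∈ χ.source, φ m = Θ (χ m) := fun m hm => by
    simp only [hΘ, χ.left_inv hm]
  set O' : Set F := O ∩ (χ.target ∩ χ.symm ⁻¹' W) with hO'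
  have hO'o : IsOpen O' := hOo.inter
    ((continuousOn_extChartAt_symm m₀).isOpen_inter_preimage (isOpen_extChartAt_target m₀) hWo)
  set V : Set F := e.target ∩ e.symm ⁻¹' O' with hV
  have hVo : IsOpen V := e.isOpen_inter_preimage_symm hO'o
  have hΘ0 : e (χ m₀) = 0 := by
    change Θ (χ m₀) = 0
    rw [← hφΘ _ (mem_extChartAt_source m₀)]; exact avgChart_self μ hm₀
  have h0V : (0 : F) ∈ V := by
    rw [← hΘ0]
    refine ⟨e.map_source hex, ?_⟩
    rw [mem_preimage, e.left_inv hex]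
    exact ⟨hxO, mem_extChartAt_target m₀, by rw [mem_preimage, hχ, extChartAt_to_inv]; exact hm₀W⟩
  have hφs : ∀ m ∈ W, ContMDiffAt 𝓘(ℝ, F) 𝓘(ℝ, F) ∞ φ m := fun m hm => by
    have h1 : ContMDiffAt 𝓘(ℝ, F) 𝓘(ℝ, F) ∞ Θ (χ m) :=
      (hΘU.contDiffAt (hUo.mem_nhds (hWW₁ hm).2.2.1)).contMDiffAt
    have h2 : ContMDiffAt 𝓘(ℝ, F) 𝓘(ℝ, F) ∞ χ m :=
      contMDiffAt_extChartAt' (hsrc ▸ (hWW₁ hm).1)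
    refine (ContMDiffAt.comp m h1 h2).congr_of_eventuallyEq ?_
    filter_upwards [(isOpen_extChartAt_source m₀).mem_nhds (hWW₁ hm).1] with y hy using hφΘ y hy
  refine ⟨⟨φ, fun v => χ.symm (e.symm v), W, V, hWo, hVo, hm₀W, h0V, ?_, ?_, ?_, ?_, ?_, ?_, hφs,
    ?_, ?_⟩⟩
  · intro h hh m hm k hk
    rw [← mul_smul]; exact hm _ (H.mul_mem hk hh)
  · intro m hm m' hm' hmm'
    rw [hφΘ m (hWW₁ hm).1, hφΘ m' (hWW₁ hm').1] at hmm'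
    exact χ.injOn (hWW₁ hm).1 (hWW₁ hm').1 (e.injOn (hWW₁ hm).2.1 (hWW₁ hm').2.1 hmm')
  · exact fun v hv => hv.2.2.2
  · exact fun v hv => e.right_inv hv.1
  · exact fun h hh m hm => avgChart_smul E μ hm₀ hh (hWA hm)
  · exact avgChart_self μ hm₀
  · intro v hv
    obtain ⟨A, hA⟩ := hv.2.1.2.2
    have h1 : ContDiffAt ℝ ∞ Θ (e.symm v) := hΘU.contDiffAt (hUo.mem_nhds hv.2.1.2.1)
    have h2 : HasFDerivAt Θ (A : F →L[ℝ] F) (e.symm v) := by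
      rw [hA]; exact (h1.differentiableAt (by simp)).hasFDerivAt
    have h3 : ContDiffAt ℝ ∞ e.symm v := e.contDiffAt_symm hv.1 h2 h1
    exact ContMDiffAt.comp v ((contMDiffOn_extChartAt_symm (n := ∞) m₀).contMDiffAt
      ((isOpen_extChartAt_target m₀).mem_nhds hv.2.1.2.1.1)) h3.contMDiffAt
  · have h1 : D F F φ m₀ = D F F (Θ ∘ χ) m₀ := by
      refine D_congr ?_
      filter_upwards [extChartAt_source_mem_nhds (I := 𝓘(ℝ, F)) m₀] with y hy using hφΘ y hy
    rw [h1, D_comp (F := F) (F' := F) (F'' := F) (b := χ m₀) rfl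
      (hΘd.differentiableAt.mdifferentiableAt) (md_extChartAt m₀), D_extChartAt, D_eq_fderiv,
      hΘd.fderiv]
    rfl

end Existence

section LinearChart

variable {F : Type*} [NormedAddCommGroup F] [NormedSpace ℝ F]
variable {G : Type*} [Group G]
variable {M : Type*} [TopologicalSpace M] [ChartedSpace F M] [MulAction G M]
variable {H : Subgroup G} {m₀ : M} (c : LinearChart F H m₀)

namespace LinearChart

theorem param_coord {m : M} (hm : m ∈ c.dom) (h : c.coord m ∈ c.ball) :
    c.param (c.coord m) = m :=
  c.injOn (c.param_mem _ h) hm (c.coord_param _ h)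

theorem param_zero : c.param 0 = m₀ := by
  have := c.param_coord c.mem_dom (by rw [c.coord_self]; exact c.zero_mem)
  rwa [c.coord_self] at this

theorem md_coord {m : M} (hm : m ∈ c.dom) : MD F F c.coord m :=
  (c.smooth_coord m hm).mdifferentiableAt (by simp)

theorem md_param {v : F} (hv : v ∈ c.ball) : MD F F c.param v :=
  (c.smooth_param v hv).mdifferentiableAt (by simp)

theorem D_param : D F F c.param 0 = ContinuousLinearMap.id ℝ F := by
  have h1 := D_comp (F := F) (F' := F) (F'' := F) c.param_zero (c.md_coord c.mem_dom)
    (c.md_param c.zero_mem)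
  rw [c.D_coord, ContinuousLinearMap.id_comp] at h1
  rw [← h1, ← D_id (F := F) (0 : F)]
  refine D_congr ?_
  filter_upwards [c.isOpen_ball.mem_nhds c.zero_mem] with v hv using c.coord_param v hv

theorem smul_param_eq_iff {h : G} (hh : h ∈ H) {v : F} (hv : v ∈ c.ball) :
    h • c.param v = c.param v ↔ actD F h m₀ v = v := by
  have h1 := c.coord_smul h hh _ (c.param_mem v hv)
  rw [c.coord_param v hv] at h1
  constructor
  · intro h2
    rw [← h1, h2, c.coord_param v hv]
  · intro h2
    refine c.injOn (c.smul_mem h hh _ (c.param_mem v hv)) (c.param_mem v hv) ?_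
    rw [h1, h2, c.coord_param v hv]

end LinearChart

end LinearChart

/-! ### One-parameter groups of linear maps -/

section OneParameter

variable {V : Type*} [NormedAddCommGroup V] [NormedSpace ℝ V] {P : ℝ → V →L[ℝ] V} {A : V →L[ℝ] V}

theorem hasDerivAt_apply_of_hom (hP : ∀ s t, P (s + t) = (P s).comp (P t))
    (hA : HasDerivAt P A 0) (w : V) (s : ℝ) : HasDerivAt (fun u => P u w) (P s (A w)) s := by
  have h1 : HasDerivAt (fun u => P (u - s)) A s := by
    have : HasDerivAt P A (s - s) := by rwa [sub_self]
    simpa using this.comp_sub_const s s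
  have h2 : HasDerivAt (fun u => P s (P (u - s) w)) (P s (A w)) s :=
    (P s).hasFDerivAt.comp_hasDerivAt s (h1.clm_apply (hasDerivAt_const s w) |>.congr_deriv (by simp))
  refine h2.congr_of_eventuallyEq (Eventually.of_forall fun u => ?_)
  simp only [← ContinuousLinearMap.comp_apply (P s), ← hP, add_sub_cancel]

theorem apply_eq_zero_iff_of_hom (h0 : P 0 = ContinuousLinearMap.id ℝ V)
    (hP : ∀ s t, P (s + t) = (P s).comp (P t)) (hA : HasDerivAt P A 0) {w : V} :
    A w = 0 ↔ ∀ s, P s w = w := by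
  constructor
  · intro h s
    have h1 := is_const_of_deriv_eq_zero (f := fun u => P u w)
      (fun u => (hasDerivAt_apply_of_hom hP hA w u).differentiableAt)
      (fun u => by rw [(hasDerivAt_apply_of_hom hP hA w u).deriv, h, map_zero]) s 0
    simpa [h0] using h1
  · intro h
    have h1 := hasDerivAt_apply_of_hom hP hA w 0
    simp only [h] at h1
    have h2 := h1.unique (hasDerivAt_const (0 : ℝ) w)
    simpa [h0] using h2

/-- The generator of a bounded one-parameter group is semisimple at `0`. -/
theorem apply_eq_zero_of_bounded (h0 : P 0 = ContinuousLinearMap.id ℝ V)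
    (hP : ∀ s t, P (s + t) = (P s).comp (P t)) (hA : HasDerivAt P A 0) {C : ℝ}
    (hC : ∀ s, ‖P s‖ ≤ C) {w : V} (hw : A (A w) = 0) : A w = 0 := by
  have h1 := (apply_eq_zero_iff_of_hom h0 hP hA).1 hw
  -- The group fixes `A w`, so the orbit of `w` is affine in `s`; a bounded affine orbit is
  -- constant.
  have h2 : ∀ s, P s w = w + s • A w := fun s => by
    have h3 : ∀ u, HasDerivAt (fun u : ℝ => P u w - u • A w) 0 u := fun u => by
      have := (hasDerivAt_apply_of_hom hP hA w u).sub ((hasDerivAt_id u).smul_const (A w))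
      simpa [h1, Pi.sub_def] using this
    have h4 := is_const_of_deriv_eq_zero (fun u => (h3 u).differentiableAt)
      (fun u => (h3 u).deriv) s 0
    simp only [h0, ContinuousLinearMap.id_apply, zero_smul, sub_zero] at h4
    exact sub_eq_iff_eq_add.1 h4
  by_contra hne
  have hpos : 0 < ‖A w‖ := norm_pos_iff.2 hne
  -- Chosen so that the norm of `s • A w` exceeds its bound `C * ‖w‖ + ‖w‖` by `1`.
  set s : ℝ := (C * ‖w‖ + ‖w‖ + 1) / ‖A w‖ with hs
  have h5 : ‖s • A w‖ ≤ C * ‖w‖ + ‖w‖ := by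
    have : s • A w = P s w - w := by rw [h2]; abel
    rw [this]
    exact (norm_sub_le _ _).trans (add_le_add_left ((P s).le_of_opNorm_le (hC s) w) _)
  rw [norm_smul, Real.norm_eq_abs] at h5
  have h6 : s * ‖A w‖ = C * ‖w‖ + ‖w‖ + 1 := div_mul_cancel₀ _ hpos.ne'
  have h7 := mul_le_mul_of_nonneg_right (le_abs_self s) hpos.le
  linarith

end OneParameter

/-! ### The isotropy representation of the torus -/

section Isotropy

variable {E : Type*} [NormedAddCommGroup E] [NormedSpace ℝ E] [FiniteDimensional ℝ E]
variable {G : Type*} [TopologicalSpace G] [ChartedSpace E G] [Group G] [LieGroup 𝓘(ℝ, E) ∞ G]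
  [T2Space G]
variable {F : Type*} [NormedAddCommGroup F] [NormedSpace ℝ F] [FiniteDimensional ℝ F]
variable {M : Type*} [TopologicalSpace M] [ChartedSpace F M] [IsManifold 𝓘(ℝ, F) ∞ M]
  [MulAction G M] [ContMDiffSMul 𝓘(ℝ, E) 𝓘(ℝ, F) ∞ G M]
variable {T : MaximalTorus G}

variable (T) in
/-- The stabilizer of `m` in the torus. -/
def torusStab (m : M) : Subgroup G := T.toSubgroup ⊓ MulAction.stabilizer G m

theorem mem_torusStab {m : M} {h : G} : h ∈ torusStab T m ↔ h ∈ T.carrier ∧ h • m = m := Iff.rfl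

variable (E F T) in
include E F in
theorem isCompact_torusStab [CompactSpace G] [T2Space M] (m : M) :
    IsCompact (torusStab T m : Set G) := by
  have : ContinuousSMul G M := continuousSMul_of_contMDiffSMul E F
  refine IsClosed.isCompact (T.closed.inter ?_)
  exact isClosed_eq (f := fun h : G => h • m) (by fun_prop) continuous_const

theorem expE_mem_torusStab {X : E} (hX : X ∈ tE E T) {m : M} (h : genE E G F m X = 0) (s : ℝ) :
    expE G (s • X) ∈ torusStab T m :=
  mem_torusStab.2 ⟨expE_mem (Submodule.smul_mem _ s hX), genE_eq_zero_iff.1 h s⟩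

variable (G F) in
/-- The infinitesimal action of `X` on the tangent space at `m`. -/
def infAct (X : E) (m : M) : F →L[ℝ] F := deriv (fun s : ℝ => actD F (expE G (s • X)) m) 0

/-- `infAct` is a `deriv`, meaningful only once differentiability is known. This follows from smooth
dependence of the chart derivative of the action on the group element near `1`. -/
theorem hasDerivAt_actD_expE {X : E} {m : M} (h : genE E G F m X = 0) :
    HasDerivAt (fun s : ℝ => actD F (expE G (s • X)) m) (infAct G F X m) 0 := by
  refine DifferentiableAt.hasDerivAt ?_
  set χ := extChartAt 𝓘(ℝ, E) (1 : G) with hχ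
  have h1 := actRep_self_param_contDiffAt E (g := (1 : G)) (mem_chart_source F m)
    (by rw [one_smul]; exact mem_chart_source F m)
  have h2 : ContDiffAt ℝ ∞ (fun u : E => fderiv ℝ (actRep F m (χ.symm u))
      (extChartAt 𝓘(ℝ, F) m m)) (χ 1) :=
    ContDiffAt.fderiv (n := ∞) (f := fun (u : E) (x : F) => actRep F m (χ.symm u) x)
      (g := fun _ => extChartAt 𝓘(ℝ, F) m m) h1 contDiffAt_const (by simp)
  have h3 := (hasVel_expE (G := G) X).comp (md_extChartAt (1 : G))
  have h4 : DifferentiableAt ℝ (fun u : E => fderiv ℝ (actRep F m (χ.symm u))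
      (extChartAt 𝓘(ℝ, F) m m)) (χ (expE G ((0 : ℝ) • X))) := by
    rw [zero_smul, expE_zero]; exact h2.differentiableAt (by simp)
  have h5 := DifferentiableAt.comp (0 : ℝ) h4 h3.hasDerivAt.differentiableAt
  refine h5.congr_of_eventuallyEq ?_
  have h6 : ∀ᶠ s : ℝ in 𝓝 0, expE G (s • X) ∈ χ.source := by
    refine (continuous_expE_smul X).continuousAt.eventually ?_
    simp only [zero_smul, expE_zero]; exact extChartAt_source_mem_nhds (I := 𝓘(ℝ, E)) 1
  filter_upwards [h6] with s hs
  simp only [Function.comp_apply]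
  rw [χ.left_inv hs, actD_eq_fderiv_actRep E (genE_eq_zero_iff.1 h s)]

theorem actD_expE_zero (X : E) (m : M) :
    actD F (expE G ((0 : ℝ) • X)) m = ContinuousLinearMap.id ℝ F := by
  rw [zero_smul, expE_zero, actD_one]

theorem actD_expE_add {X : E} {m : M} (h : genE E G F m X = 0) (s t : ℝ) :
    actD F (expE G ((s + t) • X)) m =
      (actD F (expE G (s • X)) m).comp (actD F (expE G (t • X)) m) := by
  rw [expE_add_smul, actD_mul E (genE_eq_zero_iff.1 h t)]

theorem infAct_eq_zero_iff {X : E} {m : M} (h : genE E G F m X = 0) {w : F} :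
    infAct G F X m w = 0 ↔ ∀ s : ℝ, actD F (expE G (s • X)) m w = w :=
  apply_eq_zero_iff_of_hom (P := fun s : ℝ => actD F (expE G (s • X)) m)
    (actD_expE_zero X m) (actD_expE_add h) (hasDerivAt_actD_expE h)

/-- The one-parameter group lies in the image of the compact stabilizer of `m` in `T`, hence is
bounded, so its generator has no nilpotent part at `0`. -/
theorem infAct_eq_zero_of_sq [CompactSpace G] [T2Space M] {X : E} (hX : X ∈ tE E T) {m : M}
    (h : genE E G F m X = 0) {w : F} (hw : infAct G F X m (infAct G F X m w) = 0) :
    infAct G F X m w = 0 := by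
  obtain ⟨C, hC⟩ := (isCompact_torusStab E F T m).exists_bound_of_continuousOn
    (continuousOn_actD E (F := F) (torusStab T m : Set G) (m₀ := m)
      fun g hg => (mem_torusStab.1 hg).2)
  exact apply_eq_zero_of_bounded (P := fun s : ℝ => actD F (expE G (s • X)) m)
    (actD_expE_zero X m) (actD_expE_add h) (hasDerivAt_actD_expE h)
    (fun s => hC _ (expE_mem_torusStab hX h s)) hw

/-- A vector tangent to a curve of fixed points of `X` is annihilated by `X`. -/
theorem infAct_eq_zero_of_hasVel {X : E} {m : M} {c : ℝ → M} {s : ℝ} {w : F} (hc : HasVel c s m w)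
    (h : ∀ᶠ u in 𝓝 s, genE E G F (c u) X = 0) : infAct G F X m w = 0 := by
  have hm : genE E G F m X = 0 := by rw [← hc.1]; exact h.self_of_nhds
  refine (infAct_eq_zero_iff hm).2 fun t => ?_
  have h1 := hc.comp (md_const_smul E (expE G (t • X)) m)
  refine h1.unique (HasVel.congr hc ?_)
  filter_upwards [h] with u hu using genE_eq_zero_iff.1 hu t

/-- Near the center of a linear chart, `X` vanishes where it annihilates the coordinates. -/
theorem genE_param_eq_zero_iff {m : M} (c : LinearChart F (torusStab T m) m) {X : E}
    (hX : X ∈ tE E T) (h : genE E G F m X = 0) {v : F} (hv : v ∈ c.ball) :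
    genE E G F (c.param v) X = 0 ↔ infAct G F X m v = 0 := by
  rw [genE_eq_zero_iff, infAct_eq_zero_iff h]
  exact forall_congr' fun s => c.smul_param_eq_iff (expE_mem_torusStab hX h s) hv

end Isotropy

/-! ### Upper semicontinuity of infinitesimal stabilizers -/

section Semicontinuity

variable {E : Type*} [NormedAddCommGroup E] [NormedSpace ℝ E] [FiniteDimensional ℝ E]
variable {G : Type*} [TopologicalSpace G] [ChartedSpace E G] [Group G] [LieGroup 𝓘(ℝ, E) ∞ G]
  [T2Space G]
variable {F : Type*} [NormedAddCommGroup F] [NormedSpace ℝ F] [FiniteDimensional ℝ F]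
variable {M : Type*} [TopologicalSpace M] [ChartedSpace F M] [IsManifold 𝓘(ℝ, F) ∞ M]
  [MulAction G M] [ContMDiffSMul 𝓘(ℝ, E) 𝓘(ℝ, F) ∞ G M]
variable {T : MaximalTorus G}

variable (E F) in
include E in
/-- The averaging projection onto the vectors fixed by a compact isotropy group. -/
theorem exists_invariant_projection {H : Subgroup G} (hH : IsCompact (H : Set G)) {m₀ : M}
    (hm₀ : ∀ h ∈ H, h • m₀ = m₀) : ∃ π : F →L[ℝ] F,
      (∀ k ∈ H, ∀ v, π (actD F k m₀ v) = π v) ∧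
      ∀ v, (∀ k ∈ H, actD F k m₀ v = v) → π v = v := by
  have : CompleteSpace F := FiniteDimensional.complete ℝ F
  have : IsTopologicalGroup G := topologicalGroup_of_lieGroup 𝓘(ℝ, E) ∞
  have : CompactSpace H := isCompact_iff_compactSpace.1 hH
  let _ : MeasurableSpace H := borel H
  have : BorelSpace H := ⟨rfl⟩
  obtain ⟨μ, hμ, hμ'⟩ := exists_leftInvariant_probability H
  have hc : Continuous fun h : H => actD F ((h⁻¹ : H) : G) m₀ :=
    (continuous_actD_coe E hm₀).comp continuous_inv
  have hi := integrable_of_continuous μ hc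
  have happ : ∀ v, (∫ h : H, actD F ((h⁻¹ : H) : G) m₀ ∂μ) v =
      ∫ h : H, actD F ((h⁻¹ : H) : G) m₀ v ∂μ := fun v =>
    ContinuousLinearMap.integral_apply hi v
  refine ⟨∫ h : H, actD F ((h⁻¹ : H) : G) m₀ ∂μ, fun k hk v => ?_, fun v hv => ?_⟩
  -- Because the integrand involves `h⁻¹`, the substitution `h ↦ k h` turns `h⁻¹ k` into `h⁻¹`: left
  -- invariance of the measure suffices.
  · rw [happ, happ, ← integral_mul_left_eq_self (μ := μ)
      (fun h : H => actD F ((h⁻¹ : H) : G) m₀ (actD F k m₀ v)) ⟨k, hk⟩]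
    refine integral_congr_ae (Eventually.of_forall fun h => ?_)
    simp only [mul_inv_rev]
    rw [← ContinuousLinearMap.comp_apply, ← actD_mul E (hm₀ k hk)]
    simp
  · rw [happ]
    have : ∀ h : H, actD F ((h⁻¹ : H) : G) m₀ v = v := fun h => hv _ (h⁻¹).2
    simp only [this, integral_const, probReal_univ, one_smul]

theorem D_coord_smul {H : Subgroup G} {m : M} (c : LinearChart F H m) {q : M} (hq : q ∈ c.dom)
    (X : E) : D E F (fun a : G => c.coord (a • q)) 1 X = -D F F c.coord q (genE E G F q X) := by
  have h1 := D_comp (F := E) (F' := F) (F'' := F) (f := fun a : G => a • q) (one_smul G q)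
    (c.md_coord hq) (md_smul_const 1 q)
  have h2 : D E F (fun a : G => c.coord (a • q)) 1 =
      (D F F c.coord q).comp (D E F (fun a : G => a • q) 1) := h1
  rw [h2]
  simp [genE]

theorem continuousAt_D_coord_smul {H : Subgroup G} {m : M} (c : LinearChart F H m) :
    ContinuousAt (fun q : M => D E F (fun a : G => c.coord (a • q)) 1) m := by
  have hG : IsManifold 𝓘(ℝ, E) ∞ G := inferInstance
  set κ := extChartAt 𝓘(ℝ, E) (1 : G) with hκ
  set χ := extChartAt 𝓘(ℝ, F) m with hχ
  have h1 : ContDiffAt ℝ ∞ (fun x : E × F => c.coord (κ.symm x.1 • χ.symm x.2)) (κ 1, χ m) := by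
    refine contDiffAt_rep_prod (f := fun q : G × M => c.coord (q.1 • q.2)) le_rfl
      (mem_chart_source E 1) (mem_chart_source F m) ?_
    refine ContMDiffAt.comp (I' := 𝓘(ℝ, F)) (g := c.coord) (1, m) ?_ (contMDiffAt_smul (1, m))
    simp only [one_smul]
    exact c.smooth_coord m c.mem_dom
  have h2 : ContDiffAt ℝ ∞ (fun y : F =>
      fderiv ℝ (fun u : E => c.coord (κ.symm u • χ.symm y)) (κ 1)) (χ m) := by
    refine ContDiffAt.fderiv (n := ∞) (f := fun (y : F) (u : E) => c.coord (κ.symm u • χ.symm y))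
      (g := fun _ => κ 1) ?_ contDiffAt_const (by simp)
    exact ContDiffAt.comp (χ m, κ 1) (f := Prod.swap) (g := fun x : E × F =>
      c.coord (κ.symm x.1 • χ.symm x.2)) h1 (contDiff_snd.prodMk contDiff_fst).contDiffAt
  have h3 := ContinuousAt.comp (x := m) (f := χ) h2.continuousAt (continuousAt_extChartAt m)
  refine h3.congr ?_
  filter_upwards [extChartAt_source_mem_nhds (I := 𝓘(ℝ, F)) m, c.isOpen_dom.mem_nhds c.mem_dom]
    with q hq hq'
  have hmd : MD E F (fun a : G => c.coord (a • q)) 1 := by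
    have h4 : MD F F c.coord ((1 : G) • q) := by rw [one_smul]; exact c.md_coord hq'
    exact MDifferentiableAt.comp (1 : G) h4 (md_smul_const 1 q)
  rw [D_eq_fderiv_written hmd, Function.comp_apply, χ.left_inv hq]
  rfl

/-- Infinitesimal stabilizers in the torus are upper semicontinuous. -/
theorem eventually_genE_eq_zero [CompactSpace G] [T2Space M] (T : MaximalTorus G) (m : M) :
    ∀ᶠ q in 𝓝 m, ∀ X ∈ tE E T, genE E G F q X = 0 → genE E G F m X = 0 := by
  have hfix : ∀ h ∈ torusStab T m, h • m = m := fun h hh => (mem_torusStab.1 hh).2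
  obtain ⟨c⟩ := exists_linearChart E F (isCompact_torusStab E F T m) hfix
  obtain ⟨π, hπ, hπ'⟩ := exists_invariant_projection E F (isCompact_torusStab E F T m) hfix
  set f : tE E T →ₗ[ℝ] F := (genE E G F m).toLinearMap ∘ₗ (tE E T).subtype with hf
  obtain ⟨C, hC⟩ := (LinearMap.ker f).exists_isCompl
  -- Up to sign, the invariant part of the generating fields of a complement `C` of the stabilizer
  -- of `m`. It is injective at `m`, hence near `m`.
  set Ψ : M → C →L[ℝ] F := fun q => (π.comp (D E F (fun a : G => c.coord (a • q)) 1)).comp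
    ((tE E T).subtypeL.comp C.subtypeL) with hΨ
  have hΨc : ContinuousAt Ψ m :=
    (continuousAt_const.clm_comp (continuousAt_D_coord_smul c)).clm_comp continuousAt_const
  have hΨm : Function.Injective (Ψ m) := by
    rw [injective_iff_map_eq_zero]
    intro Y hY
    have hYT : ((Y : tE E T) : E) ∈ tE E T := (Y : tE E T).2
    have h1 : π (D E F (fun a : G => c.coord (a • m)) 1 ((Y : tE E T) : E)) = 0 := hY
    rw [D_coord_smul c c.mem_dom, c.D_coord, map_neg, neg_eq_zero,
      ContinuousLinearMap.id_apply, hπ' _ ?_] at h1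
    · have h2 : (Y : tE E T) ∈ LinearMap.ker f := h1
      have h3 := hC.disjoint.le_bot ⟨h2, Y.2⟩
      exact Subtype.ext ((Submodule.mem_bot ℝ).1 h3)
    -- As `T` is abelian, `k` maps the orbit curve of `Y` through `m` to itself and so fixes its
    -- velocity.
    · intro k hk
      have h2 := hasVel_expE_smul (F := F) (G := G) ((Y : tE E T) : E) m
      have h3 := h2.comp (md_const_smul E k m)
      have h4 : HasVel (fun s : ℝ => k • expE G (s • ((Y : tE E T) : E)) • m) 0 m
          (-genE E G F m ((Y : tE E T) : E)) := by
        refine h2.congr (Eventually.of_forall fun s => ?_)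
        simp only
        rw [← mul_smul, (commute_of_mem (mem_torusStab.1 hk).1
          (expE_mem (Submodule.smul_mem _ s hYT))).eq, mul_smul, hfix k hk]
      have h5 := h3.unique h4
      rw [map_neg, neg_inj] at h5
      exact h5
  filter_upwards [hΨc.eventually (ContinuousLinearMap.isOpen_injective.mem_nhds hΨm),
    c.isOpen_dom.mem_nhds c.mem_dom] with q hq hqd X hX hqX
  obtain ⟨Z, hZ, Y, hY, hZY⟩ := Submodule.mem_sup.1
    (hC.sup_eq_top ▸ Submodule.mem_top : (⟨X, hX⟩ : tE E T) ∈ LinearMap.ker f ⊔ C)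
  have hZY' : (Z : E) + (Y : E) = X := congrArg Subtype.val hZY
  have hZm : genE E G F m (Z : E) = 0 := hZ
  -- The map `π ∘ coord` is invariant under the stabilizer of `m`, so it is constant along the orbit
  -- of `exp (s Z)` even at points that `Z` does not fix.
  have hZ0 : π (D F F c.coord q (genE E G F q (Z : E))) = 0 := by
    have h1 := ((hasVel_expE_smul (F := F) (G := G) (Z : E) q).comp (c.md_coord hqd)).hasDerivAt
    have h2 := π.hasFDerivAt.comp_hasDerivAt (0 : ℝ) h1
    have h3 : HasDerivAt (fun s : ℝ => π (c.coord (expE G (s • (Z : E)) • q))) 0 0 := by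
      refine (hasDerivAt_const (0 : ℝ) (π (c.coord q))).congr_of_eventuallyEq
        (Eventually.of_forall fun s => ?_)
      have hs := expE_mem_torusStab Z.2 hZm s
      simp only
      rw [c.coord_smul _ hs _ hqd, hπ _ hs]
    have h4 := h2.unique h3
    rwa [map_neg, map_neg, neg_eq_zero] at h4
  have hY0 : Ψ q ⟨Y, hY⟩ = 0 := by
    change π (D E F (fun a : G => c.coord (a • q)) 1 (Y : E)) = 0
    have h1 : (Y : E) = X - Z := by rw [← hZY', add_sub_cancel_left]
    rw [D_coord_smul c hqd, h1, map_sub, hqX, zero_sub]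
    simp only [map_neg, neg_neg, hZ0]
  have hY0' : Y = 0 := congrArg Subtype.val ((injective_iff_map_eq_zero _).1 hq _ hY0)
  rw [← hZY', hY0', ZeroMemClass.coe_zero, add_zero, hZm]

end Semicontinuity

/-! ### Local constancy of moment map components, and members of `𝒲` -/

section Moment

variable {E : Type*} [NormedAddCommGroup E] [NormedSpace ℝ E] [FiniteDimensional ℝ E]
variable {G : Type*} [TopologicalSpace G] [ChartedSpace E G] [Group G] [LieGroup 𝓘(ℝ, E) ∞ G]
  [T2Space G] [CompactSpace G]
variable {F : Type*} [NormedAddCommGroup F] [NormedSpace ℝ F] [FiniteDimensional ℝ F]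
variable {M : Type*} [TopologicalSpace M] [ChartedSpace F M] [IsManifold 𝓘(ℝ, F) ∞ M]
  [T2Space M] [MulAction G M] [ContMDiffSMul 𝓘(ℝ, E) 𝓘(ℝ, F) ∞ G M]
variable {B : InvariantInnerProduct E G} {T : MaximalTorus G} {N : Tube B T}
  {Q : QHamiltonianSpace F M B}

theorem Xhat.ext' {p q : Xhat N Q} (h : p.pt = q.pt) (h' : p.momE = q.momE) : p = q :=
  Subtype.ext (Prod.ext h (Subtype.ext h'))

/-- Local sections of the covering `X̂ → 𝒳`. -/
theorem exists_section (p : Xhat N Q) : ∃ (σ : M → Xhat N Q) (O : Set M), IsOpen O ∧ p.pt ∈ O ∧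
    σ p.pt = p ∧ (∀ m ∈ O, (σ m).pt = m) ∧ ContinuousOn σ O ∧
    (∀ m ∈ O, MD F E (fun m => (σ m).momE) m) ∧ ∀ᶠ q in 𝓝 p, σ q.pt = q := by
  classical
  obtain ⟨ξ, O, hO, hpO, hOX, hξT, hξp, hξd, hξe, hξq⟩ := exists_lift p
  set σ : M → Xhat N Q := fun m => if h : m ∈ O then
    ⟨(m, ⟨(ξ m : E), hξT m⟩), hOX h, hξe m h⟩ else p with hσ
  have hσO : ∀ m (h : m ∈ O), σ m = ⟨(m, ⟨(ξ m : E), hξT m⟩), hOX h, hξe m h⟩ := fun m h => by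
    simp only [hσ, dif_pos h]
  have hpt : ∀ m ∈ O, (σ m).pt = m := fun m h => by rw [hσO m h]; rfl
  have hmom : ∀ m ∈ O, (σ m).momE = ξ m := fun m h => by rw [hσO m h]; rfl
  refine ⟨σ, O, hO, hpO, Xhat.ext' (hpt _ hpO) ((hmom _ hpO).trans hξp), hpt, ?_, ?_, ?_⟩
  · refine Topology.IsInducing.subtypeVal.continuousOn_iff.2 ?_
    have h1 : ContinuousOn (fun m => (m, (⟨(ξ m : E), hξT m⟩ : T.lie (E := E)))) O := by
      refine continuousOn_id.prodMk ?_
      refine Topology.IsInducing.subtypeVal.continuousOn_iff.2 ?_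
      exact fun m hm => (hξd m hm).continuousAt.continuousWithinAt
    exact h1.congr fun m hm => by rw [Function.comp_apply, hσO m hm]
  · intro m hm
    refine (hξd m hm).congr_of_eventuallyEq ?_
    filter_upwards [hO.mem_nhds hm] with m' hm' using hmom m' hm'
  · have h1 : ∀ᶠ q : Xhat N Q in 𝓝 p, q.pt ∈ O :=
      Xhat.continuous_pt.continuousAt.eventually (hO.mem_nhds hpO)
    filter_upwards [hξq, h1] with q hq hqO
    exact Xhat.ext' (hpt _ hqO) ((hmom _ hqO).trans hq.symm)

/-- The component of the moment map along `X` is locally constant on the zeros of `X`. -/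
theorem eventually_bE_momE_eq (p : Xhat N Q) {X : E} (hX : X ∈ tE E T)
    (hp : genE E G F p.pt X = 0) :
    ∀ᶠ q : Xhat N Q in 𝓝 p, genE E G F q.pt X = 0 → bE B q.momE X = bE B p.momE X := by
  obtain ⟨σ, O, hO, hpO, hσp, hσpt, hσc, hσd, hσq⟩ := exists_section p
  obtain ⟨c⟩ := exists_linearChart E F (isCompact_torusStab E F T p.pt)
    fun h hh => (mem_torusStab.1 hh).2
  have h1 : ∀ᶠ v in 𝓝 (0 : F), v ∈ c.ball ∧ c.param v ∈ O := by
    refine Filter.Eventually.and (c.isOpen_ball.mem_nhds c.zero_mem) ?_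
    refine (c.smooth_param 0 c.zero_mem).continuousAt.eventually (hO.mem_nhds ?_)
    rw [c.param_zero]; exact hpO
  obtain ⟨r, hr, hball⟩ := Metric.eventually_nhds_iff_ball.1 h1
  have h2 : ∀ᶠ m in 𝓝 p.pt, m ∈ c.dom ∧ c.coord m ∈ Metric.ball (0 : F) r := by
    refine Filter.Eventually.and (c.isOpen_dom.mem_nhds c.mem_dom) ?_
    refine (c.smooth_coord _ c.mem_dom).continuousAt.eventually (Metric.isOpen_ball.mem_nhds ?_)
    rw [c.coord_self]; exact Metric.mem_ball_self hr
  filter_upwards [hσq, Xhat.continuous_pt.continuousAt.eventually h2] with q hq hq2 hqX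
  obtain ⟨hqd, hqv⟩ := hq2
  set v := c.coord q.pt with hv
  have hψv : c.param v = q.pt := c.param_coord hqd (hball _ hqv).1
  -- In the chart the zeros of `X` are the kernel of a linear map, so the whole segment from `0` to
  -- `v` consists of zeros.
  have hAv : infAct G F X p.pt v = 0 := by
    rw [← genE_param_eq_zero_iff c hX hp (hball _ hqv).1, hψv, hqX]
  have hsv : ∀ s ∈ Icc (0 : ℝ) 1, s • v ∈ Metric.ball (0 : F) r := fun s hs => by
    rw [mem_ball_zero_iff] at hqv ⊢
    rw [norm_smul, Real.norm_of_nonneg hs.1]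
    exact (mul_le_of_le_one_left (norm_nonneg _) hs.2).trans_lt hqv
  set g : ℝ → ℝ := fun s => bE B (σ (c.param (s • v))).momE X with hg
  have hgd : ∀ s ∈ Icc (0 : ℝ) 1, HasDerivAt g 0 s := by
    intro s hs
    obtain ⟨hb, hbO⟩ := hball _ (hsv s hs)
    have hx : HasVel (fun u : ℝ => c.param (u • v)) s (c.param (s • v))
        (D F F c.param (s • v) ((1 : ℝ) • v)) :=
      (((hasDerivAt_id s).smul_const v).hasVel rfl).comp (c.md_param hb)
    have hξ := (hx.comp (hσd _ hbO)).hasDerivAt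
    have hgen : genE E G F (c.param (s • v)) X = 0 := by
      rw [genE_param_eq_zero_iff c hX hp hb, map_smul, hAv, smul_zero]
    have h0 := bE_deriv_lift_eq_zero (N := N) (Q := Q) hx
      (by have := (σ (c.param (s • v))).2.1; rwa [← hσpt _ hbO]) hX hgen
      (ξ := fun u => (σ (c.param (u • v))).momE) (fun u => Xhat.momE_mem _) hξ (by
        filter_upwards [hx.continuousAt.eventually (hO.mem_nhds hbO)] with u hu
        rw [← Xhat.proj_eq, hσpt _ hu])
    have h3 := (LinearMap.toContinuousLinearMap ((bE B).flip X)).hasFDerivAt.comp_hasDerivAt s hξ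
    have h4 : HasDerivAt g (bE B _ X) s := h3
    rwa [h0] at h4
  have h5 := constant_of_has_deriv_right_zero
    (fun s hs => (hgd s hs).continuousAt.continuousWithinAt)
    (fun s hs => (hgd s (Ico_subset_Icc_self hs)).hasDerivWithinAt) 1 (right_mem_Icc.2 zero_le_one)
  simp only [hg, one_smul, zero_smul, hψv, c.param_zero, hq, hσp] at h5
  exact h5

/-- A locally constant function on the fixed point set is constant on its connected components. -/
theorem bE_momE_eq_of_mem_connectedComponentIn {K : Set (T.lie (E := E))} {p q : Xhat N Q}
    (hp : p ∈ fixedSet N Q K) (hq : q ∈ connectedComponentIn (fixedSet N Q K) p)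
    {X : T.lie (E := E)} (hX : X ∈ K) : bE B q.momE (X : LieAlg E G) = bE B p.momE (X : LieAlg E G) := by
  have hsub := connectedComponentIn_subset (fixedSet N Q K) p
  refine (isPreconnected_connectedComponentIn (F := fixedSet N Q K) (x := p)).induction₂
    (fun x y : Xhat N Q => bE B y.momE (X : LieAlg E G) = bE B x.momE (X : LieAlg E G)) (fun x hx => ?_)
    (fun x y z _ _ _ h h' => h'.trans h) (fun x y _ _ h => h.symm)
    (mem_connectedComponentIn hp) hq
  rw [eventually_nhdsWithin_iff]
  filter_upwards [eventually_bE_momE_eq x X.2 (hsub hx X hX)] with y hy hy'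
  exact hy (hsub hy' X hX)

/-- A point fixed by an infinitesimal stabilizer `K` determines an element of `𝒲`. -/
theorem mk'_mem_calW {K : Submodule ℝ (T.lie (E := E))} (hK : K ∈ stabilizers N Q) {p : Xhat N Q}
    (hp : p ∈ fixedSet N Q (K : Set (T.lie (E := E)))) :
    AffineSubspace.mk' p.moment (perp B T K) ∈ calW N Q := by
  refine ⟨K, hK, p, hp, AffineSubspace.direction_mk' _ _, fun q hq => ?_⟩
  rw [AffineSubspace.mem_mk']
  intro X hX
  have h1 := bE_momE_eq_of_mem_connectedComponentIn hp hq hX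
  have h2 : ∀ Y : E, bE B Y (q.momE - p.momE) = bE B q.momE Y - bE B p.momE Y := fun Y => by
    rw [bE_symm, map_sub, LinearMap.sub_apply]
  exact (h2 (X : LieAlg E G)).trans (sub_eq_zero.2 h1)

theorem stab_mem_stabilizers (p : Xhat N Q) : p.stab ∈ stabilizers N Q :=
  ⟨p.pt, p.2.1, rfl⟩

end Moment

/-! ### Orthogonal complements and affine subspaces of `𝔱` -/

section Perp

variable {E : Type*} [NormedAddCommGroup E] [NormedSpace ℝ E] [FiniteDimensional ℝ E]
variable {G : Type*} [TopologicalSpace G] [ChartedSpace E G] [Group G]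
variable {B : InvariantInnerProduct E G} {T : MaximalTorus G}

/-- The inclusion of the Lie algebra of the torus into the model space. -/
def toE (X : T.lie (E := E)) : E := (X : LieAlg E G)

theorem toE_mem (X : T.lie (E := E)) : toE X ∈ tE E T := X.2

theorem mk'_le_mk' {V : Type*} [AddCommGroup V] [Module ℝ V] (y : V) {K K' : Submodule ℝ V}
    (h : K ≤ K') : AffineSubspace.mk' y K ≤ AffineSubspace.mk' y K' := fun x hx => by
  rw [AffineSubspace.mem_mk'] at hx ⊢
  exact h hx

theorem eq_zero_of_mem_perp {K : Submodule ℝ (T.lie (E := E))} {X : T.lie (E := E)} (h : X ∈ K)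
    (h' : X ∈ perp B T K) : X = 0 := by
  by_contra hne
  exact (B.pos X fun h0 => hne (Subtype.ext h0)).ne' (h' X h)

theorem perp_perp (K : Submodule ℝ (T.lie (E := E))) : perp B T (perp B T K) = K := by
  have : FiniteDimensional ℝ (LieAlg E G) := inferInstanceAs (FiniteDimensional ℝ E)
  have hs : ∀ X Y, B.form.restrict T.lie X Y = B.form.restrict T.lie Y X := fun X Y => B.symm X Y
  exact LinearMap.BilinForm.orthogonal_orthogonal
    (nondegenerate_of_pos hs fun X hX => B.pos X fun h0 => hX (Subtype.ext h0))
    (fun X Y h => (hs Y X).trans h) K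

theorem perp_anti {K K' : Submodule ℝ (T.lie (E := E))} (h : K ≤ K') : perp B T K' ≤ perp B T K :=
  LinearMap.BilinForm.orthogonal_le h

theorem perp_orth (Δ : AffineSubspace ℝ (T.lie (E := E))) :
    perp B T (orth B T Δ) = Δ.direction := perp_perp _

theorem orth_mk' (x : T.lie (E := E)) (K : Submodule ℝ (T.lie (E := E))) :
    orth B T (AffineSubspace.mk' x (perp B T K)) = K := by
  rw [orth, AffineSubspace.direction_mk', perp_perp]

theorem isProj_mk' {x y : T.lie (E := E)} {K : Submodule ℝ (T.lie (E := E))} (h : x - y ∈ K) :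
    IsProj B T (AffineSubspace.mk' y (perp B T K)) x y :=
  ⟨AffineSubspace.self_mem_mk' _ _, by rwa [orth_mk']⟩

theorem eq_mk'_of_orth_eq {Δ : AffineSubspace ℝ (T.lie (E := E))} {y : T.lie (E := E)} (hy : y ∈ Δ)
    {K : Submodule ℝ (T.lie (E := E))} (h : orth B T Δ = K) :
    Δ = AffineSubspace.mk' y (perp B T K) := by
  rw [← h, perp_orth, AffineSubspace.mk'_eq hy]

end Perp

/-! ### Consequences of genericity -/

section Generic

variable {E : Type*} [NormedAddCommGroup E] [NormedSpace ℝ E] [FiniteDimensional ℝ E]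
variable {G : Type*} [TopologicalSpace G] [ChartedSpace E G] [Group G] [LieGroup 𝓘(ℝ, E) ∞ G]
  [T2Space G] [CompactSpace G]
variable {F : Type*} [NormedAddCommGroup F] [NormedSpace ℝ F] [FiniteDimensional ℝ F]
variable {M : Type*} [TopologicalSpace M] [ChartedSpace F M] [IsManifold 𝓘(ℝ, F) ∞ M]
  [T2Space M] [MulAction G M] [ContMDiffSMul 𝓘(ℝ, E) 𝓘(ℝ, F) ∞ G M]
variable {B : InvariantInnerProduct E G} {T : MaximalTorus G} {N : Tube B T}
  {Q : QHamiltonianSpace F M B} {γ β : T.lie (E := E)}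

/-- Two nested elements of `𝒲` onto which `γ` has the same projection coincide. -/
theorem IsGeneric.eq_of_le (hγ : IsGeneric N Q γ) {Δ Δ' : AffineSubspace ℝ (T.lie (E := E))}
    (hΔ : Δ ∈ calW N Q) (hΔ' : Δ' ∈ calW N Q) (hle : Δ' ≤ Δ) (h : IsProj B T Δ γ β)
    (h' : IsProj B T Δ' γ β) : Δ' = Δ := by
  by_contra hne
  exact hγ.1 Δ hΔ Δ' hΔ' (lt_of_le_of_ne hle hne) β β h h' rfl

theorem mk'_perp_stab_mem_calW (p : Xhat N Q) :
    AffineSubspace.mk' p.moment (perp B T p.stab) ∈ calW N Q :=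
  mk'_mem_calW (stab_mem_stabilizers p) fun _ hX => hX

theorem le_stab_iff {K : Submodule ℝ (T.lie (E := E))} {p : Xhat N Q} :
    K ≤ p.stab ↔ p ∈ fixedSet N Q (K : Set (T.lie (E := E))) := Iff.rfl

/-- A larger stabilizer would give a smaller member `Δ_p ⊆ Δ` of `𝒲` through `β`. Since `γ - β ∈ 𝔱_Δ
⊆ 𝔨`, it would also project `γ` to `β`, which genericity excludes. -/
theorem stab_eq_orth (hγ : IsGeneric N Q γ) {Δ : AffineSubspace ℝ (T.lie (E := E))}
    (hΔ : Δ ∈ calW N Q) (hβ : IsProj B T Δ γ β) {p : Xhat N Q} (hp : p ∈ piece N Q Δ β) :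
    p.stab = orth B T Δ := by
  obtain ⟨h1, rfl⟩ := hp
  have h2 : orth B T Δ ≤ p.stab := le_stab_iff.2 h1
  have h3 : AffineSubspace.mk' p.moment (perp B T p.stab) ≤ Δ := by
    rw [eq_mk'_of_orth_eq (B := B) hβ.1 rfl]
    exact mk'_le_mk' _ (perp_anti h2)
  rw [← hγ.eq_of_le hΔ (mk'_perp_stab_mem_calW p) h3 hβ (isProj_mk' (h2 hβ.2)), orth_mk']

/-- Vectors tangent to the fixed point set of `K` are annihilated by `K`. -/
theorem infAct_eq_zero_of_mem_tangentTo {K : Set (T.lie (E := E))} {p : Xhat N Q} {w : F}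
    (hw : w ∈ (tangentTo (fixedSet N Q K) p : Submodule ℝ F)) {X : T.lie (E := E)} (hX : X ∈ K) :
    infAct G F (toE X) p.pt w = 0 := by
  suffices (tangentTo (fixedSet N Q K) p : Submodule ℝ F) ≤
      LinearMap.ker (infAct G F (toE X) p.pt : F →ₗ[ℝ] F) from this hw
  refine Submodule.span_le.2 ?_
  rintro w ⟨δ, c, hδ, rfl, hcS, -, hc, rfl⟩
  have h0 : Ioo (-δ) δ ∈ 𝓝 (0 : ℝ) := Ioo_mem_nhds (by linarith) hδ
  have h1 : MD ℝ F (fun s => (c s).pt) 0 := (hc.contMDiffAt h0).mdifferentiableAt (by simp)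
  have h2 : HasVel (fun s => (c s).pt) 0 (c 0).pt (D ℝ F (fun s => (c s).pt) 0 1) := ⟨rfl, h1, rfl⟩
  refine infAct_eq_zero_of_hasVel h2 ?_
  filter_upwards [h0] with s hs using hcS s hs X hX

/-- For generic `γ`, the vectors annihilated by `β - γ` are tangent to the fixed point set. -/
theorem mem_tangentTo_of_infAct_eq_zero (hγ : IsGeneric N Q γ)
    {Δ : AffineSubspace ℝ (T.lie (E := E))} (hΔ : Δ ∈ calW N Q) (hβ : IsProj B T Δ γ β)
    {p : Xhat N Q} (hp : p ∈ piece N Q Δ β) {w : F}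
    (hw : infAct G F (toE (β - γ)) p.pt w = 0) :
    w ∈ (tangentTo (fixedSet N Q (orth B T Δ : Set (T.lie (E := E)))) p : Submodule ℝ F) := by
  have hstab := stab_eq_orth hγ hΔ hβ hp
  have hmom : p.moment = β := hp.2
  obtain ⟨σ, O, hO, hpO, hσp, hσpt, hσc, -, -⟩ := exists_section p
  obtain ⟨c⟩ := exists_linearChart E F (isCompact_torusStab E F T p.pt)
    fun h hh => (mem_torusStab.1 hh).2
  have h1 : ∀ᶠ v in 𝓝 (0 : F), v ∈ c.ball ∧ c.param v ∈ O ∧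
      ∀ X ∈ tE E T, genE E G F (c.param v) X = 0 → genE E G F p.pt X = 0 := by
    refine Filter.Eventually.and (c.isOpen_ball.mem_nhds c.zero_mem) ?_
    refine (c.smooth_param 0 c.zero_mem).continuousAt.eventually
      (p := fun m => m ∈ O ∧ ∀ X ∈ tE E T, genE E G F m X = 0 → genE E G F p.pt X = 0) ?_
    rw [c.param_zero]
    exact Filter.Eventually.and (hO.mem_nhds hpO) (eventually_genE_eq_zero T p.pt)
  have h2 : ∀ᶠ s in 𝓝 (0 : ℝ), s • w ∈ c.ball ∧ c.param (s • w) ∈ O ∧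
      ∀ X ∈ tE E T, genE E G F (c.param (s • w)) X = 0 → genE E G F p.pt X = 0 := by
    have hc : ContinuousAt (fun s : ℝ => s • w) 0 := by fun_prop
    refine hc.eventually (p := fun v => v ∈ c.ball ∧ c.param v ∈ O ∧
      ∀ X ∈ tE E T, genE E G F (c.param v) X = 0 → genE E G F p.pt X = 0) ?_
    simp only [zero_smul]; exact h1
  obtain ⟨δ, hδ, hball⟩ := Metric.eventually_nhds_iff_ball.1 h2
  rw [Real.ball_eq_Ioo, zero_sub, zero_add] at hball
  set x : ℝ → Xhat N Q := fun s => σ (c.param (s • w)) with hx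
  have hxpt : ∀ s ∈ Ioo (-δ) δ, (x s).pt = c.param (s • w) := fun s hs => hσpt _ (hball s hs).2.1
  have hx0 : x 0 = p := by simp only [hx, zero_smul, c.param_zero, hσp]
  have hfix : ∀ s ∈ Ioo (-δ) δ, ∀ X ∈ p.stab,
      infAct G F (toE X) p.pt w = 0 → X ∈ (x s).stab := fun s hs X hX hXw => by
    change genE E G F (x s).pt (toE X) = 0
    rw [hxpt s hs, genE_param_eq_zero_iff c (toE_mem X) hX (hball s hs).1, map_smul, hXw, smul_zero]
  -- Any non-zero parameter would do: the stabilizer there consists of the `X` in the stabilizer of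
  -- `p` that annihilate `w`, whatever the parameter.
  have hs₁ : δ / 2 ∈ Ioo (-δ) δ := ⟨by linarith, by linarith⟩
  set K := (x (δ / 2)).stab with hK
  have hKp : ∀ X ∈ K, X ∈ p.stab ∧ infAct G F (toE X) p.pt w = 0 := fun X hX => by
    have h3 : genE E G F (x (δ / 2)).pt (toE X) = 0 := hX
    rw [hxpt _ hs₁] at h3
    have h4 := (hball _ hs₁).2.2 _ (toE_mem X) h3
    rw [genE_param_eq_zero_iff c (toE_mem X) h4 (hball _ hs₁).1, map_smul] at h3
    exact ⟨h4, (smul_eq_zero.1 h3).resolve_left (by linarith)⟩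
  have hKle : K ≤ p.stab := fun X hX => (hKp X hX).1
  have hmem : AffineSubspace.mk' β (perp B T K) ∈ calW N Q :=
    hmom ▸ mk'_mem_calW (stab_mem_stabilizers _) (le_stab_iff.1 hKle)
  have hγβ : γ - β ∈ K := by
    have h3 : β - γ ∈ p.stab := by
      rw [hstab, ← neg_sub]; exact Submodule.neg_mem _ hβ.2
    rw [← neg_sub]
    exact Submodule.neg_mem _ (hfix _ hs₁ _ h3 hw)
  -- Here the comparison runs opposite to `stab_eq_orth`: the smaller stabilizer `K` gives a member
  -- of `𝒲` containing `Δ`.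
  have hle : Δ ≤ AffineSubspace.mk' β (perp B T K) := by
    rw [eq_mk'_of_orth_eq hβ.1 hstab.symm]
    exact mk'_le_mk' β (perp_anti hKle)
  have hΔK : orth B T Δ = K := by
    rw [hγ.eq_of_le hmem hΔ hle (isProj_mk' hγβ) hβ, orth_mk']
  have hvel : HasVel (fun s : ℝ => c.param (s • w)) 0 p.pt w := by
    have h3 : HasVel (fun s : ℝ => s • w) 0 (0 : F) w := by
      have h4 := (hasDerivAt_id (0 : ℝ)).smul_const w
      rw [one_smul] at h4
      exact h4.hasVel (zero_smul ℝ w)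
    have h4 := h3.comp (c.md_param c.zero_mem)
    rwa [c.D_param, c.param_zero] at h4
  have hsm : ContMDiffOn 𝓘(ℝ, ℝ) 𝓘(ℝ, F) ∞ (fun s : ℝ => c.param (s • w)) (Ioo (-δ) δ) :=
    fun s hs => (ContMDiffAt.comp s (c.smooth_param _ (hball s hs).1)
      (contDiff_id.smul contDiff_const).contDiffAt.contMDiffAt).contMDiffWithinAt
  refine Submodule.subset_span ⟨δ, x, hδ, hx0, fun s hs X hX => ?_, ?_, hsm.congr hxpt, ?_⟩
  · rw [hΔK] at hX
    exact hfix s hs X (hKp X hX).1 (hKp X hX).2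
  · exact hσc.comp hsm.continuousOn fun s hs => (hball s hs).2.1
  · have h3 : HasVel (fun s => (x s).pt) 0 p.pt w := hvel.congr (by
      filter_upwards [Ioo_mem_nhds (by linarith : -δ < 0) hδ] with s hs using hxpt s hs)
    exact h3.2.2.symm

/-- For generic `γ`, the action of `β - γ` on the normal space of the fixed point set is injective. -/
theorem mem_tangentTo_of_infAct_mem_tangentTo (hγ : IsGeneric N Q γ)
    {Δ : AffineSubspace ℝ (T.lie (E := E))} (hΔ : Δ ∈ calW N Q) (hβ : IsProj B T Δ γ β)
    {p : Xhat N Q} (hp : p ∈ piece N Q Δ β) (hβγ : β - γ ∈ orth B T Δ) {w : F}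
    (hw : infAct G F (toE (β - γ)) p.pt w ∈
      (tangentTo (fixedSet N Q (orth B T Δ : Set (T.lie (E := E)))) p : Submodule ℝ F)) :
    w ∈ (tangentTo (fixedSet N Q (orth B T Δ : Set (T.lie (E := E)))) p : Submodule ℝ F) := by
  have hgen : genE E G F p.pt (toE (β - γ)) = 0 := hp.1 _ hβγ
  have h1 : infAct G F (toE (β - γ)) p.pt (infAct G F (toE (β - γ)) p.pt w) = 0 :=
    infAct_eq_zero_of_mem_tangentTo hw hβγ
  exact mem_tangentTo_of_infAct_eq_zero hγ hΔ hβ hp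
    (infAct_eq_zero_of_sq (toE_mem (β - γ)) hgen h1)

end Generic

end QHam

end

/-! ### Assembly of the theorem -/

theorem mainTheorem8
    {E : Type*} [NormedAddCommGroup E] [NormedSpace ℝ E] [FiniteDimensional ℝ E]
    {G : Type*} [TopologicalSpace G] [ChartedSpace E G] [Group G] [LieGroup 𝓘(ℝ, E) ∞ G]
    [T2Space G] [CompactSpace G] [ConnectedSpace G]
    {F : Type*} [NormedAddCommGroup F] [NormedSpace ℝ F] [FiniteDimensional ℝ F]
    {M : Type*} [TopologicalSpace M] [ChartedSpace F M] [IsManifold 𝓘(ℝ, F) ∞ M]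
    [T2Space M] [SecondCountableTopology M]
    [MulAction G M] [ContMDiffSMul 𝓘(ℝ, E) 𝓘(ℝ, F) ∞ G M]
    (B : QHam.InvariantInnerProduct E G) (T : QHam.MaximalTorus G) (N : QHam.Tube B T)
    (Q : QHam.QHamiltonianSpace F M B)
    (γ : T.lie (E := E)) (hγ : QHam.IsGeneric N Q γ) :
    (∀ β : T.lie (E := E),
      QHam.calZ N Q γ β =
        (⋃ Δ ∈ {Δ ∈ QHam.calW N Q | QHam.IsProj B T Δ γ β}, QHam.piece N Q Δ β) ∧
      {Δ ∈ QHam.calW N Q | QHam.IsProj B T Δ γ β}.PairwiseDisjoint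
        (fun Δ => QHam.piece N Q Δ β)) ∧
    (∀ Δ ∈ QHam.calW N Q, ∀ β : T.lie (E := E), QHam.IsProj B T Δ γ β →
      ∀ p ∈ QHam.piece N Q Δ β,
        p.stab = QHam.orth B T Δ ∧
        (∀ X ∈ QHam.perp B T (QHam.orth B T Δ), p.gen X = 0 → X = 0) ∧
        ∃ hβ : β - γ ∈ QHam.orth B T Δ,
          (∀ α : Module.Dual ℝ (QHam.orth B T Δ),
            QHam.IsNormalWeight (QHam.orth B T Δ) p α → α ⟨β - γ, hβ⟩ ≠ 0) ∧
          (∀ w : TangentSpace 𝓘(ℝ, F) p.pt,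
            (Submodule.Quotient.mk (QHam.linAct p (β - γ) w) :
              QHam.NormalSpace (QHam.fixedSet N Q (QHam.orth B T Δ)) p) = 0 →
            (Submodule.Quotient.mk w :
              QHam.NormalSpace (QHam.fixedSet N Q (QHam.orth B T Δ)) p) = 0)) := by
  have hpiece : ∀ Δ ∈ QHam.calW N Q, ∀ β : T.lie (E := E), QHam.IsProj B T Δ γ β →
      ∀ p ∈ QHam.piece N Q Δ β, p.stab = QHam.orth B T Δ :=
    fun Δ hΔ β hβ p hp => QHam.stab_eq_orth hγ hΔ hβ hp
  refine ⟨fun β => ⟨?_, ?_⟩, fun Δ hΔ β hβ p hp => ?_⟩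
  · ext p
    simp only [Set.mem_iUnion, Set.mem_ofPred_eq, exists_prop]
    constructor
    · rintro ⟨hp, rfl⟩
      have h1 : γ - p.moment ∈ p.stab := by
        rw [← neg_sub]; exact Submodule.neg_mem _ (hp _ rfl)
      -- The piece containing `p` is that of `Δ_p`, the translate through `Φ̂_a(p)` of the
      -- orthogonal complement of its stabilizer.
      refine ⟨_, ⟨QHam.mk'_perp_stab_mem_calW p, QHam.isProj_mk' h1⟩, ?_, rfl⟩
      rw [QHam.orth_mk']
      exact fun X hX => hX
    · rintro ⟨Δ, ⟨hΔ, hβ⟩, hp, hpβ⟩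
      refine ⟨fun X hX => ?_, hpβ⟩
      rw [Set.mem_singleton_iff.1 hX, ← neg_sub]
      exact hp _ (Submodule.neg_mem _ hβ.2)
  · rintro Δ ⟨hΔ, hβ⟩ Δ' ⟨hΔ', hβ'⟩ hne
    refine Set.disjoint_left.2 fun p hp hp' => hne ?_
    -- A common point `p` determines both `Δ` and `Δ'` as `β` plus the complement of the stabilizer
    -- of `p`.
    rw [QHam.eq_mk'_of_orth_eq hβ.1 (hpiece Δ hΔ β hβ p hp).symm,
      QHam.eq_mk'_of_orth_eq hβ'.1 (hpiece Δ' hΔ' β hβ' p hp').symm]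
  · have hstab := hpiece Δ hΔ β hβ p hp
    have hβγ : β - γ ∈ QHam.orth B T Δ := by
      rw [← neg_sub]; exact Submodule.neg_mem _ hβ.2
    have hnormal : ∀ w : TangentSpace 𝓘(ℝ, F) p.pt,
        (Submodule.Quotient.mk (QHam.linAct p (β - γ) w) :
          QHam.NormalSpace (QHam.fixedSet N Q (QHam.orth B T Δ)) p) = 0 →
        (Submodule.Quotient.mk w :
          QHam.NormalSpace (QHam.fixedSet N Q (QHam.orth B T Δ)) p) = 0 := by
      intro w hw
      rw [Submodule.Quotient.mk_eq_zero] at hw ⊢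
      exact QHam.mem_tangentTo_of_infAct_mem_tangentTo hγ hΔ hβ hp hβγ hw
    refine ⟨hstab, fun X hX hX0 => ?_, hβγ, ?_, hnormal⟩
    · have h1 : X ∈ p.stab := hX0
      rw [hstab] at h1
      exact QHam.eq_zero_of_mem_perp h1 hX
    · rintro α ⟨u, v, huv, h⟩ hα
      obtain ⟨hu, hv⟩ := h ⟨β - γ, hβγ⟩
      -- A weight vanishing on `β - γ` would have weight vectors annihilated by it, against
      -- injectivity on the normal space.
      rw [hα, mul_zero, neg_zero, zero_smul] at hu
      rw [hα, mul_zero, zero_smul] at hv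
      exact huv.elim (fun h' => h' (hnormal u hu)) fun h' => h' (hnormal v hv)
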